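/- **Conventions.** Let $k$ be a commutative ring, $\Gamma$ an abelian group with a symmetric bilinear form $\langle\ ,\ \rangle\colon\Gamma\times\Gamma\to\mathbb Z/2$, and let $\iota\in\Gamma$ satisfy $\langle\iota,\iota\rangle=1$. A dg module is a $\Gamma$-graded $k$-module with a differential of degree $\iota$ and square zero; tensor products use the Koszul sign rule, so $d(m\otimes n)=dm\otimes n+(-1)^{\langle\iota,|m|\rangle}m\otimes dn$. The shift $q^jM$ has $(q^jM)^i=M^{i-j}$ and differential $(-1)^{\langle j,\iota\rangle}d$. A dg category is a category enriched in dg modules; write $\langle X|Y\rangle=\operatorname{Hom}(Y,X)$, with composition $\langle X|Y\rangle\otimes\langle Y|Z\rangle\to\langle X|Z\rangle$, $f\otimes g\mapsto f\circ g$. A bimodule $M$ over dg categories $A,B$ consists of dg modules $\langle X|M|Y\rangle$ with associative unital chain maps $\langle X'|A|X\rangle\otimes\langle X|M|Y\rangle\otimes\langle Y|B|Y'\rangle\to\langle X'|M|Y'\rangle$, and $\langle X|M\otimes_BN|Z\rangle=\bigl(\bigoplus_Y\langle X|M|Y\rangle\otimes\langle Y|N|Z\rangle\bigr)/(mf\otimes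 n-m\otimes fn)$. Let $C$ be a dg category. Its twisted envelope $\operatorname{Tw}(C)$ has as objects the pairs $\mathbf X=\operatorname{tw}_\alpha(X)$ with $X\in C$ and $\alpha\in\operatorname{End}^\iota_C(X)$, $d\alpha+\alpha^2=0$. Its morphisms $\operatorname{tw}_\alpha(X)\to\operatorname{tw}_\beta(Y)$ are those of $C$ from $X$ to $Y$, with the composition of $C$ and differential $f\mapsto df+\beta\circ f-(-1)^{\langle\iota,|f|\rangle}f\circ\alpha$. We regard $C\subset\operatorname{Tw}(C)$ by $X\mapsto\operatorname{tw}_0(X)$, which makes $\operatorname{Tw}(C)$ a $(\operatorname{Tw}(C),C)$- and a $(C,\operatorname{Tw}(C))$-bimodule. For $\mathbf Y=\operatorname{tw}_\beta(Y)$ let $\psi_{\mathbf Y}\colon Y\to\mathbf Y$ be the degree zero morphism given by $\mathrm{id}_Y$, with inverse $\psi_{\mathbf Y}^{-1}$ given by $\mathrm{id}_Y$. The two-sided bar complex $\operatorname{Bar}(C)$ is the $(C,C)$-bimodule $$\langle Y|\operatorname{Bar}(C)|Y'\rangle=\Bigl(\bigoplus_{r\ge0}\ B_r,\ d+\delta\Bigr),\qquad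 B_r=q^{-r\iota}\bigoplus_{X_0,\dots,X_r}\langle Y|X_0\rangle\otimes\langle X_0|X_1\rangle\otimes\cdots\otimes\langle X_r|Y'\rangle .$$ Write $[f_0,\dots,f_{r+1}]$ for its simple tensors of homogeneous morphisms, and $k_u=\langle\iota,|f_u|\rangle$. The differential $d+\delta$ sends $[f_0,\dots,f_{r+1}]$ to $$\sum_{i=0}^{r+1}(-1)^{r+k_0+\cdots+k_{i-1}}[\dots,d(f_i),\dots]+\sum_{i=0}^{r}(-1)^i[\dots,f_i\circ f_{i+1},\dots]$$ (the second sum being omitted for $r=0$), and the bimodule structure is $g\cdot[f_0,\dots,f_{r+1}]\cdot g'=(-1)^{r\langle\iota,|g|\rangle}[g\circ f_0,\dots,f_{r+1}\circ g']$. Put $\sigma(k_0,\dots,k_{r+1})=\sum_{u=0}^{r}(r+1-u)k_u$ and $[f_0,\dots,f_{r+1}]'=(-1)^{\sigma(k_0,\dots,k_{r+1})}[f_0,\dots,f_{r+1}]$. The completed bar complex $\overline{\operatorname{Bar}}(C)$ is defined by the same formulas, with the direct sum over the length $r$ replaced by the (degreewise) product: $\bigl(\prod_{r\ge0}B_r,\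 d+\delta\bigr)$, where each $B_r$ is still the direct sum over objects. **Statement.** Consider homogeneous $\mathbf f_0\in\langle\mathbf Y|\mathbf X_0\rangle$, $\mathbf f_u\in\langle\mathbf X_{u-1}|\mathbf X_u\rangle$ $(1\le u\le r)$, $\mathbf f_{r+1}\in\langle\mathbf X_r|\mathbf Y'\rangle$ in $\operatorname{Tw}(C)$, with $\mathbf X_u=\operatorname{tw}_{\alpha_u}(X_u)$, and let $f_u$ be the morphism of $C$ underlying $\mathbf f_u$. For $n=(n_0,\dots,n_r)\in\mathbb Z_{\ge0}^{r+1}$ let $$(h_0,\dots,h_{s+1})=(f_0,\underbrace{\alpha_0,\dots,\alpha_0}_{n_0},f_1,\underbrace{\alpha_1,\dots,\alpha_1}_{n_1},\dots,f_r,\underbrace{\alpha_r,\dots,\alpha_r}_{n_r},f_{r+1}),\qquad s=r+\sum_u n_u .$$ 1. There is a unique family of $k$-linear maps $$\Xi_{\operatorname{Tw}}\colon\langle\mathbf Y|\operatorname{Bar}(\operatorname{Tw}(C))|\mathbf Y'\rangle\to\langle\mathbf Y|\operatorname{Tw}(C)\otimes_C\overline{\operatorname{Bar}}(C)\otimes_C\operatorname{Tw}(C)|\mathbf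 Y'\rangle$$ (one for each pair of objects $\mathbf Y,\mathbf Y'$ of $\operatorname{Tw}(C)$) such that for all such sequences $$\Xi_{\operatorname{Tw}}([\mathbf f_0,\dots,\mathbf f_{r+1}]')=\psi_{\mathbf Y}\otimes\Bigl(\sum_{n_0,\dots,n_r\ge0}[h_0,\dots,h_{s+1}]'\Bigr)\otimes\psi_{\mathbf Y'}^{-1}.$$ Here the sum is taken in $\overline{\operatorname{Bar}}(C)$ componentwise: for each length only finitely many $n$ contribute. 2. $\Xi_{\operatorname{Tw}}$ is a closed degree zero morphism of $(\operatorname{Tw}(C),\operatorname{Tw}(C))$-bimodules: it preserves degrees, commutes with the differentials, and commutes with both actions. 3. In unprimed notation, $$\Xi_{\operatorname{Tw}}([\mathbf f_0,\dots,\mathbf f_{r+1}])=\psi_{\mathbf Y}\otimes\Bigl(\sum_{n_0,\dots,n_r\ge0}(-1)^{\tau(n)}[h_0,\dots,h_{s+1}]\Bigr)\otimes\psi_{\mathbf Y'}^{-1},$$ $$\tau(n)=\binom{n_0+\cdots+n_r+1}{2}+\sum_{u=0}^r(r-u)n_u+\sum_{0\le u\le u'\le r}k_u\,n_{u'},\qquad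 k_u=\langle\iota,|f_u|\rangle .$$ Moreover, with $l_v=\langle\iota,|h_v|\rangle$ (where $\langle\iota,|\alpha_u|\rangle=1$), one has $\sigma(l_0,\dots,l_{s+1})-\sigma(k_0,\dots,k_{r+1})=\tau(n)$ in $\mathbb Z/2$. -/

import Mathlib

namespace DG

noncomputable section
open scoped Classical
open scoped TensorProduct DirectSum
set_option linter.unusedSectionVars false
set_option linter.checkUnivs false

universe w w' w'' u u' u'' u₃ v v' v'' v₃ uk uΓ

/-- The sign datum on the grading group: a symmetric bilinear form with values in `ℤ/2` and an
element `ι` (the degree of all differentials) with `⟨ι, ι⟩ = 1`. -/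
class SignedGrading (Γ : Type*) [AddCommGroup Γ] where
  form : Γ →+ Γ →+ ZMod 2
  form_comm : ∀ i j, form i j = form j i
  ι : Γ
  form_ι_ι : form ι ι = 1

open SignedGrading

/-- The scalar `(-1)^a` for `a : ℤ/2`. -/
def sgn (k : Type*) [CommRing k] (a : ZMod 2) : k := (-1) ^ a.val

section sgn
variable (k : Type*) [CommRing k]

theorem sgn_zero : sgn k 0 = 1 := by simp [sgn]

theorem sgn_one : sgn k 1 = -1 := by
  have : (1 : ZMod 2).val = 1 := rfl
  simp [sgn, this]

theorem zmod2_cases (a : ZMod 2) : a = 0 ∨ a = 1 := by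
  revert a; decide

theorem sgn_add (a b : ZMod 2) : sgn k (a + b) = sgn k a * sgn k b := by
  have h : (1 : ZMod 2) + 1 = 0 := rfl
  rcases zmod2_cases a with rfl | rfl <;> rcases zmod2_cases b with rfl | rfl <;>
    simp [sgn_zero, sgn_one, h]

theorem sgn_mul_self (a : ZMod 2) : sgn k a * sgn k a = 1 := by
  rw [← sgn_add, CharTwo.add_self_eq_zero, sgn_zero]

end sgn

variable {k : Type uk} [CommRing k] {Γ : Type uΓ} [AddCommGroup Γ] [SignedGrading Γ]

variable (k Γ) in
/-- A differential `Γ`-graded `k`-module.  A graded module `{Mⁱ}` is encoded by its total module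
`⨁ Mⁱ` together with the submodules `gr i = Mⁱ`, of which it is the internal direct sum. -/
structure DGMod where
  carrier : Type w
  [acg : AddCommGroup carrier]
  [mod : Module k carrier]
  gr : Γ → Submodule k carrier
  indep : iSupIndep gr
  span : ⨆ i, gr i = ⊤
  d : carrier →ₗ[k] carrier
  d_mem : ∀ i, ∀ x ∈ gr i, d x ∈ gr (i + ι)
  d_d : ∀ x, d (d x) = 0

namespace DGMod

instance : CoeSort (DGMod.{w} k Γ) (Type w) := ⟨carrier⟩

instance (M : DGMod.{w} k Γ) : AddCommGroup M := M.acg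

instance (M : DGMod.{w} k Γ) : Module k M := M.mod

section lift
variable (M : DGMod.{w} k Γ) {N : Type w'} [AddCommGroup N] [Module k N]

theorem internal : DirectSum.IsInternal M.gr :=
  DirectSum.isInternal_submodule_of_iSupIndep_of_iSup_eq_top M.indep M.span

/-- The linear map that is `F i` on the component of degree `i`. -/
def lift (F : Γ → M →ₗ[k] N) : M →ₗ[k] N :=
  (DirectSum.toModule k Γ N fun i => F i ∘ₗ (M.gr i).subtype) ∘ₗ
    (LinearEquiv.ofBijective (DirectSum.coeLinearMap M.gr) M.internal).symm.toLinearMap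

theorem lift_apply (F : Γ → M →ₗ[k] N) {i : Γ} {x : M} (hx : x ∈ M.gr i) :
    M.lift F x = F i x := by
  have : (LinearEquiv.ofBijective (DirectSum.coeLinearMap M.gr) M.internal).symm x
      = DirectSum.lof k Γ (fun i => M.gr i) i ⟨x, hx⟩ := by
    rw [LinearEquiv.symm_apply_eq]
    exact (DirectSum.coeLinearMap_of M.gr i ⟨x, hx⟩).symm
  simp [lift, this]

variable {M} in
theorem hom_ext {f g : M →ₗ[k] N} (h : ∀ i, ∀ x ∈ M.gr i, f x = g x) : f = g := by
  have : ⨆ i, M.gr i ≤ LinearMap.eqLocus f g := iSup_le fun i x hx => h i x hx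
  rw [M.span] at this
  exact LinearMap.ext fun x => this trivial

/-- The projection onto the component of degree `i`. -/
def proj (i : Γ) : M →ₗ[k] M := M.lift fun j => if j = i then LinearMap.id else 0

theorem proj_same {i : Γ} {x : M} (hx : x ∈ M.gr i) : M.proj i x = x := by
  simp [proj, M.lift_apply _ hx]

theorem proj_ne {i j : Γ} (hij : j ≠ i) {x : M} (hx : x ∈ M.gr j) : M.proj i x = 0 := by
  simp [proj, M.lift_apply _ hx, hij]

/-- The sign operator `x ↦ (-1)^⟨j, |x|⟩ x`. -/
def tw (j : Γ) : M →ₗ[k] M := M.lift fun i => sgn k (form j i) • LinearMap.id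

theorem tw_apply (j : Γ) {i : Γ} {x : M} (hx : x ∈ M.gr i) :
    M.tw j x = sgn k (form j i) • x := by
  simp [tw, M.lift_apply _ hx]

/-- The operator `x ↦ (-1)^⟨ι, |x|⟩ x`. -/
def ε : M →ₗ[k] M := M.tw ι

theorem ε_apply {i : Γ} {x : M} (hx : x ∈ M.gr i) : M.ε x = sgn k (form ι i) • x :=
  M.tw_apply _ hx

theorem tw_mem (j : Γ) {i : Γ} {x : M} (hx : x ∈ M.gr i) : M.tw j x ∈ M.gr i := by
  rw [M.tw_apply j hx]; exact (M.gr i).smul_mem _ hx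

theorem ε_mem {i : Γ} {x : M} (hx : x ∈ M.gr i) : M.ε x ∈ M.gr i := M.tw_mem _ hx

theorem tw_tw (j : Γ) (x : M) : M.tw j (M.tw j x) = x := by
  have : M.tw j ∘ₗ M.tw j = LinearMap.id := hom_ext fun i x hx => by
    simp [M.tw_apply j hx, smul_smul, sgn_mul_self]
  exact LinearMap.congr_fun this x

theorem ε_ε (x : M) : M.ε (M.ε x) = x := M.tw_tw _ x

theorem tw_add (j j' : Γ) (x : M) : M.tw (j + j') x = M.tw j (M.tw j' x) := by
  have : M.tw (j + j') = M.tw j ∘ₗ M.tw j' := hom_ext fun i x hx => by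
    simp [M.tw_apply _ hx, smul_smul, sgn_add, mul_comm]
  exact LinearMap.congr_fun this x

theorem tw_zero (x : M) : M.tw 0 x = x := by
  have : M.tw 0 = LinearMap.id := hom_ext fun i x hx => by
    simp [M.tw_apply _ hx, sgn_zero]
  exact LinearMap.congr_fun this x

theorem tw_neg (j : Γ) (x : M) : M.tw (-j) x = M.tw j x := by
  have : M.tw (-j) = M.tw j := hom_ext fun i x hx => by
    rw [M.tw_apply _ hx, M.tw_apply _ hx, map_neg, AddMonoidHom.neg_apply, CharTwo.neg_eq]
  exact LinearMap.congr_fun this x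

theorem tw_comm (j j' : Γ) (x : M) : M.tw j (M.tw j' x) = M.tw j' (M.tw j x) := by
  rw [← tw_add, ← tw_add, add_comm]

theorem d_tw (j : Γ) (x : M) : M.d (M.tw j x) = sgn k (form j ι) • M.tw j (M.d x) := by
  have : M.d ∘ₗ M.tw j = sgn k (form j ι) • M.tw j ∘ₗ M.d := hom_ext fun i x hx => by
    simp only [LinearMap.comp_apply, LinearMap.smul_apply, M.tw_apply _ hx, map_smul,
      M.tw_apply _ (M.d_mem i x hx), smul_smul, map_add, sgn_add]
    rw [mul_left_comm, sgn_mul_self, mul_one]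
  exact LinearMap.congr_fun this x

theorem d_ε (x : M) : M.d (M.ε x) = - M.ε (M.d x) := by
  simp [ε, d_tw, form_ι_ι, sgn_one]

/-- A linear map of degree `j` commutes with the sign operators up to the expected sign. -/
theorem map_tw {M : DGMod.{w} k Γ} {N : DGMod.{w'} k Γ} {l : Γ} (f : M →ₗ[k] N)
    (hf : ∀ i, ∀ x ∈ M.gr i, f x ∈ N.gr (i + l)) (j : Γ) (x : M) :
    f (M.tw j x) = sgn k (form j l) • N.tw j (f x) := by
  have : f ∘ₗ M.tw j = sgn k (form j l) • N.tw j ∘ₗ f := hom_ext fun i x hx => by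
    simp only [LinearMap.comp_apply, LinearMap.smul_apply, M.tw_apply _ hx, map_smul,
      N.tw_apply _ (hf i x hx), smul_smul, map_add, sgn_add]
    rw [mul_left_comm, sgn_mul_self, mul_one]
  exact LinearMap.congr_fun this x

theorem map_tw_zero {M : DGMod.{w} k Γ} {N : DGMod.{w'} k Γ} (f : M →ₗ[k] N)
    (hf : ∀ i, ∀ x ∈ M.gr i, f x ∈ N.gr i) (j : Γ) (x : M) :
    f (M.tw j x) = N.tw j (f x) := by
  have := map_tw (l := 0) f (fun i x hx => by simpa using hf i x hx) j x
  simpa [sgn_zero] using this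

end lift

/-- Independence of a family of submodules that is separated by linear maps. -/
theorem indep_of_proj {M : Type w} [AddCommGroup M] [Module k M] {gr : Γ → Submodule k M}
    (h : ∀ i, ∃ (N : Type w) (_ : AddCommGroup N) (_ : Module k N) (p : M →ₗ[k] N),
      (∀ x ∈ gr i, p x = 0 → x = 0) ∧ ∀ j, j ≠ i → ∀ x ∈ gr j, p x = 0) : iSupIndep gr := by
  intro i
  obtain ⟨N, _, _, p, h1, h2⟩ := h i
  rw [Submodule.disjoint_def]
  intro x hx hxs
  refine h1 x hx ?_
  have : ⨆ j, ⨆ (_ : j ≠ i), gr j ≤ LinearMap.ker p :=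
    iSup_le fun j => iSup_le fun hj y hy => h2 j hj y hy
  exact this hxs

/-- The grading shift `q^j M`, with `(q^j M)^i = M^{i-j}` and differential `(-1)^⟨j, ι⟩ d`. -/
def shift (j : Γ) (M : DGMod.{w} k Γ) : DGMod.{w} k Γ where
  carrier := M
  gr i := M.gr (i - j)
  indep := M.indep.comp (sub_left_injective)
  span := by
    rw [← M.span]; exact (Equiv.subRight j).iSup_comp (g := M.gr)
  d := sgn k (form j ι) • M.d
  d_mem i x hx := by
    have := M.d_mem _ x hx
    rw [sub_add_eq_add_sub] at this
    exact Submodule.smul_mem _ _ this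
  d_d x := by simp [M.d_d]

/-- The twist `tw_δ(M)`: the same graded module with differential `d + δ`. -/
def twist (M : DGMod.{w} k Γ) (δ : M →ₗ[k] M) (hδ : ∀ i, ∀ x ∈ M.gr i, δ x ∈ M.gr (i + ι))
    (h : ∀ x, M.d (δ x) + δ (M.d x) + δ (δ x) = 0) : DGMod.{w} k Γ where
  carrier := M
  gr := M.gr
  indep := M.indep
  span := M.span
  d := M.d + δ
  d_mem i x hx := (M.gr _).add_mem (M.d_mem i x hx) (hδ i x hx)
  d_d x := by
    have := h x
    simp only [LinearMap.add_apply, map_add, M.d_d]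
    rw [zero_add, add_comm (δ (M.d x)), ← this]; abel

/-- The direct sum of dg modules. -/
def dsum {A : Type w'} (M : A → DGMod.{w} k Γ) : DGMod.{max w w'} k Γ where
  carrier := ⨁ a, M a
  gr i := ⨅ a, ((M a).gr i).comap (DirectSum.component k A (fun a => M a) a)
  indep := indep_of_proj fun i => ⟨_, inferInstance, inferInstance,
    DirectSum.lmap fun a => (M a).proj i, by
      intro x hx h
      simp only [Submodule.mem_iInf, Submodule.mem_comap, DirectSum.component] at hx
      ext1 a
      have := DFunLike.congr_fun h a
      exact ((M a).proj_same (hx a)).symm.trans this, by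
      intro j hj x hx
      simp only [Submodule.mem_iInf, Submodule.mem_comap, DirectSum.component] at hx
      ext1 a
      exact (M a).proj_ne hj (hx a)⟩
  span := by
    refine eq_top_iff.2 fun x _ => ?_
    induction x using DirectSum.induction_on with
    | zero => exact Submodule.zero_mem _
    | add x y hx hy => exact Submodule.add_mem _ (hx trivial) (hy trivial)
    | of a x =>
      have hle : ⨆ i, (M a).gr i ≤
          (⨆ i, ⨅ a, ((M a).gr i).comap (DirectSum.component k A (fun a => M a) a)).comap
            (DirectSum.lof k A (fun a => M a) a) := by
        refine iSup_le fun i y hy => ?_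
        refine Submodule.mem_iSup_of_mem i ?_
        simp only [Submodule.mem_iInf, Submodule.mem_comap]
        intro b
        by_cases hb : a = b
        · subst hb; rw [DirectSum.component.lof_self]; exact hy
        · rw [DirectSum.component.of, dif_neg hb]; exact Submodule.zero_mem _
      rw [(M a).span] at hle
      exact hle trivial
  d := DirectSum.lmap fun a => (M a).d
  d_mem i x hx := by
    simp only [Submodule.mem_iInf, Submodule.mem_comap, DirectSum.component] at hx ⊢
    exact fun a => (M a).d_mem i _ (hx a)
  d_d x := by ext1 a; simp [(M a).d_d]

section dsum
variable {A : Type w'} (M : A → DGMod.{w} k Γ)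

/-- The inclusion of a summand. -/
def inc (a : A) : M a →ₗ[k] dsum M := DirectSum.lof k A (fun a => M a) a

/-- The projection to a summand. -/
def comp (a : A) : dsum M →ₗ[k] M a := DirectSum.component k A (fun a => M a) a

/-- The map out of a direct sum with prescribed restrictions to the summands. -/
def dsumLift {N : Type w''} [AddCommGroup N] [Module k N] (F : ∀ a, M a →ₗ[k] N) :
    dsum M →ₗ[k] N := DirectSum.toModule k A N F

@[simp] theorem dsumLift_inc {N : Type w''} [AddCommGroup N] [Module k N]
    (F : ∀ a, M a →ₗ[k] N) (a : A) (x : M a) : dsumLift M F (inc M a x) = F a x :=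
  DirectSum.toModule_lof (R := k) (ι := A) (M := fun a => M a) (φ := F) a x

theorem dsum_ext {N : Type w''} [AddCommGroup N] [Module k N] {f g : dsum M →ₗ[k] N}
    (h : ∀ a x, f (inc M a x) = g (inc M a x)) : f = g :=
  DirectSum.linearMap_ext k fun a => LinearMap.ext (h a)

theorem dsum_ind {p : dsum M → Prop} (x : dsum M) (zero : p 0)
    (add : ∀ x y, p x → p y → p (x + y)) (inc : ∀ a x, p (inc M a x)) : p x :=
  DirectSum.induction_on (β := fun a => (M a : Type w)) x zero inc add

theorem mem_dsum_gr {i : Γ} {x : dsum M} : x ∈ (dsum M).gr i ↔ ∀ a, comp M a x ∈ (M a).gr i :=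
  Submodule.mem_iInf (R := k) (M := ⨁ a, M a)
    (fun a => ((M a).gr i).comap (DirectSum.component k A (fun a => M a) a))

theorem comp_inc_same (a : A) (x : M a) : comp M a (inc M a x) = x :=
  DirectSum.component.lof_self (R := k) (ι := A) (M := fun a => M a) a x

theorem comp_inc_ne {a b : A} (h : a ≠ b) (x : M a) : comp M b (inc M a x) = 0 := by
  exact (DirectSum.component.of (R := k) (ι := A) (M := fun a => M a) b a x).trans (dif_neg h)

theorem inc_mem {a : A} {i : Γ} {x : M a} (hx : x ∈ (M a).gr i) : inc M a x ∈ (dsum M).gr i := by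
  rw [mem_dsum_gr]
  intro b
  by_cases hb : a = b
  · subst hb; rwa [comp_inc_same]
  · rw [comp_inc_ne M hb]; exact Submodule.zero_mem _

theorem comp_ext {x y : dsum M} (h : ∀ a, comp M a x = comp M a y) : x = y :=
  DFinsupp.ext h

theorem d_inc (a : A) (x : M a) : (dsum M).d (inc M a x) = inc M a ((M a).d x) :=
  DirectSum.lmap_lof (fun a => (M a).d) a x

theorem comp_d (a : A) (x : dsum M) : comp M a ((dsum M).d x) = (M a).d (comp M a x) := rfl

theorem tw_inc (j : Γ) (a : A) (x : M a) : (dsum M).tw j (inc M a x) = inc M a ((M a).tw j x) :=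
  (map_tw_zero (inc M a) (fun _ _ => inc_mem M) j x).symm

theorem ε_inc (a : A) (x : M a) : (dsum M).ε (inc M a x) = inc M a ((M a).ε x) :=
  tw_inc M ι a x

theorem dsum_gr_span (i : Γ) : (dsum M).gr i ≤ ⨆ a, ((M a).gr i).map (inc M a) := by
  intro x hx
  rw [mem_dsum_gr] at hx
  have hx' : x = DFinsupp.sum (β := fun a => M a) x (fun a y => inc M a y) :=
    (DFinsupp.sum_single (β := fun a => (M a : Type w)) (f := x)).symm
  rw [hx']
  exact Submodule.sum_mem _ fun a _ => Submodule.mem_iSup_of_mem a ⟨_, hx a, rfl⟩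

theorem dsum_gr_mem {N : Type w''} [AddCommGroup N] [Module k N] {S : Submodule k N}
    {F : dsum M →ₗ[k] N} {i : Γ} (h : ∀ a, ∀ x ∈ (M a).gr i, F (inc M a x) ∈ S) {x : dsum M}
    (hx : x ∈ (dsum M).gr i) : F x ∈ S := by
  have : (⨆ a, ((M a).gr i).map (inc M a)) ≤ S.comap F := by
    refine iSup_le fun a => ?_
    rintro _ ⟨y, hy, rfl⟩
    exact h a y hy
  exact this (dsum_gr_span M i hx)

end dsum

/-- The families that are finite sums of homogeneous families. -/
def prodCarrier {A : Type w'} (M : A → DGMod.{w} k Γ) : Submodule k (∀ a, M a) :=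
  ⨆ i, Submodule.pi Set.univ fun a => (M a).gr i

/-- The (degreewise) product of dg modules: `(∏ M_a)^i = ∏ (M_a)^i`, whose total module consists of
the families that are finite sums of homogeneous families. -/
def dprod {A : Type w'} (M : A → DGMod.{w} k Γ) : DGMod.{max w w'} k Γ :=
  let G : Γ → Submodule k (∀ a, M a) := fun i => Submodule.pi Set.univ fun a => (M a).gr i
  let D : (∀ a, M a) →ₗ[k] (∀ a, M a) := LinearMap.pi fun a => (M a).d ∘ₗ LinearMap.proj a
  have hD : ∀ i, ∀ x ∈ G i, D x ∈ G (i + ι) := fun i x hx a _ => (M a).d_mem i _ (hx a trivial)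
  { carrier := prodCarrier M
    gr := fun i => (G i).comap (Submodule.subtype _)
    indep := indep_of_proj fun i => ⟨_, inferInstance, inferInstance,
      (LinearMap.pi fun a => (M a).proj i ∘ₗ LinearMap.proj a) ∘ₗ
        Submodule.subtype (prodCarrier M), by
        intro x hx h
        ext a
        have := congrFun h a
        exact ((M a).proj_same (hx a trivial)).symm.trans this, by
        intro j hj x hx
        ext a
        exact (M a).proj_ne hj (hx a trivial)⟩
    span := by
      rw [← (Submodule.map_injective_of_injective
          (Submodule.subtype_injective (prodCarrier M))).eq_iff, Submodule.map_iSup, Submodule.map_top, Submodule.range_subtype]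
      congr 1; funext i
      rw [Submodule.map_comap_subtype]
      exact inf_eq_right.2 (le_iSup G i)
    d := D.restrict (p := prodCarrier M) (q := prodCarrier M) (by
      have : prodCarrier M ≤ (prodCarrier M).comap D :=
        iSup_le fun i x hx => Submodule.mem_iSup_of_mem (i + ι) (hD i x hx)
      exact fun x hx => this hx)
    d_mem := fun i x hx => hD i x.1 hx
    d_d := fun x => by
      ext a
      exact (M a).d_d _ }

section dprod
variable {A : Type w'} (M : A → DGMod.{w} k Γ)

/-- The `a`-th component of an element of the product. -/
def pcomp (a : A) : dprod M →ₗ[k] M a :=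
  LinearMap.proj (φ := fun a => (M a : Type w)) a ∘ₗ Submodule.subtype _

theorem pcomp_ext {x y : dprod M} (h : ∀ a, pcomp M a x = pcomp M a y) : x = y :=
  Subtype.ext (funext h)

theorem pcomp_d (a : A) (x : dprod M) : pcomp M a ((dprod M).d x) = (M a).d (pcomp M a x) := rfl

theorem mem_dprod_gr {i : Γ} {x : dprod M} :
    x ∈ (dprod M).gr i ↔ ∀ a, pcomp M a x ∈ (M a).gr i :=
  ⟨fun h a => h a trivial, fun h a _ => h a⟩

theorem pcomp_tw (j : Γ) (a : A) (x : dprod M) :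
    pcomp M a ((dprod M).tw j x) = (M a).tw j (pcomp M a x) :=
  map_tw_zero (pcomp M a) (fun _ _ hx => (mem_dprod_gr M).1 hx a) j x

/-- Maps into a product: a family of maps of the same degree `l`. -/
def dprodLift {N : DGMod.{w''} k Γ} (l : Γ) (F : ∀ a, N →ₗ[k] M a)
    (hF : ∀ a i, ∀ x ∈ N.gr i, F a x ∈ (M a).gr (i + l)) : N →ₗ[k] dprod M :=
  (LinearMap.pi F).codRestrict _ (by
    have : ⨆ i, N.gr i ≤ (⨆ i, Submodule.pi Set.univ fun a => (M a).gr i).comap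
        (LinearMap.pi F) :=
      iSup_le fun i x hx => Submodule.mem_iSup_of_mem (i + l) (fun a _ => hF a i x hx)
    rw [N.span] at this
    exact fun x => this trivial)

theorem pcomp_dprodLift {N : DGMod.{w''} k Γ} (l : Γ) (F : ∀ a, N →ₗ[k] M a)
    (hF : ∀ a i, ∀ x ∈ N.gr i, F a x ∈ (M a).gr (i + l)) (a : A) (x : N) :
    pcomp M a (dprodLift M l F hF x) = F a x := rfl

end dprod

/-- The tensor product over `k`, with `(M ⊗ N)^l = ⨁_{i+j=l} M^i ⊗ N^j` and differential
`d ⊗ 1 + 1 ⊗ d` (with the Koszul sign rule). -/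
def tensor (M : DGMod.{w} k Γ) (N : DGMod.{w'} k Γ) : DGMod.{max w w'} k Γ where
  carrier := M ⊗[k] N
  gr l := ⨆ i, Submodule.map₂ (TensorProduct.mk k M N) (M.gr i) (N.gr (l - i))
  indep := indep_of_proj fun l => ⟨_, inferInstance, inferInstance,
    TensorProduct.lift (M.lift fun i => (TensorProduct.mk k M N).compl₂ (N.proj (l - i))), by
      have key : (⨆ i, Submodule.map₂ (TensorProduct.mk k M N) (M.gr i) (N.gr (l - i))) ≤
          LinearMap.eqLocus (TensorProduct.lift
            (M.lift fun i => (TensorProduct.mk k M N).compl₂ (N.proj (l - i)))) LinearMap.id := by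
        refine iSup_le fun i => Submodule.map₂_le.2 fun m hm n hn => ?_
        simp [LinearMap.mem_eqLocus, M.lift_apply _ hm, N.proj_same hn]
      intro x hx h
      exact ((key hx).symm.trans h), by
      intro j hj x hx
      have key : (⨆ i, Submodule.map₂ (TensorProduct.mk k M N) (M.gr i) (N.gr (j - i))) ≤
          LinearMap.ker (TensorProduct.lift
            (M.lift fun i => (TensorProduct.mk k M N).compl₂ (N.proj (l - i)))) := by
        refine iSup_le fun i => Submodule.map₂_le.2 fun m hm n hn => ?_
        have : j - i ≠ l - i := fun h => hj (sub_left_injective h)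
        simp [M.lift_apply _ hm, N.proj_ne this hn]
      exact key hx⟩
  span := by
    rw [eq_top_iff, ← TensorProduct.map₂_mk_top_top_eq_top, ← M.span, ← N.span,
      Submodule.map₂_iSup_left]
    refine iSup_le fun i => ?_
    rw [Submodule.map₂_iSup_right]
    refine iSup_le fun j => ?_
    refine le_iSup_of_le (i + j) (le_iSup_of_le i ?_)
    rw [add_sub_cancel_left]
  d := TensorProduct.map M.d LinearMap.id + TensorProduct.map M.ε N.d
  d_mem l x hx := by
    have key : (⨆ i, Submodule.map₂ (TensorProduct.mk k M N) (M.gr i) (N.gr (l - i))) ≤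
        (⨆ i, Submodule.map₂ (TensorProduct.mk k M N) (M.gr i) (N.gr (l + ι - i))).comap
          (TensorProduct.map M.d LinearMap.id + TensorProduct.map M.ε N.d) := by
      refine iSup_le fun i => Submodule.map₂_le.2 fun m hm n hn => ?_
      simp only [Submodule.mem_comap, TensorProduct.mk_apply, LinearMap.add_apply,
        TensorProduct.map_tmul, LinearMap.id_apply]
      refine Submodule.add_mem _ (Submodule.mem_iSup_of_mem (i + ι) ?_)
        (Submodule.mem_iSup_of_mem i ?_)
      · rw [add_sub_add_right_eq_sub]
        exact Submodule.apply_mem_map₂ _ (M.d_mem i m hm) hn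
      · rw [← sub_add_eq_add_sub]
        exact Submodule.apply_mem_map₂ _ (M.ε_mem hm) (N.d_mem _ n hn)
    exact key hx
  d_d x := by
    induction x using TensorProduct.induction_on with
    | zero => simp
    | add x y hx hy => rw [map_add, map_add, hx, hy, add_zero]
    | tmul m n => simp [M.d_d, N.d_d, M.d_ε, TensorProduct.neg_tmul]

section tensor
variable (M : DGMod.{w} k Γ) (N : DGMod.{w'} k Γ)

/-- Simple tensors. -/
def tmul : M →ₗ[k] N →ₗ[k] M.tensor N := TensorProduct.mk k M N

/-- The map out of a tensor product defined by a bilinear map. -/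
def tensorLift {P : Type w''} [AddCommGroup P] [Module k P] (F : M →ₗ[k] N →ₗ[k] P) :
    M.tensor N →ₗ[k] P := TensorProduct.lift F

@[simp] theorem tensorLift_tmul {P : Type w''} [AddCommGroup P] [Module k P]
    (F : M →ₗ[k] N →ₗ[k] P) (m : M) (n : N) : tensorLift M N F (tmul M N m n) = F m n :=
  TensorProduct.lift.tmul m n

theorem tensor_ext {P : Type w''} [AddCommGroup P] [Module k P] {f g : M.tensor N →ₗ[k] P}
    (h : ∀ m n, f (tmul M N m n) = g (tmul M N m n)) : f = g :=
  TensorProduct.ext' h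

theorem tensor_ind {p : M.tensor N → Prop} (x : M.tensor N) (zero : p 0)
    (add : ∀ x y, p x → p y → p (x + y)) (tmul : ∀ m n, p (tmul M N m n)) : p x :=
  TensorProduct.induction_on (motive := p) x zero tmul add

theorem tmul_mem {i j : Γ} {m : M} {n : N} (hm : m ∈ M.gr i) (hn : n ∈ N.gr j) :
    tmul M N m n ∈ (M.tensor N).gr (i + j) := by
  have hn' : n ∈ N.gr (i + j - i) := by rwa [add_sub_cancel_left]
  exact Submodule.mem_iSup_of_mem (R := k) (M := M ⊗[k] N)
    (p := fun i' => Submodule.map₂ (TensorProduct.mk k M N) (M.gr i') (N.gr (i + j - i')))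
    i (Submodule.apply_mem_map₂ _ hm hn')

theorem tensor_gr_le {l : Γ} {S : Submodule k (M.tensor N)}
    (h : ∀ i j, i + j = l → ∀ m ∈ M.gr i, ∀ n ∈ N.gr j, tmul M N m n ∈ S) :
    (M.tensor N).gr l ≤ S :=
  iSup_le fun i => Submodule.map₂_le.2 fun m hm n hn =>
    h i (l - i) (add_sub_cancel i l) m hm n hn

theorem d_tmul (m : M) (n : N) : (M.tensor N).d (tmul M N m n) =
    tmul M N (M.d m) n + tmul M N (M.ε m) (N.d n) := rfl

theorem tw_tmul (j : Γ) (m : M) (n : N) :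
    (M.tensor N).tw j (tmul M N m n) = tmul M N (M.tw j m) (N.tw j n) := by
  have : (tmul M N).compr₂ ((M.tensor N).tw j) = (tmul M N).compl₁₂ (M.tw j) (N.tw j) :=
    hom_ext fun i m hm => hom_ext fun i' n hn => by
      simp only [LinearMap.compr₂_apply, LinearMap.compl₁₂_apply, M.tw_apply j hm,
        N.tw_apply j hn, (M.tensor N).tw_apply j (tmul_mem M N hm hn), map_smul,
        LinearMap.smul_apply, smul_smul, map_add, sgn_add]
      rw [mul_comm]
  exact LinearMap.congr_fun₂ this m n

theorem ε_tmul (m : M) (n : N) :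
    (M.tensor N).ε (tmul M N m n) = tmul M N (M.ε m) (N.ε n) := tw_tmul M N ι m n

end tensor

/-- The quotient of a dg module by a graded submodule stable under the differential. -/
def quot (M : DGMod.{w} k Γ) (S : Submodule k M) (hS : ∀ i, ∀ x ∈ S, M.proj i x ∈ S)
    (hd : ∀ x ∈ S, M.d x ∈ S) : DGMod.{w} k Γ where
  carrier := M ⧸ S
  gr i := (M.gr i).map S.mkQ
  indep := indep_of_proj fun i => ⟨_, inferInstance, inferInstance,
    S.mapQ S (M.proj i) (fun x hx => hS i x hx), by
      rintro _ ⟨x, hx, rfl⟩ h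
      rw [Submodule.mkQ_apply, Submodule.mapQ_apply, M.proj_same hx] at h
      exact h, by
      rintro j hj _ ⟨x, hx, rfl⟩
      rw [Submodule.mkQ_apply, Submodule.mapQ_apply, M.proj_ne hj hx]; rfl⟩
  span := by
    rw [← Submodule.map_iSup, M.span, Submodule.map_top, Submodule.range_mkQ]
  d := S.mapQ S M.d hd
  d_mem := by
    rintro i _ ⟨x, hx, rfl⟩
    exact ⟨M.d x, M.d_mem i x hx, rfl⟩
  d_d x := by
    obtain ⟨x, rfl⟩ := S.mkQ_surjective x
    simp [M.d_d]

theorem bilin_tw {M : DGMod.{w} k Γ} {N : DGMod.{w'} k Γ} {P : DGMod.{w''} k Γ}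
    (F : M →ₗ[k] N →ₗ[k] P)
    (hF : ∀ i j, ∀ m ∈ M.gr i, ∀ n ∈ N.gr j, F m n ∈ P.gr (i + j)) (j : Γ) (m : M) (n : N) :
    P.tw j (F m n) = F (M.tw j m) (N.tw j n) := by
  have : F.compr₂ (P.tw j) = F.compl₁₂ (M.tw j) (N.tw j) :=
    hom_ext fun i m hm => hom_ext fun i' n hn => by
      simp only [LinearMap.compr₂_apply, LinearMap.compl₁₂_apply, M.tw_apply j hm,
        N.tw_apply j hn, P.tw_apply j (hF _ _ m hm n hn), map_smul,
        LinearMap.smul_apply, smul_smul, map_add, sgn_add]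
      rw [mul_comm]
  exact LinearMap.congr_fun₂ this m n

theorem shift_tw (j l : Γ) (M : DGMod.{w} k Γ) (x : M) :
    (M.shift j).tw l x = sgn k (form l j) • M.tw l x := by
  have : (sgn k (form l j) • M.tw l : M →ₗ[k] M) = (M.shift j).tw l :=
    hom_ext (M := M) fun i x hx => by
      have hx' : x ∈ (M.shift j).gr (i + j) := by
        change x ∈ M.gr (i + j - j); rwa [add_sub_cancel_right]
      rw [LinearMap.smul_apply, M.tw_apply l hx, smul_smul, mul_comm, ← sgn_add, ← map_add]
      exact ((M.shift j).tw_apply l hx').symm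
  exact (LinearMap.congr_fun this x).symm

theorem twist_tw (M : DGMod.{w} k Γ) (δ : M →ₗ[k] M) (hδ : ∀ i, ∀ x ∈ M.gr i, δ x ∈ M.gr (i + ι))
    (h : ∀ x, M.d (δ x) + δ (M.d x) + δ (δ x) = 0) (l : Γ) (x : M) :
    (M.twist δ hδ h).tw l x = M.tw l x := rfl

theorem prodCarrier_map₂ {A : Type*} {M : DGMod.{w} k Γ} {N : A → DGMod.{w'} k Γ}
    {P : A → DGMod.{w''} k Γ} (F : ∀ a, M →ₗ[k] N a →ₗ[k] P a)
    (hF : ∀ a i j, ∀ m ∈ M.gr i, ∀ n ∈ (N a).gr j, F a m n ∈ (P a).gr (i + j))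
    (m : M) (x : ∀ a, N a) (hx : x ∈ prodCarrier N) : (fun a => F a m (x a)) ∈ prodCarrier P := by
  have h : ⨆ i, M.gr i ≤ (prodCarrier P).comap (LinearMap.pi fun a => (F a).flip (x a)) := by
    refine iSup_le fun i m hm => ?_
    have h' : prodCarrier N ≤
        (prodCarrier P).comap (LinearMap.pi fun a => F a m ∘ₗ LinearMap.proj a) :=
      iSup_le fun j y hy => Submodule.mem_iSup_of_mem (i + j)
        fun a _ => hF a i j m hm _ (hy a trivial)
    exact h' hx
  rw [M.span] at h
  exact h (x := m) trivial

/-- Bilinear degree zero maps into the factors assemble to a bilinear map of products. -/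
def dprodMap₂ {A : Type*} {M : DGMod.{w} k Γ} {N : A → DGMod.{w'} k Γ} {P : A → DGMod.{w''} k Γ}
    (F : ∀ a, M →ₗ[k] N a →ₗ[k] P a)
    (hF : ∀ a i j, ∀ m ∈ M.gr i, ∀ n ∈ (N a).gr j, F a m n ∈ (P a).gr (i + j)) :
    M →ₗ[k] dprod N →ₗ[k] dprod P :=
  LinearMap.mk₂ k
    (fun m x => (⟨fun a => F a m (x.1 a), prodCarrier_map₂ F hF m x.1 x.2⟩ : dprod P))
    (fun m m' x => Subtype.ext (funext fun a => LinearMap.map_add₂ (F a) m m' (x.1 a)))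
    (fun c m x => Subtype.ext (funext fun a => LinearMap.map_smul₂ (F a) c m (x.1 a)))
    (fun m x x' => Subtype.ext (funext fun a => map_add (F a m) (x.1 a) (x'.1 a)))
    (fun c m x => Subtype.ext (funext fun a => map_smul (F a m) c (x.1 a)))

theorem pcomp_dprodMap₂ {A : Type*} {M : DGMod.{w} k Γ} {N : A → DGMod.{w'} k Γ}
    {P : A → DGMod.{w''} k Γ} (F : ∀ a, M →ₗ[k] N a →ₗ[k] P a)
    (hF : ∀ a i j, ∀ m ∈ M.gr i, ∀ n ∈ (N a).gr j, F a m n ∈ (P a).gr (i + j))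
    (a : A) (m : M) (x : dprod N) : pcomp P a (dprodMap₂ F hF m x) = F a m (pcomp N a x) := rfl
end DGMod

variable (k Γ) in
/-- A dg category.  We write hom complexes from right to left: `hom X Y` is the complex
`⟨X|Y⟩ = Hom(Y, X)`, so that `comp f g = f ∘ g` for `f ∈ ⟨X|Y⟩`, `g ∈ ⟨Y|Z⟩`.
The operator `ε` in the Leibniz rule is `f ↦ (-1)^⟨ι, |f|⟩ f`. -/
structure DGCat where
  Obj : Type u
  hom : Obj → Obj → DGMod.{v} k Γ
  one : ∀ X, hom X X
  one_mem : ∀ X, one X ∈ (hom X X).gr 0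
  comp : ∀ {X Y Z}, hom X Y →ₗ[k] hom Y Z →ₗ[k] hom X Z
  comp_mem : ∀ {X Y Z} (i j : Γ), ∀ f ∈ (hom X Y).gr i, ∀ g ∈ (hom Y Z).gr j,
    comp f g ∈ (hom X Z).gr (i + j)
  one_comp : ∀ {X Y} (f : hom X Y), comp (one X) f = f
  comp_one : ∀ {X Y} (f : hom X Y), comp f (one Y) = f
  assoc : ∀ {X Y Z W} (f : hom X Y) (g : hom Y Z) (h : hom Z W),
    comp (comp f g) h = comp f (comp g h)
  d_comp : ∀ {X Y Z} (f : hom X Y) (g : hom Y Z),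
    (hom X Z).d (comp f g) = comp ((hom X Y).d f) g + comp ((hom X Y).ε f) ((hom Y Z).d g)

namespace DGCat

theorem tw_comp (C : DGCat.{u, v} k Γ) (j : Γ) {X Y Z : C.Obj} (f : C.hom X Y) (g : C.hom Y Z) :
    (C.hom X Z).tw j (C.comp f g) = C.comp ((C.hom X Y).tw j f) ((C.hom Y Z).tw j g) :=
  DGMod.bilin_tw C.comp C.comp_mem j f g

theorem ε_comp (C : DGCat.{u, v} k Γ) {X Y Z : C.Obj} (f : C.hom X Y) (g : C.hom Y Z) :
    (C.hom X Z).ε (C.comp f g) = C.comp ((C.hom X Y).ε f) ((C.hom Y Z).ε g) :=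
  C.tw_comp ι f g

theorem tw_one (C : DGCat.{u, v} k Γ) (j : Γ) (X : C.Obj) : (C.hom X X).tw j (C.one X) = C.one X := by
  rw [DGMod.tw_apply _ _ (C.one_mem X)]; simp [sgn_zero]

theorem d_one (C : DGCat.{u, v} k Γ) (X : C.Obj) : (C.hom X X).d (C.one X) = 0 := by
  have := C.d_comp (C.one X) (C.one X)
  rw [DGMod.ε, C.tw_one, C.one_comp, C.comp_one, C.one_comp] at this
  simpa using this

end DGCat

/-- An object `tw_α(X)` of the twisted envelope: an object `X` with a Maurer–Cartan
endomorphism `α` of degree `ι`, i.e. `d α + α² = 0`. -/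
structure MCObj (C : DGCat.{u, v} k Γ) where
  obj : C.Obj
  α : C.hom obj obj
  α_mem : α ∈ (C.hom obj obj).gr ι
  mc : (C.hom obj obj).d α + C.comp α α = 0

section Tw
variable (C : DGCat.{u, v} k Γ)

/-- `f ↦ α_X ∘ f - (-1)^⟨ι, |f|⟩ f ∘ α_Y`. -/
def twδ (X Y : MCObj C) : C.hom X.obj Y.obj →ₗ[k] C.hom X.obj Y.obj :=
  C.comp X.α - C.comp.flip Y.α ∘ₗ (C.hom X.obj Y.obj).ε

theorem twδ_apply (X Y : MCObj C) (f : C.hom X.obj Y.obj) :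
    twδ C X Y f = C.comp X.α f - C.comp ((C.hom X.obj Y.obj).ε f) Y.α := rfl

theorem ε_α (X : MCObj C) : (C.hom X.obj X.obj).ε X.α = - X.α := by
  rw [DGMod.ε_apply _ X.α_mem, form_ι_ι, sgn_one, neg_one_smul]

/-- The hom complex of the twisted envelope: same graded module, with differential
`f ↦ d f + α_X ∘ f - (-1)^⟨ι, |f|⟩ f ∘ α_Y`. -/
def twHom (X Y : MCObj C) : DGMod.{v} k Γ :=
  (C.hom X.obj Y.obj).twist (twδ C X Y)
    (fun i f hf => by
      rw [twδ_apply]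
      refine Submodule.sub_mem _ ?_ ?_
      · rw [add_comm]; exact C.comp_mem _ _ _ X.α_mem _ hf
      · exact C.comp_mem _ _ _ (DGMod.ε_mem _ hf) _ Y.α_mem)
    (fun f => by
      have hX : (C.hom X.obj X.obj).d X.α = - C.comp X.α X.α := eq_neg_of_add_eq_zero_left X.mc
      have hY : (C.hom Y.obj Y.obj).d Y.α = - C.comp Y.α Y.α := eq_neg_of_add_eq_zero_left Y.mc
      simp only [twδ_apply, map_sub, C.d_comp, C.ε_comp, ε_α, hX, hY, DGMod.ε_ε, DGMod.d_ε,
        map_neg, LinearMap.neg_apply, C.assoc, map_sub]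
      abel)

theorem tw_d_comp (X Y Z : MCObj C) (f : C.hom X.obj Y.obj) (g : C.hom Y.obj Z.obj) :
    (C.hom X.obj Z.obj).d (C.comp f g) + twδ C X Z (C.comp f g) =
      C.comp ((C.hom X.obj Y.obj).d f + twδ C X Y f) g
        + C.comp ((C.hom X.obj Y.obj).ε f) ((C.hom Y.obj Z.obj).d g + twδ C Y Z g) := by
  simp only [twδ_apply, map_sub, C.d_comp, C.ε_comp, map_add, LinearMap.add_apply,
    LinearMap.sub_apply, C.assoc]
  abel

/-- The twisted envelope `Tw(C)`. -/
def Tw : DGCat.{max u v, v} k Γ where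
  Obj := MCObj C
  hom := twHom C
  one X := C.one X.obj
  one_mem X := C.one_mem X.obj
  comp {X Y Z} := C.comp (X := X.obj) (Y := Y.obj) (Z := Z.obj)
  comp_mem := C.comp_mem
  one_comp := C.one_comp
  comp_one := C.comp_one
  assoc := C.assoc
  d_comp {X Y Z} := tw_d_comp C X Y Z

end Tw

/-- A dg functor. -/
structure DGFunctor (C : DGCat.{u, v} k Γ) (D : DGCat.{u', v'} k Γ) where
  obj : C.Obj → D.Obj
  map : ∀ {X Y}, C.hom X Y →ₗ[k] D.hom (obj X) (obj Y)
  map_mem : ∀ {X Y} (i : Γ), ∀ f ∈ (C.hom X Y).gr i, map f ∈ (D.hom (obj X) (obj Y)).gr i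
  map_d : ∀ {X Y} (f : C.hom X Y), map ((C.hom X Y).d f) = (D.hom (obj X) (obj Y)).d (map f)
  map_one : ∀ X, map (C.one X) = D.one (obj X)
  map_comp : ∀ {X Y Z} (f : C.hom X Y) (g : C.hom Y Z),
    map (C.comp f g) = D.comp (map f) (map g)

/-- The identity dg functor. -/
def DGFunctor.id (C : DGCat.{u, v} k Γ) : DGFunctor C C where
  obj X := X
  map := LinearMap.id
  map_mem _ _ h := h
  map_d _ := rfl
  map_one _ := rfl
  map_comp _ _ := rfl

/-- The object `tw_0(X)`. -/
def MCObj.zero (C : DGCat.{u, v} k Γ) (X : C.Obj) : MCObj C where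
  obj := X
  α := 0
  α_mem := Submodule.zero_mem _
  mc := by simp

theorem twHom_zero_d (C : DGCat.{u, v} k Γ) (X Y : C.Obj) (f : C.hom X Y) :
    (twHom C (MCObj.zero C X) (MCObj.zero C Y)).d f = (C.hom X Y).d f := by
  have h : (twδ C (MCObj.zero C X) (MCObj.zero C Y) : C.hom X Y →ₗ[k] C.hom X Y) f = 0 := by
    change C.comp 0 f - C.comp _ 0 = 0
    simp
  exact (congrArg (fun g : C.hom X Y => (C.hom X Y).d f + g) h).trans (add_zero _)

/-- The fully faithful embedding `η : C → Tw(C)`, `X ↦ tw_0(X)`, `f ↦ f`. -/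
def η (C : DGCat.{u, v} k Γ) : DGFunctor C (Tw C) where
  obj := MCObj.zero C
  map {X Y} := (LinearMap.id : C.hom X Y →ₗ[k] C.hom X Y)
  map_mem _ _ h := h
  map_d {X Y} f := (twHom_zero_d C X Y f).symm
  map_one _ := rfl
  map_comp _ _ := rfl

/-- A `(C, D)`-bimodule: dg modules `⟨X|M|Y⟩` with commuting left and right actions, which are
chain maps `⟨X'|C|X⟩ ⊗ ⟨X|M|Y⟩ → ⟨X'|M|Y⟩` and `⟨X|M|Y⟩ ⊗ ⟨Y|D|Y'⟩ → ⟨X|M|Y'⟩`. -/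
structure Bimod (C : DGCat.{u, v} k Γ) (D : DGCat.{u', v'} k Γ) where
  obj : C.Obj → D.Obj → DGMod.{w} k Γ
  lact : ∀ {X' X Y}, C.hom X' X →ₗ[k] obj X Y →ₗ[k] obj X' Y
  ract : ∀ {X Y Y'}, obj X Y →ₗ[k] D.hom Y Y' →ₗ[k] obj X Y'
  lact_mem : ∀ {X' X Y} (i j : Γ), ∀ f ∈ (C.hom X' X).gr i, ∀ m ∈ (obj X Y).gr j,
    lact f m ∈ (obj X' Y).gr (i + j)
  ract_mem : ∀ {X Y Y'} (i j : Γ), ∀ m ∈ (obj X Y).gr i, ∀ g ∈ (D.hom Y Y').gr j,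
    ract m g ∈ (obj X Y').gr (i + j)
  one_lact : ∀ {X Y} (m : obj X Y), lact (C.one X) m = m
  ract_one : ∀ {X Y} (m : obj X Y), ract m (D.one Y) = m
  comp_lact : ∀ {X'' X' X Y} (f : C.hom X'' X') (f' : C.hom X' X) (m : obj X Y),
    lact (C.comp f f') m = lact f (lact f' m)
  ract_comp : ∀ {X Y Y' Y''} (m : obj X Y) (g : D.hom Y Y') (g' : D.hom Y' Y''),
    ract m (D.comp g g') = ract (ract m g) g'
  lact_ract : ∀ {X' X Y Y'} (f : C.hom X' X) (m : obj X Y) (g : D.hom Y Y'),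
    ract (lact f m) g = lact f (ract m g)
  d_lact : ∀ {X' X Y} (f : C.hom X' X) (m : obj X Y),
    (obj X' Y).d (lact f m) = lact ((C.hom X' X).d f) m + lact ((C.hom X' X).ε f) ((obj X Y).d m)
  d_ract : ∀ {X Y Y'} (m : obj X Y) (g : D.hom Y Y'),
    (obj X Y').d (ract m g) = ract ((obj X Y).d m) g + ract ((obj X Y).ε m) ((D.hom Y Y').d g)

section
variable {C : DGCat.{u, v} k Γ} {D : DGCat.{u', v'} k Γ}

/-- Closed degree zero morphisms of bimodules: families of degree zero chain maps commuting with
both actions. -/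
structure IsClosedBimodMap (M : Bimod.{w} C D) (N : Bimod.{w'} C D)
    (φ : ∀ X Y, M.obj X Y →ₗ[k] N.obj X Y) : Prop where
  mem : ∀ X Y (i : Γ), ∀ m ∈ (M.obj X Y).gr i, φ X Y m ∈ (N.obj X Y).gr i
  d : ∀ X Y (m : M.obj X Y), φ X Y ((M.obj X Y).d m) = (N.obj X Y).d (φ X Y m)
  lact : ∀ X' X Y (f : C.hom X' X) (m : M.obj X Y), φ X' Y (M.lact f m) = N.lact f (φ X Y m)
  ract : ∀ X Y Y' (m : M.obj X Y) (g : D.hom Y Y'), φ X Y' (M.ract m g) = N.ract (φ X Y m) g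

namespace Bimod

theorem tw_lact (M : Bimod.{w} C D) (j : Γ) {X' X : C.Obj} {Y : D.Obj} (f : C.hom X' X)
    (m : M.obj X Y) :
    (M.obj X' Y).tw j (M.lact f m) = M.lact ((C.hom X' X).tw j f) ((M.obj X Y).tw j m) :=
  DGMod.bilin_tw M.lact M.lact_mem j f m

theorem tw_ract (M : Bimod.{w} C D) (j : Γ) {X : C.Obj} {Y Y' : D.Obj} (m : M.obj X Y)
    (g : D.hom Y Y') :
    (M.obj X Y').tw j (M.ract m g) = M.ract ((M.obj X Y).tw j m) ((D.hom Y Y').tw j g) :=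
  DGMod.bilin_tw M.ract M.ract_mem j m g

/-- The identity bimodule. -/
def unit (C : DGCat.{u, v} k Γ) : Bimod.{v} C C where
  obj := C.hom
  lact := C.comp
  ract := C.comp
  lact_mem := C.comp_mem
  ract_mem := C.comp_mem
  one_lact := C.one_comp
  ract_one := C.comp_one
  comp_lact := C.assoc
  ract_comp m g g' := (C.assoc m g g').symm
  lact_ract := C.assoc
  d_lact := C.d_comp
  d_ract := C.d_comp

/-- Restriction of a bimodule along dg functors. -/
def restr {C' : DGCat.{u'', v''} k Γ} {D' : DGCat.{u₃, v₃} k Γ} (F : DGFunctor C' C)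
    (G : DGFunctor D' D) (M : Bimod.{w} C D) : Bimod.{w} C' D' where
  obj X Y := M.obj (F.obj X) (G.obj Y)
  lact := M.lact ∘ₗ F.map
  ract := M.ract.compl₂ G.map
  lact_mem i j f hf m hm := M.lact_mem i j _ (F.map_mem i f hf) m hm
  ract_mem i j m hm g hg := M.ract_mem i j m hm _ (G.map_mem j g hg)
  one_lact m := by
    rw [LinearMap.comp_apply, F.map_one, M.one_lact]
  ract_one m := by
    rw [LinearMap.compl₂_apply, G.map_one, M.ract_one]
  comp_lact f f' m := by
    simp only [LinearMap.comp_apply, F.map_comp, M.comp_lact]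
  ract_comp m g g' := by
    simp only [LinearMap.compl₂_apply, G.map_comp, M.ract_comp]
  lact_ract f m g := M.lact_ract _ m _
  d_lact f m := by
    simp only [LinearMap.comp_apply, M.d_lact, F.map_d]
    rw [DGMod.ε, DGMod.ε, DGMod.map_tw_zero F.map F.map_mem]
  d_ract m g := by
    simp only [LinearMap.compl₂_apply, M.d_ract, G.map_d]

theorem shift_aux (j : Γ) (M : Bimod.{w} C D) {X'' X' X : C.Obj} {Y Y' : D.Obj} :
    (∀ m : M.obj X Y, M.lact ((C.hom X X).tw j (C.one X)) m = m) ∧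
    (∀ (f : C.hom X'' X') (f' : C.hom X' X) (m : M.obj X Y),
      M.lact ((C.hom X'' X).tw j (C.comp f f')) m =
        M.lact ((C.hom X'' X').tw j f) (M.lact ((C.hom X' X).tw j f') m)) ∧
    (∀ (f : C.hom X' X) (m : M.obj X Y),
      sgn k (form j ι) • (M.obj X' Y).d (M.lact ((C.hom X' X).tw j f) m) =
        M.lact ((C.hom X' X).tw j ((C.hom X' X).d f)) m +
        M.lact ((C.hom X' X).tw j ((C.hom X' X).ε f)) (sgn k (form j ι) • (M.obj X Y).d m)) ∧
    (∀ (m : M.obj X Y) (g : D.hom Y Y'),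
      sgn k (form j ι) • (M.obj X Y').d (M.ract m g) =
        M.ract (sgn k (form j ι) • (M.obj X Y).d m) g +
        M.ract (((M.obj X Y).shift j).ε m) ((D.hom Y Y').d g)) := by
  refine ⟨fun m => ?_, fun f f' m => ?_, fun f m => ?_, fun m g => ?_⟩
  · rw [C.tw_one, M.one_lact]
  · rw [C.tw_comp, M.comp_lact]
  · rw [M.d_lact, DGMod.d_tw, smul_add, map_smul, LinearMap.smul_apply, smul_smul, sgn_mul_self,
      one_smul, map_smul, DGMod.ε, DGMod.tw_comm]
  · have h : ((M.obj X Y).shift j).ε m = sgn k (form j ι) • (M.obj X Y).ε m := by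
      refine (DGMod.shift_tw j ι (M.obj X Y) m).trans ?_
      rw [form_comm]; rfl
    rw [h, M.d_ract, smul_add, map_smul, map_smul]; rfl

/-- The shift `q^j M`; the left action is twisted: `f · m = (-1)^⟨j, |f|⟩ f m`. -/
def shift (j : Γ) (M : Bimod.{w} C D) : Bimod.{w} C D where
  obj X Y := (M.obj X Y).shift j
  lact {X' X Y} := (M.lact (X' := X') (X := X) (Y := Y)) ∘ₗ (C.hom X' X).tw j
  ract {X Y Y'} := M.ract (X := X) (Y := Y) (Y' := Y')
  lact_mem {X' X Y} i l f hf m hm := by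
    have := M.lact_mem _ _ _ (DGMod.tw_mem _ j hf) _ hm
    change _ ∈ (M.obj X' Y).gr (i + l - j)
    rwa [add_sub_assoc]
  ract_mem {X Y Y'} i l m hm g hg := by
    have := M.ract_mem _ _ _ hm _ hg
    change _ ∈ (M.obj X Y').gr (i + l - j)
    rwa [add_sub_right_comm]
  one_lact {X Y} := (M.shift_aux (X'' := X) (X' := X) (Y' := Y) j).1
  ract_one := M.ract_one
  comp_lact {X'' X' X Y} := (M.shift_aux (Y' := Y) j).2.1
  ract_comp := M.ract_comp
  lact_ract f m g := M.lact_ract _ m g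
  d_lact {X' X Y} := (M.shift_aux (X'' := X) (Y' := Y) j).2.2.1
  d_ract {X Y Y'} := (M.shift_aux (X'' := X) (X' := X) j).2.2.2

/-- The twist of a bimodule by an endomorphism `δ` of degree `ι` with `[d, δ] + δ² = 0`. -/
def twist (M : Bimod.{w} C D) (δ : ∀ X Y, M.obj X Y →ₗ[k] M.obj X Y)
    (hδ : ∀ X Y i, ∀ m ∈ (M.obj X Y).gr i, δ X Y m ∈ (M.obj X Y).gr (i + ι))
    (h : ∀ X Y m, (M.obj X Y).d (δ X Y m) + δ X Y ((M.obj X Y).d m) + δ X Y (δ X Y m) = 0)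
    (hl : ∀ X' X Y (f : C.hom X' X) (m : M.obj X Y),
      δ X' Y (M.lact f m) = M.lact ((C.hom X' X).ε f) (δ X Y m))
    (hr : ∀ X Y Y' (m : M.obj X Y) (g : D.hom Y Y'), δ X Y' (M.ract m g) = M.ract (δ X Y m) g) :
    Bimod.{w} C D where
  obj X Y := (M.obj X Y).twist (δ X Y) (hδ X Y) (h X Y)
  lact {X' X Y} := M.lact (X' := X') (X := X) (Y := Y)
  ract {X Y Y'} := M.ract (X := X) (Y := Y) (Y' := Y')
  lact_mem := M.lact_mem
  ract_mem := M.ract_mem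
  one_lact := M.one_lact
  ract_one := M.ract_one
  comp_lact := M.comp_lact
  ract_comp := M.ract_comp
  lact_ract := M.lact_ract
  d_lact {X' X Y} := fun f (m : M.obj X Y) =>
    show (M.obj X' Y).d (M.lact f m) + δ X' Y (M.lact f m) = M.lact ((C.hom X' X).d f) m +
      M.lact ((C.hom X' X).ε f) ((M.obj X Y).d m + δ X Y m) by
    rw [M.d_lact, hl, map_add, add_assoc]
  d_ract {X Y Y'} := fun (m : M.obj X Y) g =>
    show (M.obj X Y').d (M.ract m g) + δ X Y' (M.ract m g) =
      M.ract ((M.obj X Y).d m + δ X Y m) g + M.ract ((M.obj X Y).ε m) ((D.hom Y Y').d g) by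
    rw [M.d_ract, hr, map_add, LinearMap.add_apply, add_right_comm]

section dsum
variable {A : Type u''} (M : A → Bimod.{w} C D)

/-- The left action on a direct sum. -/
def dsumLact {X' X : C.Obj} {Y : D.Obj} : C.hom X' X →ₗ[k] (DGMod.dsum fun a => (M a).obj X Y) →ₗ[k]
    (DGMod.dsum fun a => (M a).obj X' Y) :=
  (DGMod.dsumLift (fun a => (M a).obj X Y) fun a =>
    ((M a).lact (X' := X') (X := X) (Y := Y)).flip.compr₂
      (DGMod.inc (fun a => (M a).obj X' Y) a)).flip

@[simp] theorem dsumLact_inc {X' X : C.Obj} {Y : D.Obj} (f : C.hom X' X) (a : A)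
    (m : (M a).obj X Y) :
    dsumLact M f (DGMod.inc _ a m) = DGMod.inc (fun a => (M a).obj X' Y) a ((M a).lact f m) := by
  simp [dsumLact]

/-- The right action on a direct sum. -/
def dsumRact {X : C.Obj} {Y Y' : D.Obj} : (DGMod.dsum fun a => (M a).obj X Y) →ₗ[k] D.hom Y Y' →ₗ[k]
    (DGMod.dsum fun a => (M a).obj X Y') :=
  DGMod.dsumLift (fun a => (M a).obj X Y) fun a =>
    ((M a).ract (X := X) (Y := Y) (Y' := Y')).compr₂ (DGMod.inc (fun a => (M a).obj X Y') a)

@[simp] theorem dsumRact_inc {X : C.Obj} {Y Y' : D.Obj} (a : A) (m : (M a).obj X Y)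
    (g : D.hom Y Y') :
    dsumRact M (DGMod.inc _ a m) g = DGMod.inc (fun a => (M a).obj X Y') a ((M a).ract m g) := by
  simp [dsumRact]

/-- The direct sum of bimodules. -/
def dsum : Bimod.{max w u''} C D where
  obj X Y := DGMod.dsum fun a => (M a).obj X Y
  lact := dsumLact M
  ract := dsumRact M
  lact_mem i j f hf m hm := by
    refine DGMod.dsum_gr_mem _ (F := dsumLact M f) (fun a x hx => ?_) hm
    rw [dsumLact_inc]
    exact DGMod.inc_mem _ ((M a).lact_mem i j f hf x hx)
  ract_mem i j m hm g hg := by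
    refine DGMod.dsum_gr_mem _ (F := (dsumRact M).flip g) (fun a x hx => ?_) hm
    rw [LinearMap.flip_apply, dsumRact_inc]
    exact DGMod.inc_mem _ ((M a).ract_mem i j x hx g hg)
  one_lact m := by
    induction m using DGMod.dsum_ind with
    | zero => simp
    | add x y hx hy => simp [hx, hy]
    | inc a x => simp [(M a).one_lact]
  ract_one m := by
    induction m using DGMod.dsum_ind with
    | zero => simp
    | add x y hx hy => simp [hx, hy]
    | inc a x => simp [(M a).ract_one]
  comp_lact f f' m := by
    induction m using DGMod.dsum_ind with
    | zero => simp
    | add x y hx hy => simp [hx, hy]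
    | inc a x => simp [(M a).comp_lact]
  ract_comp m g g' := by
    induction m using DGMod.dsum_ind with
    | zero => simp
    | add x y hx hy => simp [hx, hy]
    | inc a x => simp [(M a).ract_comp]
  lact_ract f m g := by
    induction m using DGMod.dsum_ind with
    | zero => simp
    | add x y hx hy => simp [hx, hy]
    | inc a x => simp [(M a).lact_ract]
  d_lact f m := by
    induction m using DGMod.dsum_ind with
    | zero => simp
    | add x y hx hy => simp only [map_add, hx, hy]; abel
    | inc a x => simp [(M a).d_lact, DGMod.d_inc]
  d_ract m g := by
    induction m using DGMod.dsum_ind with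
    | zero => simp
    | add x y hx hy => simp only [map_add, LinearMap.add_apply, hx, hy]; abel
    | inc a x => simp [(M a).d_ract, DGMod.d_inc, DGMod.ε_inc]

end dsum

section dprod
variable {A : Type u''} (M : A → Bimod.{w} C D)

/-- The product of bimodules. -/
def dprod : Bimod.{max w u''} C D where
  obj X Y := DGMod.dprod fun a => (M a).obj X Y
  lact {X' X Y} := DGMod.dprodMap₂ (fun a => (M a).lact (X' := X') (X := X) (Y := Y))
    (fun a => (M a).lact_mem)
  ract {X Y Y'} := (DGMod.dprodMap₂ (fun a => ((M a).ract (X := X) (Y := Y) (Y' := Y')).flip)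
    (fun a i j g hg m hm => by
      rw [add_comm]; exact (M a).ract_mem j i m hm g hg)).flip
  lact_mem i j f hf m hm := (DGMod.mem_dprod_gr _).2 fun a =>
    (M a).lact_mem i j f hf _ ((DGMod.mem_dprod_gr _).1 hm a)
  ract_mem i j m hm g hg := (DGMod.mem_dprod_gr _).2 fun a =>
    (M a).ract_mem i j _ ((DGMod.mem_dprod_gr _).1 hm a) g hg
  one_lact m := DGMod.pcomp_ext _ fun a => (M a).one_lact _
  ract_one m := DGMod.pcomp_ext _ fun a => (M a).ract_one _
  comp_lact f f' m := DGMod.pcomp_ext _ fun a => (M a).comp_lact f f' _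
  ract_comp m g g' := DGMod.pcomp_ext _ fun a => (M a).ract_comp _ g g'
  lact_ract f m g := DGMod.pcomp_ext _ fun a => (M a).lact_ract f _ g
  d_lact {X' X Y} f m := DGMod.pcomp_ext _ fun a => (M a).d_lact f (DGMod.pcomp _ a m)
  d_ract {X Y Y'} m g := DGMod.pcomp_ext _ fun a => by
    have h := (M a).d_ract (DGMod.pcomp _ a m) g
    rw [DGMod.ε, ← DGMod.pcomp_tw (fun a => (M a).obj X Y)] at h
    exact h

end dprod

section pre
variable (M : Bimod.{w} C D)

/-- The left action on `⨁_X ⟨Y|X⟩ ⊗ ⟨X|M|Z⟩`. -/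
def preLact {Y' Y : C.Obj} {Z : D.Obj} : C.hom Y' Y →ₗ[k]
    (DGMod.dsum fun X => (C.hom Y X).tensor (M.obj X Z)) →ₗ[k]
    (DGMod.dsum fun X => (C.hom Y' X).tensor (M.obj X Z)) :=
  (DGMod.dsumLift _ fun X => DGMod.tensorLift _ _ <|
    LinearMap.mk₂ k (fun f m => DGMod.inc (fun X => (C.hom Y' X).tensor (M.obj X Z)) X ∘ₗ
        (DGMod.tmul (C.hom Y' X) (M.obj X Z)).flip m ∘ₗ C.comp.flip f)
      (fun f f' m => by ext; simp) (fun c f m => by ext; simp)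
      (fun f m m' => by ext; simp) (fun c f m => by ext; simp)).flip

@[simp] theorem preLact_inc {Y' Y : C.Obj} {Z : D.Obj} (g : C.hom Y' Y) (X : C.Obj) (f : C.hom Y X)
    (m : M.obj X Z) :
    preLact M g (DGMod.inc _ X (DGMod.tmul _ _ f m)) =
      DGMod.inc (fun X => (C.hom Y' X).tensor (M.obj X Z)) X (DGMod.tmul _ _ (C.comp g f) m) := by
  simp [preLact]

/-- The right action on `⨁_X ⟨Y|X⟩ ⊗ ⟨X|M|Z⟩`. -/
def preRact {Y : C.Obj} {Z Z' : D.Obj} :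
    (DGMod.dsum fun X => (C.hom Y X).tensor (M.obj X Z)) →ₗ[k] D.hom Z Z' →ₗ[k]
    (DGMod.dsum fun X => (C.hom Y X).tensor (M.obj X Z')) :=
  (DGMod.dsumLift _ fun X => DGMod.tensorLift _ _ <|
    LinearMap.mk₂ k (fun f m => DGMod.inc (fun X => (C.hom Y X).tensor (M.obj X Z')) X ∘ₗ
        DGMod.tmul (C.hom Y X) (M.obj X Z') f ∘ₗ M.ract m)
      (fun f f' m => by ext; simp) (fun c f m => by ext; simp)
      (fun f m m' => by ext; simp) (fun c f m => by ext; simp))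

@[simp] theorem preRact_inc {Y : C.Obj} {Z Z' : D.Obj} (X : C.Obj) (f : C.hom Y X)
    (m : M.obj X Z) (g : D.hom Z Z') :
    preRact M (DGMod.inc _ X (DGMod.tmul _ _ f m)) g =
      DGMod.inc (fun X => (C.hom Y X).tensor (M.obj X Z')) X (DGMod.tmul _ _ f (M.ract m g)) := by
  simp [preRact]

theorem pre_ind {Y : C.Obj} {Z : D.Obj}
    {p : (DGMod.dsum fun X => (C.hom Y X).tensor (M.obj X Z)) → Prop}
    (x : DGMod.dsum fun X => (C.hom Y X).tensor (M.obj X Z)) (zero : p 0)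
    (add : ∀ x y, p x → p y → p (x + y))
    (tmul : ∀ X f m, p (DGMod.inc _ X (DGMod.tmul (C.hom Y X) (M.obj X Z) f m))) : p x := by
  induction x using DGMod.dsum_ind with
  | zero => exact zero
  | add x y hx hy => exact add x y hx hy
  | inc X x =>
    induction x using DGMod.tensor_ind with
    | zero => rw [map_zero]; exact zero
    | add x y hx hy => rw [map_add]; exact add _ _ hx hy
    | tmul f m => exact tmul X f m

theorem pre_gr_mem {Y : C.Obj} {Z : D.Obj} {N : Type w''} [AddCommGroup N] [Module k N]
    {S : Submodule k N} {F : (DGMod.dsum fun X => (C.hom Y X).tensor (M.obj X Z)) →ₗ[k] N} {l : Γ}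
    (h : ∀ X i j, i + j = l → ∀ f ∈ (C.hom Y X).gr i, ∀ m ∈ (M.obj X Z).gr j,
      F (DGMod.inc _ X (DGMod.tmul _ _ f m)) ∈ S)
    {x : DGMod.dsum fun X => (C.hom Y X).tensor (M.obj X Z)}
    (hx : x ∈ (DGMod.dsum fun X => (C.hom Y X).tensor (M.obj X Z)).gr l) : F x ∈ S := by
  refine DGMod.dsum_gr_mem _ (fun X x hx => ?_) hx
  exact DGMod.tensor_gr_le _ _ (S := S.comap (F ∘ₗ DGMod.inc (fun X => (C.hom Y X).tensor (M.obj X Z)) X))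
    (fun i j hij f hf m hm => h X i j hij f hf m hm) hx

theorem pre_inc_mem {Y X : C.Obj} {Z : D.Obj} {i j : Γ} {f : C.hom Y X} (hf : f ∈ (C.hom Y X).gr i)
    {m : M.obj X Z} (hm : m ∈ (M.obj X Z).gr j) :
    DGMod.inc (fun X => (C.hom Y X).tensor (M.obj X Z)) X (DGMod.tmul _ _ f m) ∈
      (DGMod.dsum fun X => (C.hom Y X).tensor (M.obj X Z)).gr (i + j) :=
  DGMod.inc_mem _ (DGMod.tmul_mem _ _ hf hm)

/-- The bimodule `C ⊗_k M`, that is `⟨Y|pre M|Z⟩ = ⨁_X ⟨Y|X⟩ ⊗ ⟨X|M|Z⟩`. -/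
def pre : Bimod.{max u v w} C D where
  obj Y Z := DGMod.dsum fun X => (C.hom Y X).tensor (M.obj X Z)
  lact := preLact M
  ract := preRact M
  lact_mem i j g hg x hx := by
    refine pre_gr_mem M (F := preLact M g) (fun X i' j' hij f hf m hm => ?_) hx
    rw [preLact_inc, ← hij, ← add_assoc]
    exact pre_inc_mem M (C.comp_mem _ _ _ hg _ hf) hm
  ract_mem i j x hx g hg := by
    refine pre_gr_mem M (F := (preRact M).flip g) (fun X i' j' hij f hf m hm => ?_) hx
    rw [LinearMap.flip_apply, preRact_inc, ← hij, add_assoc]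
    exact pre_inc_mem M hf (M.ract_mem _ _ _ hm _ hg)
  one_lact x := by
    induction x using pre_ind with
    | zero => simp
    | add x y hx hy => simp [hx, hy]
    | tmul X f m => simp [C.one_comp]
  ract_one x := by
    induction x using pre_ind with
    | zero => simp
    | add x y hx hy => simp [hx, hy]
    | tmul X f m => simp [M.ract_one]
  comp_lact g g' x := by
    induction x using pre_ind with
    | zero => simp
    | add x y hx hy => simp [hx, hy]
    | tmul X f m => simp [C.assoc]
  ract_comp x g g' := by
    induction x using pre_ind with
    | zero => simp
    | add x y hx hy => simp [hx, hy]
    | tmul X f m => simp [M.ract_comp]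
  lact_ract g x g' := by
    induction x using pre_ind with
    | zero => simp
    | add x y hx hy => simp [hx, hy]
    | tmul X f m => simp
  d_lact g x := by
    induction x using pre_ind with
    | zero => simp
    | add x y hx hy => simp only [map_add, hx, hy]; abel
    | tmul X f m =>
      simp only [preLact_inc, DGMod.d_inc, DGMod.d_tmul, C.d_comp, C.ε_comp, map_add,
        LinearMap.add_apply]
      abel
  d_ract x g := by
    induction x using pre_ind with
    | zero => simp
    | add x y hx hy => simp only [map_add, LinearMap.add_apply, hx, hy]; abel
    | tmul X f m =>
      simp only [preRact_inc, DGMod.d_inc, DGMod.d_tmul, DGMod.ε_inc, DGMod.ε_tmul, M.d_ract,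
        map_add, LinearMap.add_apply]
      abel

variable {M} {Y : C.Obj} {Z : D.Obj}

/-- The simple tensor `f ⊗ m` in `pre M`. -/
def preMk (X : C.Obj) : C.hom Y X →ₗ[k] M.obj X Z →ₗ[k] M.pre.obj Y Z :=
  (DGMod.tmul (C.hom Y X) (M.obj X Z)).compr₂
    (DGMod.inc (fun X => (C.hom Y X).tensor (M.obj X Z)) X)

/-- Linear maps out of `pre M`. -/
def preLift {N : Type w''} [AddCommGroup N] [Module k N]
    (F : ∀ X, C.hom Y X →ₗ[k] M.obj X Z →ₗ[k] N) : M.pre.obj Y Z →ₗ[k] N :=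
  DGMod.dsumLift _ fun X => DGMod.tensorLift _ _ (F X)

theorem preLift_mk {N : Type w''} [AddCommGroup N] [Module k N]
    (F : ∀ X, C.hom Y X →ₗ[k] M.obj X Z →ₗ[k] N) (X : C.Obj) (f : C.hom Y X) (m : M.obj X Z) :
    preLift F (preMk X f m) = F X f m :=
  (DGMod.dsumLift_inc _ _ X _).trans (DGMod.tensorLift_tmul _ _ _ f m)

theorem preMk_ind {p : M.pre.obj Y Z → Prop} (x : M.pre.obj Y Z) (zero : p 0)
    (add : ∀ x y, p x → p y → p (x + y)) (mk : ∀ X f m, p (preMk X f m)) : p x :=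
  pre_ind M x zero add mk

theorem preMk_gr_mem {N : Type w''} [AddCommGroup N] [Module k N]
    {S : Submodule k N} {F : M.pre.obj Y Z →ₗ[k] N} {l : Γ}
    (h : ∀ X i j, i + j = l → ∀ f ∈ (C.hom Y X).gr i, ∀ m ∈ (M.obj X Z).gr j,
      F (preMk X f m) ∈ S) {x : M.pre.obj Y Z} (hx : x ∈ (M.pre.obj Y Z).gr l) : F x ∈ S :=
  pre_gr_mem M h hx

theorem preMk_mem {X : C.Obj} {i j : Γ} {f : C.hom Y X} (hf : f ∈ (C.hom Y X).gr i)
    {m : M.obj X Z} (hm : m ∈ (M.obj X Z).gr j) : preMk X f m ∈ (M.pre.obj Y Z).gr (i + j) :=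
  pre_inc_mem M hf hm

theorem d_preMk (X : C.Obj) (f : C.hom Y X) (m : M.obj X Z) : (M.pre.obj Y Z).d (preMk X f m) =
    preMk X ((C.hom Y X).d f) m + preMk X ((C.hom Y X).ε f) ((M.obj X Z).d m) :=
  (DGMod.d_inc _ X _).trans ((congrArg _ (DGMod.d_tmul _ _ f m)).trans (map_add _ _ _))

theorem lact_preMk {Y' : C.Obj} (g : C.hom Y' Y) (X : C.Obj) (f : C.hom Y X) (m : M.obj X Z) :
    M.pre.lact g (preMk X f m) = preMk X (C.comp g f) m := preLact_inc M g X f m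

theorem ract_preMk {Z' : D.Obj} (X : C.Obj) (f : C.hom Y X) (m : M.obj X Z) (g : D.hom Z Z') :
    M.pre.ract (preMk X f m) g = preMk X f (M.ract m g) := preRact_inc M X f m g

end pre
end Bimod
end
namespace Bimod

section stage
variable {C : DGCat.{u, v} k Γ} {D : DGCat.{u', v'} k Γ}

/-- The action map `pre M → M`, `f ⊗ m ↦ f m`. -/
def act (M : Bimod.{w} C D) (Y : C.Obj) (Z : D.Obj) : M.pre.obj Y Z →ₗ[k] M.obj Y Z :=
  preLift fun _ => M.lact

theorem act_mk (M : Bimod.{w} C D) {Y : C.Obj} {Z : D.Obj} (X : C.Obj) (f : C.hom Y X)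
    (m : M.obj X Z) : M.act Y Z (preMk X f m) = M.lact f m := preLift_mk _ X f m

theorem act_closed (M : Bimod.{w} C D) : IsClosedBimodMap M.pre M M.act where
  mem Y Z i x hx := by
    refine preMk_gr_mem (F := M.act Y Z) (fun X i' j' hij f hf m hm => ?_) hx
    rw [act_mk, ← hij]
    exact M.lact_mem _ _ _ hf _ hm
  d Y Z x := by
    induction x using preMk_ind with
    | zero => simp only [map_zero]
    | add x y hx hy => simp only [map_add, hx, hy]
    | mk X f m => rw [d_preMk, map_add, act_mk, act_mk, act_mk, M.d_lact]
  lact Y' Y Z g x := by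
    induction x using preMk_ind with
    | zero => simp only [map_zero]
    | add x y hx hy => simp only [map_add, hx, hy]
    | mk X f m => rw [lact_preMk, act_mk, act_mk, M.comp_lact]
  ract Y Z Z' x g := by
    induction x using preMk_ind with
    | zero => simp only [map_zero, LinearMap.zero_apply]
    | add x y hx hy => simp only [map_add, LinearMap.add_apply, hx, hy]
    | mk X f m => rw [ract_preMk, act_mk, act_mk, M.lact_ract]

variable {N : Bimod.{w} C D}

/-- For a map `φ : pre N → N`, the map `pre (pre N) → pre N`, `f ⊗ b ↦ f b - f ⊗ φ(b)`. -/
def preδ (φ : ∀ Y Z, N.pre.obj Y Z →ₗ[k] N.obj Y Z) (Y : C.Obj) (Z : D.Obj) :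
    N.pre.pre.obj Y Z →ₗ[k] N.pre.obj Y Z :=
  N.pre.act Y Z - preLift fun X => (preMk X).compl₂ (φ X Z)

theorem preδ_mk (φ : ∀ Y Z, N.pre.obj Y Z →ₗ[k] N.obj Y Z) {Y : C.Obj} {Z : D.Obj} (X : C.Obj)
    (f : C.hom Y X) (b : N.pre.obj X Z) :
    preδ φ Y Z (preMk X f b) = N.pre.lact f b - preMk X f (φ X Z b) := by
  rw [preδ, LinearMap.sub_apply, act_mk, preLift_mk, LinearMap.compl₂_apply]

theorem preδ_closed {φ : ∀ Y Z, N.pre.obj Y Z →ₗ[k] N.obj Y Z} (h : IsClosedBimodMap N.pre N φ) :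
    IsClosedBimodMap N.pre.pre N.pre (preδ φ) where
  mem Y Z i x hx := by
    refine preMk_gr_mem (F := preδ φ Y Z) (fun X i' j' hij f hf m hm => ?_) hx
    rw [preδ_mk, ← hij]
    exact Submodule.sub_mem _ (N.pre.lact_mem _ _ _ hf _ hm)
      (preMk_mem hf (h.mem _ _ _ _ hm))
  d Y Z x := by
    induction x using preMk_ind with
    | zero => simp only [map_zero]
    | add x y hx hy => simp only [map_add, hx, hy]
    | mk X f m =>
      rw [d_preMk, map_add, preδ_mk, preδ_mk, preδ_mk, map_sub, N.pre.d_lact, d_preMk, h.d]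
      abel
  lact Y' Y Z g x := by
    induction x using preMk_ind with
    | zero => simp only [map_zero]
    | add x y hx hy => simp only [map_add, hx, hy]
    | mk X f m =>
      rw [lact_preMk, preδ_mk, preδ_mk, map_sub, N.pre.comp_lact, lact_preMk]
  ract Y Z Z' x g := by
    induction x using preMk_ind with
    | zero => simp only [map_zero, LinearMap.zero_apply]
    | add x y hx hy => simp only [map_add, LinearMap.add_apply, hx, hy]
    | mk X f m =>
      rw [ract_preMk, preδ_mk, preδ_mk, map_sub, LinearMap.sub_apply, N.pre.lact_ract,
        ract_preMk, h.ract]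

theorem act_preδ_act (M : Bimod.{w} C D) (Y : C.Obj) (Z : D.Obj) (x : M.pre.pre.obj Y Z) :
    M.act Y Z (preδ M.act Y Z x) = 0 := by
  induction x using preMk_ind with
  | zero => simp only [map_zero]
  | add x y hx hy => simp only [map_add, hx, hy, add_zero]
  | mk X f m => rw [preδ_mk, map_sub, M.act_closed.lact, act_mk, sub_self]

theorem preδ_preδ {φ : ∀ Y Z, N.pre.obj Y Z →ₗ[k] N.obj Y Z} (h : IsClosedBimodMap N.pre N φ)
    (h0 : ∀ Y Z x, φ Y Z (preδ φ Y Z x) = 0) (Y : C.Obj) (Z : D.Obj) (x : N.pre.pre.pre.obj Y Z) :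
    preδ φ Y Z (preδ (preδ φ) Y Z x) = 0 := by
  induction x using preMk_ind with
  | zero => simp only [map_zero]
  | add x y hx hy => simp only [map_add, hx, hy, add_zero]
  | mk X f m =>
    rw [preδ_mk, map_sub, (preδ_closed h).lact, preδ_mk, h0, map_zero, sub_zero, sub_self]

end stage

section shiftMap
variable {C : DGCat.{u, v} k Γ} {D : DGCat.{u', v'} k Γ} {M N L : Bimod.{w} C D}

/-- A family of maps regarded as a family of maps between shifts. -/
def shiftMap (φ : ∀ Y Z, M.obj Y Z →ₗ[k] N.obj Y Z) (j l : Γ) (Y : C.Obj) (Z : D.Obj) :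
    (M.shift j).obj Y Z →ₗ[k] (N.shift l).obj Y Z := φ Y Z

variable {φ : ∀ Y Z, M.obj Y Z →ₗ[k] N.obj Y Z} {j l : Γ}

theorem shiftMap_mem (h : IsClosedBimodMap M N φ) (hjl : j + ι = l) (Y : C.Obj) (Z : D.Obj) (i : Γ)
    (x : (M.shift j).obj Y Z) (hx : x ∈ ((M.shift j).obj Y Z).gr i) :
    shiftMap φ j l Y Z x ∈ ((N.shift l).obj Y Z).gr (i + ι) := by
  have := h.mem Y Z _ x hx
  change φ Y Z x ∈ (N.obj Y Z).gr (i + ι - l)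
  rwa [← hjl, add_sub_add_right_eq_sub]

theorem shiftMap_d_aux (h : IsClosedBimodMap M N φ) (hjl : j + ι = l) (Y : C.Obj) (Z : D.Obj)
    (x : M.obj Y Z) : sgn k (form l ι) • (N.obj Y Z).d (φ Y Z x) +
      φ Y Z (sgn k (form j ι) • (M.obj Y Z).d x) = 0 := by
  rw [← hjl, map_add, AddMonoidHom.add_apply, sgn_add, form_ι_ι, sgn_one, mul_neg_one, neg_smul,
    map_smul, h.d, neg_add_cancel]

theorem shiftMap_d (h : IsClosedBimodMap M N φ) (hjl : j + ι = l) (Y : C.Obj) (Z : D.Obj)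
    (x : (M.shift j).obj Y Z) : ((N.shift l).obj Y Z).d (shiftMap φ j l Y Z x) +
      shiftMap φ j l Y Z (((M.shift j).obj Y Z).d x) = 0 :=
  shiftMap_d_aux h hjl Y Z x

theorem shiftMap_lact_aux (h : IsClosedBimodMap M N φ) (hjl : j + ι = l) (Y' Y : C.Obj) (Z : D.Obj)
    (f : C.hom Y' Y) (x : M.obj Y Z) : φ Y' Z (M.lact ((C.hom Y' Y).tw j f) x) =
      N.lact ((C.hom Y' Y).tw l ((C.hom Y' Y).ε f)) (φ Y Z x) := by
  rw [h.lact, ← hjl, DGMod.tw_add, DGMod.ε, DGMod.tw_tw]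

theorem shiftMap_lact (h : IsClosedBimodMap M N φ) (hjl : j + ι = l) (Y' Y : C.Obj) (Z : D.Obj)
    (f : C.hom Y' Y) (x : (M.shift j).obj Y Z) : shiftMap φ j l Y' Z ((M.shift j).lact f x) =
      (N.shift l).lact ((C.hom Y' Y).ε f) (shiftMap φ j l Y Z x) :=
  shiftMap_lact_aux h hjl Y' Y Z f x

theorem shiftMap_ract (h : IsClosedBimodMap M N φ) (Y : C.Obj) (Z Z' : D.Obj)
    (x : (M.shift j).obj Y Z) (g : D.hom Z Z') : shiftMap φ j l Y Z' ((M.shift j).ract x g) =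
      (N.shift l).ract (shiftMap φ j l Y Z x) g :=
  h.ract Y Z Z' x g

theorem shiftMap_shiftMap {ψ : ∀ Y Z, N.obj Y Z →ₗ[k] L.obj Y Z} {m : Γ}
    (h : ∀ Y Z x, ψ Y Z (φ Y Z x) = 0) (Y : C.Obj) (Z : D.Obj) (x : (M.shift j).obj Y Z) :
    shiftMap ψ l m Y Z (shiftMap φ j l Y Z x) = 0 := h Y Z x

end shiftMap

section tot
variable {C : DGCat.{u, v} k Γ} {D : DGCat.{u', v'} k Γ}

variable (C D) in
/-- A complex `⋯ → B₂ → B₁ → B₀` of bimodules, with maps of degree `ι` that anticommute with the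
differentials. -/
structure Cplx where
  B : ℕ → Bimod.{w} C D
  δ : ∀ r Y Z, (B (r + 1)).obj Y Z →ₗ[k] (B r).obj Y Z
  δ_mem : ∀ r Y Z i, ∀ x ∈ ((B (r + 1)).obj Y Z).gr i, δ r Y Z x ∈ ((B r).obj Y Z).gr (i + ι)
  δ_d : ∀ r Y Z x, ((B r).obj Y Z).d (δ r Y Z x) + δ r Y Z (((B (r + 1)).obj Y Z).d x) = 0
  δ_δ : ∀ r Y Z x, δ r Y Z (δ (r + 1) Y Z x) = 0
  δ_lact : ∀ r Y' Y Z (f : C.hom Y' Y) (x : (B (r + 1)).obj Y Z),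
    δ r Y' Z ((B (r + 1)).lact f x) = (B r).lact ((C.hom Y' Y).ε f) (δ r Y Z x)
  δ_ract : ∀ r Y Z Z' (x : (B (r + 1)).obj Y Z) (g : D.hom Z Z'),
    δ r Y Z' ((B (r + 1)).ract x g) = (B r).ract (δ r Y Z x) g

namespace Cplx
variable (K : Cplx.{w} C D)

/-- The inclusion of `B r` into the direct sum. -/
def sInc (r : ℕ) (Y : C.Obj) (Z : D.Obj) : (K.B r).obj Y Z →ₗ[k] (dsum K.B).obj Y Z :=
  DGMod.inc (fun r => (K.B r).obj Y Z) r

variable {K} in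
theorem sInc_ind {Y : C.Obj} {Z : D.Obj} {p : (dsum K.B).obj Y Z → Prop}
    (x : (dsum K.B).obj Y Z) (zero : p 0) (add : ∀ x y, p x → p y → p (x + y))
    (inc : ∀ r x, p (K.sInc r Y Z x)) : p x :=
  DGMod.dsum_ind _ x zero add inc

theorem d_sInc (r : ℕ) (Y : C.Obj) (Z : D.Obj) (x : (K.B r).obj Y Z) :
    ((dsum K.B).obj Y Z).d (K.sInc r Y Z x) = K.sInc r Y Z (((K.B r).obj Y Z).d x) :=
  DGMod.d_inc (fun r => (K.B r).obj Y Z) r x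

theorem lact_sInc (r : ℕ) {Y' Y : C.Obj} (Z : D.Obj) (f : C.hom Y' Y) (x : (K.B r).obj Y Z) :
    (dsum K.B).lact f (K.sInc r Y Z x) = K.sInc r Y' Z ((K.B r).lact f x) :=
  dsumLact_inc _ f r x

theorem ract_sInc (r : ℕ) (Y : C.Obj) {Z Z' : D.Obj} (x : (K.B r).obj Y Z) (g : D.hom Z Z') :
    (dsum K.B).ract (K.sInc r Y Z x) g = K.sInc r Y Z' ((K.B r).ract x g) :=
  dsumRact_inc _ r x g

/-- The map `δ` on the `r`-th summand (zero on the `0`-th). -/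
def δInc (Y : C.Obj) (Z : D.Obj) : ∀ r, (K.B r).obj Y Z →ₗ[k] (dsum K.B).obj Y Z
  | 0 => 0
  | r + 1 => K.sInc r Y Z ∘ₗ K.δ r Y Z

/-- The map `δ` on the direct sum. -/
def sδ (Y : C.Obj) (Z : D.Obj) : (dsum K.B).obj Y Z →ₗ[k] (dsum K.B).obj Y Z :=
  DGMod.dsumLift (fun r => (K.B r).obj Y Z) (K.δInc Y Z)

theorem sδ_zero (Y : C.Obj) (Z : D.Obj) (x : (K.B 0).obj Y Z) :
    K.sδ Y Z (K.sInc 0 Y Z x) = 0 :=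
  DGMod.dsumLift_inc (fun r => (K.B r).obj Y Z) (K.δInc Y Z) 0 x

theorem sδ_succ (r : ℕ) (Y : C.Obj) (Z : D.Obj) (x : (K.B (r + 1)).obj Y Z) :
    K.sδ Y Z (K.sInc (r + 1) Y Z x) = K.sInc r Y Z (K.δ r Y Z x) :=
  DGMod.dsumLift_inc (fun r => (K.B r).obj Y Z) (K.δInc Y Z) (r + 1) x

theorem sδ_sδ (Y : C.Obj) (Z : D.Obj) (x : (dsum K.B).obj Y Z) : K.sδ Y Z (K.sδ Y Z x) = 0 := by
  induction x using sInc_ind with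
  | zero => simp only [map_zero]
  | add x y hx hy => simp only [map_add, hx, hy, add_zero]
  | inc r x =>
    match r, x with
    | 0, x => rw [sδ_zero, map_zero]
    | 1, x => rw [sδ_succ, sδ_zero]
    | r + 2, x => rw [sδ_succ, sδ_succ, K.δ_δ, map_zero]

theorem sδ_d (Y : C.Obj) (Z : D.Obj) (x : (dsum K.B).obj Y Z) :
    ((dsum K.B).obj Y Z).d (K.sδ Y Z x) + K.sδ Y Z (((dsum K.B).obj Y Z).d x) = 0 := by
  induction x using sInc_ind with
  | zero => simp only [map_zero, add_zero]
  | add x y hx hy =>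
    simp only [map_add]
    rw [add_add_add_comm, hx, hy, add_zero]
  | inc r x =>
    match r, x with
    | 0, x => rw [d_sInc, sδ_zero, sδ_zero, map_zero, add_zero]
    | r + 1, x => rw [d_sInc, sδ_succ, sδ_succ, d_sInc, ← map_add, K.δ_d, map_zero]

/-- The total complex `tw_δ(⨁_r B_r)`. -/
def tot : Bimod.{w} C D :=
  (dsum K.B).twist K.sδ
    (fun Y Z i x hx => by
      refine DGMod.dsum_gr_mem _ (F := K.sδ Y Z) (fun r x hx => ?_) hx
      change K.sδ Y Z (K.sInc r Y Z x) ∈ _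
      match r, x, hx with
      | 0, x, hx => rw [sδ_zero]; exact Submodule.zero_mem _
      | r + 1, x, hx => rw [sδ_succ]; exact DGMod.inc_mem _ (K.δ_mem r Y Z i x hx))
    (fun Y Z x => by rw [sδ_sδ, sδ_d, add_zero])
    (fun Y' Y Z f x => by
      induction x using sInc_ind with
      | zero => simp only [map_zero]
      | add x y hx hy => simp only [map_add, hx, hy]
      | inc r x =>
        match r, x with
        | 0, x => rw [lact_sInc, sδ_zero, sδ_zero, map_zero]
        | r + 1, x => rw [lact_sInc, sδ_succ, sδ_succ, lact_sInc, K.δ_lact])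
    (fun Y Z Z' x g => by
      induction x using sInc_ind with
      | zero => simp only [map_zero, LinearMap.zero_apply]
      | add x y hx hy => simp only [map_add, LinearMap.add_apply, hx, hy]
      | inc r x =>
        match r, x with
        | 0, x => rw [ract_sInc, sδ_zero, sδ_zero, map_zero, LinearMap.zero_apply]
        | r + 1, x => rw [ract_sInc, sδ_succ, sδ_succ, ract_sInc, K.δ_ract])

/-- The inclusion `B_r → tot`. -/
def inc (r : ℕ) (Y : C.Obj) (Z : D.Obj) : (K.B r).obj Y Z →ₗ[k] K.tot.obj Y Z :=
  K.sInc r Y Z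

/-- The component in `B_r` of an element of the total complex. -/
def coord (r : ℕ) (Y : C.Obj) (Z : D.Obj) : K.tot.obj Y Z →ₗ[k] (K.B r).obj Y Z :=
  DGMod.comp (fun r => (K.B r).obj Y Z) r

/-- The map `δ` on the product. -/
def pδ (Y : C.Obj) (Z : D.Obj) : (dprod K.B).obj Y Z →ₗ[k] (dprod K.B).obj Y Z :=
  DGMod.dprodLift (fun r => (K.B r).obj Y Z) (N := (dprod K.B).obj Y Z) ι
    (fun r => K.δ r Y Z ∘ₗ DGMod.pcomp (fun r => (K.B r).obj Y Z) (r + 1))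
    (fun r i _ hx => K.δ_mem r Y Z i _ ((DGMod.mem_dprod_gr _).1 hx (r + 1)))

/-- The completed total complex `tw_δ(∏_r B_r)`. -/
def totHat : Bimod.{w} C D :=
  (dprod K.B).twist K.pδ
    (fun Y Z i x hx => (DGMod.mem_dprod_gr _).2 fun r =>
      K.δ_mem r Y Z i _ ((DGMod.mem_dprod_gr _).1 hx (r + 1)))
    (fun Y Z x => DGMod.pcomp_ext _ fun r => by
      have h1 := K.δ_d r Y Z (DGMod.pcomp (fun r => (K.B r).obj Y Z) (r + 1) x)
      have h2 := K.δ_δ r Y Z (DGMod.pcomp (fun r => (K.B r).obj Y Z) (r + 2) x)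
      exact (congrArg₂ (· + ·) h1 h2).trans (add_zero _))
    (fun Y' Y Z f x => DGMod.pcomp_ext _ fun r => K.δ_lact r Y' Y Z f _)
    (fun Y Z Z' x g => DGMod.pcomp_ext _ fun r => K.δ_ract r Y Z Z' _ g)

/-- The component in `B_r` of an element of the completed total complex. -/
def component (r : ℕ) (Y : C.Obj) (Z : D.Obj) : K.totHat.obj Y Z →ₗ[k] (K.B r).obj Y Z :=
  DGMod.pcomp (fun r => (K.B r).obj Y Z) r

end Cplx
end tot

section bar
variable (C : DGCat.{u, v} k Γ)

/-- The (unshifted) length `r` part of the bar complex,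
`⟨Y|barT r|Y'⟩ = ⨁_{X_0,…,X_r} ⟨Y|X_0⟩ ⊗ ⟨X_0|X_1⟩ ⊗ ⋯ ⊗ ⟨X_{r-1}|X_r⟩ ⊗ ⟨X_r|Y'⟩`,
with the internal differential and the bimodule structure given by composition at the ends. -/
def barT : ℕ → Bimod.{max u v} C C
  | 0 => (unit C).pre
  | r + 1 => (barT r).pre

/-- The bar differential
`f_0 ⊗ ⋯ ⊗ f_{r+2} ↦ ∑_i (-1)^i f_0 ⊗ ⋯ ⊗ (f_i ∘ f_{i+1}) ⊗ ⋯ ⊗ f_{r+2}`,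
given recursively by `f_0 ⊗ b ↦ f_0 b - f_0 ⊗ δ(b)`. -/
def barδ : ∀ (r : ℕ) (Y Z : C.Obj), (barT C (r + 1)).obj Y Z →ₗ[k] (barT C r).obj Y Z
  | 0 => preδ (unit C).act
  | r + 1 => preδ (barδ r)

theorem barδ_closed : ∀ r, IsClosedBimodMap (barT C (r + 1)) (barT C r) (barδ C r)
  | 0 => preδ_closed (unit C).act_closed
  | r + 1 => preδ_closed (barδ_closed r)

theorem barδ_barδ : ∀ r Y Z x, barδ C r Y Z (barδ C (r + 1) Y Z x) = 0
  | 0 => preδ_preδ (unit C).act_closed (unit C).act_preδ_act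
  | r + 1 => preδ_preδ (barδ_closed C r) (barδ_barδ r)

/-- The shifted length `r` part `q^{-rι} barT r` of the bar complex. -/
def barS (r : ℕ) : Bimod.{max u v} C C := (barT C r).shift (-(r • ι))

/-- The bar differential between the shifted parts; it has degree `ι`. -/
def barδS (r : ℕ) (Y Z : C.Obj) : (barS C (r + 1)).obj Y Z →ₗ[k] (barS C r).obj Y Z :=
  shiftMap (barδ C r) _ _ Y Z

theorem shift_step (r : ℕ) : -((r + 1) • (ι : Γ)) + ι = -(r • ι) := by
  rw [succ_nsmul]; abel

theorem barδS_mem (r : ℕ) (Y Z : C.Obj) (i : Γ) (x : (barS C (r + 1)).obj Y Z)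
    (hx : x ∈ ((barS C (r + 1)).obj Y Z).gr i) :
    barδS C r Y Z x ∈ ((barS C r).obj Y Z).gr (i + ι) :=
  shiftMap_mem (barδ_closed C r) (shift_step r) Y Z i x hx

theorem barδS_d (r : ℕ) (Y Z : C.Obj) (x : (barS C (r + 1)).obj Y Z) :
    ((barS C r).obj Y Z).d (barδS C r Y Z x) +
      barδS C r Y Z (((barS C (r + 1)).obj Y Z).d x) = 0 :=
  shiftMap_d (barδ_closed C r) (shift_step r) Y Z x

theorem barδS_lact (r : ℕ) (Y' Y Z : C.Obj) (f : C.hom Y' Y) (x : (barS C (r + 1)).obj Y Z) :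
    barδS C r Y' Z ((barS C (r + 1)).lact f x) =
      (barS C r).lact ((C.hom Y' Y).ε f) (barδS C r Y Z x) :=
  shiftMap_lact (barδ_closed C r) (shift_step r) Y' Y Z f x

theorem barδS_ract (r : ℕ) (Y Z Z' : C.Obj) (x : (barS C (r + 1)).obj Y Z) (g : C.hom Z Z') :
    barδS C r Y Z' ((barS C (r + 1)).ract x g) = (barS C r).ract (barδS C r Y Z x) g :=
  shiftMap_ract (barδ_closed C r) Y Z Z' x g

theorem barδS_barδS (r : ℕ) (Y Z : C.Obj) (x : (barS C (r + 2)).obj Y Z) :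
    barδS C r Y Z (barδS C (r + 1) Y Z x) = 0 :=
  shiftMap_shiftMap (barδ_barδ C r) Y Z x

/-- The complex of bimodules `⋯ → q^{-2ι} barT 2 → q^{-ι} barT 1 → barT 0`. -/
def barCplx : Cplx.{max u v} C C where
  B := barS C
  δ := barδS C
  δ_mem := barδS_mem C
  δ_d := barδS_d C
  δ_δ := barδS_barδS C
  δ_lact := barδS_lact C
  δ_ract := barδS_ract C

/-- The two-sided bar complex `Bar(C) = tw_δ(⨁_r q^{-rι} barT r)`. -/
def bar : Bimod.{max u v} C C := (barCplx C).tot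

/-- The completed bar complex `tw_δ(∏_r q^{-rι} barT r)`. -/
def barHat : Bimod.{max u v} C C := (barCplx C).totHat

end bar
end Bimod

namespace DGMod

theorem hom_ind {M : DGMod.{w} k Γ} {p : M → Prop} (x : M) (zero : p 0)
    (add : ∀ x y, p x → p y → p (x + y)) (mem : ∀ i, ∀ x ∈ M.gr i, p x) : p x :=
  Submodule.iSup_induction (motive := p) M.gr (x := x) (by rw [M.span]; trivial) mem zero add

section quot
variable {M : DGMod.{w} k Γ} {S : Submodule k M} {hS : ∀ i, ∀ x ∈ S, M.proj i x ∈ S}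
  {hd : ∀ x ∈ S, M.d x ∈ S}

/-- The quotient map. -/
def qmk : M →ₗ[k] M.quot S hS hd := S.mkQ

/-- Maps out of a quotient. -/
def qlift {N : Type w'} [AddCommGroup N] [Module k N] (F : M →ₗ[k] N) (h : ∀ x ∈ S, F x = 0) :
    M.quot S hS hd →ₗ[k] N := S.liftQ F h

theorem qlift_mk {N : Type w'} [AddCommGroup N] [Module k N] (F : M →ₗ[k] N)
    (h : ∀ x ∈ S, F x = 0) (x : M) :
    qlift (hS := hS) (hd := hd) F h (qmk x) = F x := rfl

theorem q_ind {p : M.quot S hS hd → Prop} (x : M.quot S hS hd) (mk : ∀ x, p (qmk x)) : p x :=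
  Submodule.Quotient.induction_on S (C := p) x mk

theorem qmk_eq_zero {x : M} (hx : x ∈ S) : (qmk x : M.quot S hS hd) = 0 :=
  (Submodule.Quotient.mk_eq_zero S).2 hx

theorem qmk_mem {i : Γ} {x : M} (hx : x ∈ M.gr i) : (qmk x : M.quot S hS hd) ∈
    (M.quot S hS hd).gr i := ⟨x, hx, rfl⟩

theorem exists_qmk {i : Γ} {x : M.quot S hS hd} (hx : x ∈ (M.quot S hS hd).gr i) :
    ∃ y ∈ M.gr i, qmk y = x := hx

theorem d_qmk (x : M) : (M.quot S hS hd).d (qmk x) = qmk (M.d x) := rfl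

theorem ε_qmk (x : M) : (M.quot S hS hd).ε (qmk x) = qmk (M.ε x) :=
  (map_tw_zero qmk (fun _ _ => qmk_mem) ι x).symm

end quot
end DGMod

namespace Bimod

section tensor
variable {A : DGCat.{u, v} k Γ} {B : DGCat.{u', v'} k Γ} {C : DGCat.{u'', v''} k Γ}
variable (M : Bimod.{w} A B) (N : Bimod.{w'} B C)

/-- The dg module `⨁_Y ⟨X|M|Y⟩ ⊗ ⟨Y|N|Z⟩`. -/
def ten (X : A.Obj) (Z : C.Obj) : DGMod.{max u' w w'} k Γ :=
  DGMod.dsum fun Y => (M.obj X Y).tensor (N.obj Y Z)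

/-- The simple tensor `m ⊗ n` in `⨁_Y ⟨X|M|Y⟩ ⊗ ⟨Y|N|Z⟩`. -/
def tenMk {X : A.Obj} {Z : C.Obj} (Y : B.Obj) :
    M.obj X Y →ₗ[k] N.obj Y Z →ₗ[k] ten M N X Z :=
  (DGMod.tmul (M.obj X Y) (N.obj Y Z)).compr₂
    (DGMod.inc (fun Y => (M.obj X Y).tensor (N.obj Y Z)) Y)

variable {M N} in
/-- Linear maps out of `⨁_Y ⟨X|M|Y⟩ ⊗ ⟨Y|N|Z⟩`. -/
def tenLift {X : A.Obj} {Z : C.Obj} {P : Type w''} [AddCommGroup P] [Module k P]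
    (F : ∀ Y, M.obj X Y →ₗ[k] N.obj Y Z →ₗ[k] P) : ten M N X Z →ₗ[k] P :=
  DGMod.dsumLift _ fun Y => DGMod.tensorLift _ _ (F Y)

theorem tenLift_mk {X : A.Obj} {Z : C.Obj} {P : Type w''} [AddCommGroup P] [Module k P]
    (F : ∀ Y, M.obj X Y →ₗ[k] N.obj Y Z →ₗ[k] P) (Y : B.Obj) (m : M.obj X Y) (n : N.obj Y Z) :
    tenLift F (tenMk M N Y m n) = F Y m n :=
  (DGMod.dsumLift_inc _ _ Y _).trans (DGMod.tensorLift_tmul _ _ _ m n)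

variable {M N} in
theorem ten_ind {X : A.Obj} {Z : C.Obj} {p : ten M N X Z → Prop} (x : ten M N X Z) (zero : p 0)
    (add : ∀ x y, p x → p y → p (x + y)) (mk : ∀ Y m n, p (tenMk M N Y m n)) : p x := by
  induction x using DGMod.dsum_ind with
  | zero => exact zero
  | add x y hx hy => exact add x y hx hy
  | inc Y x =>
    induction x using DGMod.tensor_ind with
    | zero => rw [map_zero]; exact zero
    | add x y hx hy => rw [map_add]; exact add _ _ hx hy
    | tmul m n => exact mk Y m n

theorem tenMk_mem {X : A.Obj} {Y : B.Obj} {Z : C.Obj} {i j : Γ} {m : M.obj X Y}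
    (hm : m ∈ (M.obj X Y).gr i) {n : N.obj Y Z} (hn : n ∈ (N.obj Y Z).gr j) :
    tenMk M N Y m n ∈ (ten M N X Z).gr (i + j) :=
  DGMod.inc_mem _ (DGMod.tmul_mem _ _ hm hn)

theorem ten_gr_mem {X : A.Obj} {Z : C.Obj} {P : Type w''} [AddCommGroup P] [Module k P]
    {S : Submodule k P} {F : ten M N X Z →ₗ[k] P} {l : Γ}
    (h : ∀ Y i j, i + j = l → ∀ m ∈ (M.obj X Y).gr i, ∀ n ∈ (N.obj Y Z).gr j,
      F (tenMk M N Y m n) ∈ S) {x : ten M N X Z} (hx : x ∈ (ten M N X Z).gr l) : F x ∈ S := by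
  refine DGMod.dsum_gr_mem _ (fun Y x hx => ?_) hx
  exact DGMod.tensor_gr_le _ _
    (S := S.comap (F ∘ₗ DGMod.inc (fun Y => (M.obj X Y).tensor (N.obj Y Z)) Y))
    (fun i j hij m hm n hn => h Y i j hij m hm n hn) hx

theorem d_tenMk {X : A.Obj} {Z : C.Obj} (Y : B.Obj) (m : M.obj X Y) (n : N.obj Y Z) :
    (ten M N X Z).d (tenMk M N Y m n) =
      tenMk M N Y ((M.obj X Y).d m) n + tenMk M N Y ((M.obj X Y).ε m) ((N.obj Y Z).d n) :=
  (DGMod.d_inc _ Y _).trans ((congrArg _ (DGMod.d_tmul _ _ m n)).trans (map_add _ _ _))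

theorem ε_tenMk {X : A.Obj} {Z : C.Obj} (Y : B.Obj) (m : M.obj X Y) (n : N.obj Y Z) :
    (ten M N X Z).ε (tenMk M N Y m n) =
      tenMk M N Y ((M.obj X Y).ε m) ((N.obj Y Z).ε n) :=
  (DGMod.ε_inc _ Y _).trans (congrArg _ (DGMod.ε_tmul _ _ m n))

/-- The difference `m f ⊗ n - m ⊗ f n`. -/
def tenRel {X : A.Obj} {Z : C.Obj} {Y Y' : B.Obj} (m : M.obj X Y) (f : B.hom Y Y')
    (n : N.obj Y' Z) : ten M N X Z :=
  tenMk M N Y' (M.ract m f) n - tenMk M N Y m (N.lact f n)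

/-- The submodule spanned by the differences `m f ⊗ n - m ⊗ f n`. -/
def tenSub (X : A.Obj) (Z : C.Obj) : Submodule k (ten M N X Z) :=
  Submodule.span k {x | ∃ (Y Y' : B.Obj) (m : M.obj X Y) (f : B.hom Y Y') (n : N.obj Y' Z),
    x = tenRel M N m f n}

theorem tenRel_mem {X : A.Obj} {Z : C.Obj} {Y Y' : B.Obj} (m : M.obj X Y) (f : B.hom Y Y')
    (n : N.obj Y' Z) : tenRel M N m f n ∈ tenSub M N X Z :=
  Submodule.subset_span ⟨Y, Y', m, f, n, rfl⟩

theorem tenRel_gr {X : A.Obj} {Z : C.Obj} {Y Y' : B.Obj} {i j l : Γ} {m : M.obj X Y}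
    (hm : m ∈ (M.obj X Y).gr i) {f : B.hom Y Y'} (hf : f ∈ (B.hom Y Y').gr j)
    {n : N.obj Y' Z} (hn : n ∈ (N.obj Y' Z).gr l) :
    tenRel M N m f n ∈ (ten M N X Z).gr (i + j + l) := by
  refine Submodule.sub_mem _ (tenMk_mem M N (M.ract_mem _ _ _ hm _ hf) hn) ?_
  rw [add_assoc]
  exact tenMk_mem M N hm (N.lact_mem _ _ _ hf _ hn)

theorem tenSub_proj (X : A.Obj) (Z : C.Obj) (i : Γ) (x : ten M N X Z) (hx : x ∈ tenSub M N X Z) :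
    (ten M N X Z).proj i x ∈ tenSub M N X Z := by
  revert x
  change tenSub M N X Z ≤ (tenSub M N X Z).comap ((ten M N X Z).proj i)
  refine Submodule.span_le.2 ?_
  rintro _ ⟨Y, Y', m, f, n, rfl⟩
  change (ten M N X Z).proj i (tenRel M N m f n) ∈ tenSub M N X Z
  induction m using DGMod.hom_ind with
  | zero => simp [tenRel]
  | add m m' h h' =>
    have : tenRel M N (m + m') f n = tenRel M N m f n + tenRel M N m' f n := by
      simp only [tenRel, map_add, LinearMap.add_apply]; abel
    rw [this, map_add]; exact Submodule.add_mem _ h h'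
  | mem a m hm =>
    induction f using DGMod.hom_ind with
    | zero => simp [tenRel]
    | add f f' h h' =>
      have : tenRel M N m (f + f') n = tenRel M N m f n + tenRel M N m f' n := by
        simp only [tenRel, map_add, LinearMap.add_apply]; abel
      rw [this, map_add]; exact Submodule.add_mem _ h h'
    | mem b f hf =>
      induction n using DGMod.hom_ind with
      | zero => simp [tenRel]
      | add n n' h h' =>
        have : tenRel M N m f (n + n') = tenRel M N m f n + tenRel M N m f n' := by
          simp only [tenRel, map_add]; abel
        rw [this, map_add]; exact Submodule.add_mem _ h h'
      | mem c n hn =>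
        have hr := tenRel_gr M N hm hf hn
        by_cases hi : a + b + c = i
        · rw [hi] at hr
          rw [DGMod.proj_same _ hr]; exact tenRel_mem M N m f n
        · rw [DGMod.proj_ne _ hi hr]; exact Submodule.zero_mem _

theorem tenSub_d (X : A.Obj) (Z : C.Obj) (x : ten M N X Z) (hx : x ∈ tenSub M N X Z) :
    (ten M N X Z).d x ∈ tenSub M N X Z := by
  revert x
  change tenSub M N X Z ≤ (tenSub M N X Z).comap (ten M N X Z).d
  refine Submodule.span_le.2 ?_
  rintro _ ⟨Y, Y', m, f, n, rfl⟩
  have : (ten M N X Z).d (tenRel M N m f n) = tenRel M N ((M.obj X Y).d m) f n +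
      tenRel M N ((M.obj X Y).ε m) ((B.hom Y Y').d f) n +
      tenRel M N ((M.obj X Y).ε m) ((B.hom Y Y').ε f) ((N.obj Y' Z).d n) := by
    simp only [tenRel, map_sub, d_tenMk, M.d_ract, N.d_lact, DGMod.ε, M.tw_ract, map_add,
      LinearMap.add_apply]
    abel
  change (ten M N X Z).d (tenRel M N m f n) ∈ tenSub M N X Z
  rw [this]
  exact Submodule.add_mem _ (Submodule.add_mem _ (tenRel_mem M N _ _ _) (tenRel_mem M N _ _ _))
    (tenRel_mem M N _ _ _)

/-- The left action on `⨁_Y ⟨X|M|Y⟩ ⊗ ⟨Y|N|Z⟩`. -/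
def tenLact {X' X : A.Obj} {Z : C.Obj} (g : A.hom X' X) : ten M N X Z →ₗ[k] ten M N X' Z :=
  tenLift fun Y => (tenMk M N Y) ∘ₗ M.lact g

theorem tenLact_mk {X' X : A.Obj} {Z : C.Obj} (g : A.hom X' X) (Y : B.Obj) (m : M.obj X Y)
    (n : N.obj Y Z) : tenLact M N g (tenMk M N Y m n) = tenMk M N Y (M.lact g m) n :=
  tenLift_mk M N _ Y m n

/-- The right action on `⨁_Y ⟨X|M|Y⟩ ⊗ ⟨Y|N|Z⟩`. -/
def tenRact {X : A.Obj} {Z Z' : C.Obj} (g : C.hom Z Z') : ten M N X Z →ₗ[k] ten M N X Z' :=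
  tenLift fun Y => (tenMk M N Y).compl₂ (N.ract.flip g)

theorem tenRact_mk {X : A.Obj} {Z Z' : C.Obj} (g : C.hom Z Z') (Y : B.Obj) (m : M.obj X Y)
    (n : N.obj Y Z) : tenRact M N g (tenMk M N Y m n) = tenMk M N Y m (N.ract n g) :=
  tenLift_mk M N _ Y m n

theorem tenLact_sub {X' X : A.Obj} {Z : C.Obj} (g : A.hom X' X) :
    ∀ x ∈ tenSub M N X Z, tenLact M N g x ∈ tenSub M N X' Z := by
  change tenSub M N X Z ≤ (tenSub M N X' Z).comap (tenLact M N g)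
  refine Submodule.span_le.2 ?_
  rintro _ ⟨Y, Y', m, f, n, rfl⟩
  change tenLact M N g (tenRel M N m f n) ∈ tenSub M N X' Z
  have : tenLact M N g (tenRel M N m f n) = tenRel M N (M.lact g m) f n := by
    simp only [tenRel, map_sub, tenLact_mk, M.lact_ract]
  rw [this]; exact tenRel_mem M N _ _ _

theorem tenRact_sub {X : A.Obj} {Z Z' : C.Obj} (g : C.hom Z Z') :
    ∀ x ∈ tenSub M N X Z, tenRact M N g x ∈ tenSub M N X Z' := by
  change tenSub M N X Z ≤ (tenSub M N X Z').comap (tenRact M N g)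
  refine Submodule.span_le.2 ?_
  rintro _ ⟨Y, Y', m, f, n, rfl⟩
  change tenRact M N g (tenRel M N m f n) ∈ tenSub M N X Z'
  have : tenRact M N g (tenRel M N m f n) = tenRel M N m f (N.ract n g) := by
    simp only [tenRel, map_sub, tenRact_mk, N.lact_ract]
  rw [this]; exact tenRel_mem M N _ _ _

/-- The dg module `⟨X|M ⊗_B N|Z⟩`. -/
def tenQ (X : A.Obj) (Z : C.Obj) : DGMod.{max u' w w'} k Γ :=
  (ten M N X Z).quot (tenSub M N X Z) (tenSub_proj M N X Z) (tenSub_d M N X Z)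

/-- The quotient map. -/
def tenq (X : A.Obj) (Z : C.Obj) : ten M N X Z →ₗ[k] tenQ M N X Z := DGMod.qmk

/-- The class of the simple tensor `m ⊗ n`. -/
def tq {X : A.Obj} {Z : C.Obj} (Y : B.Obj) : M.obj X Y →ₗ[k] N.obj Y Z →ₗ[k] tenQ M N X Z :=
  (tenMk M N Y).compr₂ (tenq M N X Z)

variable {M N} in
theorem tq_ind {X : A.Obj} {Z : C.Obj} {p : tenQ M N X Z → Prop} (x : tenQ M N X Z) (zero : p 0)
    (add : ∀ x y, p x → p y → p (x + y)) (mk : ∀ Y m n, p (tq M N Y m n)) : p x := by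
  induction x using DGMod.q_ind with
  | mk x =>
    change p (tenq M N X Z x)
    induction x using ten_ind with
    | zero => rw [map_zero]; exact zero
    | add x y hx hy => rw [map_add]; exact add _ _ hx hy
    | mk Y m n => exact mk Y m n

theorem tq_gr_mem {X : A.Obj} {Z : C.Obj} {P : Type w''} [AddCommGroup P] [Module k P]
    {S : Submodule k P} {F : tenQ M N X Z →ₗ[k] P} {l : Γ}
    (h : ∀ Y i j, i + j = l → ∀ m ∈ (M.obj X Y).gr i, ∀ n ∈ (N.obj Y Z).gr j,
      F (tq M N Y m n) ∈ S) {x : tenQ M N X Z} (hx : x ∈ (tenQ M N X Z).gr l) : F x ∈ S := by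
  obtain ⟨y, hy, rfl⟩ := DGMod.exists_qmk hx
  exact ten_gr_mem M N (F := F ∘ₗ tenq M N X Z) h hy

theorem tq_mem {X : A.Obj} {Y : B.Obj} {Z : C.Obj} {i j : Γ} {m : M.obj X Y}
    (hm : m ∈ (M.obj X Y).gr i) {n : N.obj Y Z} (hn : n ∈ (N.obj Y Z).gr j) :
    tq M N Y m n ∈ (tenQ M N X Z).gr (i + j) :=
  DGMod.qmk_mem (tenMk_mem M N hm hn)

theorem d_tq {X : A.Obj} {Z : C.Obj} (Y : B.Obj) (m : M.obj X Y) (n : N.obj Y Z) :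
    (tenQ M N X Z).d (tq M N Y m n) =
      tq M N Y ((M.obj X Y).d m) n + tq M N Y ((M.obj X Y).ε m) ((N.obj Y Z).d n) :=
  congrArg (tenq M N X Z) (d_tenMk M N Y m n)

theorem ε_tq {X : A.Obj} {Z : C.Obj} (Y : B.Obj) (m : M.obj X Y) (n : N.obj Y Z) :
    (tenQ M N X Z).ε (tq M N Y m n) = tq M N Y ((M.obj X Y).ε m) ((N.obj Y Z).ε n) :=
  (DGMod.ε_qmk _).trans (congrArg (tenq M N X Z) (ε_tenMk M N Y m n))

/-- The left action of a fixed morphism on `M ⊗_B N`. -/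
def tqL {X' X : A.Obj} {Z : C.Obj} (g : A.hom X' X) : tenQ M N X Z →ₗ[k] tenQ M N X' Z :=
  DGMod.qlift (tenq M N X' Z ∘ₗ tenLact M N g)
    (fun x hx => DGMod.qmk_eq_zero (tenLact_sub M N g x hx))

/-- The right action of a fixed morphism on `M ⊗_B N`. -/
def tqR {X : A.Obj} {Z Z' : C.Obj} (g : C.hom Z Z') : tenQ M N X Z →ₗ[k] tenQ M N X Z' :=
  DGMod.qlift (tenq M N X Z' ∘ₗ tenRact M N g)
    (fun x hx => DGMod.qmk_eq_zero (tenRact_sub M N g x hx))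

theorem tqL_tq {X' X : A.Obj} {Z : C.Obj} (g : A.hom X' X) (Y : B.Obj) (m : M.obj X Y)
    (n : N.obj Y Z) : tqL M N g (tq M N Y m n) = tq M N Y (M.lact g m) n :=
  congrArg (tenq M N X' Z) (tenLact_mk M N g Y m n)

theorem tqR_tq {X : A.Obj} {Z Z' : C.Obj} (Y : B.Obj) (m : M.obj X Y)
    (n : N.obj Y Z) (g : C.hom Z Z') : tqR M N g (tq M N Y m n) = tq M N Y m (N.ract n g) :=
  congrArg (tenq M N X Z') (tenRact_mk M N g Y m n)

/-- The left action on `M ⊗_B N`. -/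
def tqLact {X' X : A.Obj} {Z : C.Obj} :
    A.hom X' X →ₗ[k] tenQ M N X Z →ₗ[k] tenQ M N X' Z :=
  LinearMap.mk₂ k (fun g x => tqL M N g x)
    (fun g g' x => by
      induction x using tq_ind with
      | zero => simp only [map_zero, add_zero]
      | add x y hx hy => simp only [map_add, hx, hy]; abel
      | mk Y m n => simp only [tqL_tq, map_add, LinearMap.add_apply])
    (fun c g x => by
      induction x using tq_ind with
      | zero => simp only [map_zero, smul_zero]
      | add x y hx hy => simp only [map_add, hx, hy, smul_add]
      | mk Y m n => simp only [tqL_tq, map_smul, LinearMap.smul_apply])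
    (fun g x y => map_add _ x y)
    (fun c g x => map_smul _ c x)

theorem tqLact_tq {X' X : A.Obj} {Z : C.Obj} (g : A.hom X' X) (Y : B.Obj) (m : M.obj X Y)
    (n : N.obj Y Z) : tqLact M N g (tq M N Y m n) = tq M N Y (M.lact g m) n :=
  tqL_tq M N g Y m n

/-- The right action on `M ⊗_B N`. -/
def tqRact {X : A.Obj} {Z Z' : C.Obj} :
    tenQ M N X Z →ₗ[k] C.hom Z Z' →ₗ[k] tenQ M N X Z' :=
  LinearMap.mk₂ k (fun x g => tqR M N g x)
    (fun x y g => map_add _ x y)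
    (fun c x g => map_smul _ c x)
    (fun x g g' => by
      induction x using tq_ind with
      | zero => simp only [map_zero, add_zero]
      | add x y hx hy => simp only [map_add, hx, hy]; abel
      | mk Y m n => simp only [tqR_tq, map_add])
    (fun c x g => by
      induction x using tq_ind with
      | zero => simp only [map_zero, smul_zero]
      | add x y hx hy => simp only [map_add, hx, hy, smul_add]
      | mk Y m n => simp only [tqR_tq, map_smul])

theorem tqRact_tq {X : A.Obj} {Z Z' : C.Obj} (Y : B.Obj) (m : M.obj X Y)
    (n : N.obj Y Z) (g : C.hom Z Z') : tqRact M N (tq M N Y m n) g = tq M N Y m (N.ract n g) :=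
  tqR_tq M N Y m n g

/-- The tensor product of bimodules `M ⊗_B N`, that is
`⟨X|M ⊗_B N|Z⟩ = ⨁_Y ⟨X|M|Y⟩ ⊗ ⟨Y|N|Z⟩ / (m f ⊗ n - m ⊗ f n)`. -/
def tensor : Bimod.{max u' w w'} A C where
  obj := tenQ M N
  lact := tqLact M N
  ract := tqRact M N
  lact_mem i j g hg x hx := by
    refine tq_gr_mem M N (F := tqLact M N g) (fun Y i' j' hij m hm n hn => ?_) hx
    rw [tqLact_tq, ← hij, ← add_assoc]
    exact tq_mem M N (M.lact_mem _ _ _ hg _ hm) hn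
  ract_mem i j x hx g hg := by
    refine tq_gr_mem M N (F := (tqRact M N).flip g) (fun Y i' j' hij m hm n hn => ?_) hx
    rw [LinearMap.flip_apply, tqRact_tq, ← hij, add_assoc]
    exact tq_mem M N hm (N.ract_mem _ _ _ hn _ hg)
  one_lact x := by
    induction x using tq_ind with
    | zero => simp only [map_zero]
    | add x y hx hy => simp only [map_add, hx, hy]
    | mk Y m n => rw [tqLact_tq, M.one_lact]
  ract_one x := by
    induction x using tq_ind with
    | zero => simp only [map_zero, LinearMap.zero_apply]
    | add x y hx hy => simp only [map_add, LinearMap.add_apply, hx, hy]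
    | mk Y m n => rw [tqRact_tq, N.ract_one]
  comp_lact g g' x := by
    induction x using tq_ind with
    | zero => simp only [map_zero]
    | add x y hx hy => simp only [map_add, hx, hy]
    | mk Y m n => simp only [tqLact_tq, M.comp_lact]
  ract_comp x g g' := by
    induction x using tq_ind with
    | zero => simp only [map_zero, LinearMap.zero_apply]
    | add x y hx hy => simp only [map_add, LinearMap.add_apply, hx, hy]
    | mk Y m n => simp only [tqRact_tq, N.ract_comp]
  lact_ract g x g' := by
    induction x using tq_ind with
    | zero => simp only [map_zero, LinearMap.zero_apply]
    | add x y hx hy => simp only [map_add, LinearMap.add_apply, hx, hy]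
    | mk Y m n => simp only [tqRact_tq, tqLact_tq]
  d_lact g x := by
    induction x using tq_ind with
    | zero => simp only [map_zero, add_zero]
    | add x y hx hy => simp only [map_add, hx, hy]; abel
    | mk Y m n =>
      simp only [tqLact_tq, d_tq, M.d_lact, DGMod.ε, M.tw_lact, map_add, LinearMap.add_apply]
      abel
  d_ract x g := by
    induction x using tq_ind with
    | zero => simp only [map_zero, LinearMap.zero_apply, add_zero]
    | add x y hx hy => simp only [map_add, LinearMap.add_apply, hx, hy]; abel
    | mk Y m n =>
      simp only [tqRact_tq, d_tq, N.d_ract, ε_tq, map_add, LinearMap.add_apply]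
      abel

/-- The simple tensor `m ⊗ n` in `M ⊗_B N`. -/
def tmul {X : A.Obj} {Z : C.Obj} (Y : B.Obj) :
    M.obj X Y →ₗ[k] N.obj Y Z →ₗ[k] (M.tensor N).obj X Z := tq M N Y

end tensor
end Bimod

section path

/-- Composable sequences `(f_0, …, f_{r+1})` of homogeneous morphisms
`f_0 ∈ ⟨Y|X_0⟩`, `f_1 ∈ ⟨X_0|X_1⟩`, …, `f_{r+1} ∈ ⟨X_r|Y'⟩`, together with their degrees. -/
inductive Path (C : DGCat.{u, v} k Γ) : C.Obj → C.Obj → Type (max u v uΓ)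
  | last {Y Y' : C.Obj} (X : C.Obj) (i : Γ) (f : C.hom Y X) (hf : f ∈ (C.hom Y X).gr i)
      (j : Γ) (g : C.hom X Y') (hg : g ∈ (C.hom X Y').gr j) : Path C Y Y'
  | cons {Y Y' : C.Obj} (X : C.Obj) (i : Γ) (f : C.hom Y X) (hf : f ∈ (C.hom Y X).gr i)
      (p : Path C X Y') : Path C Y Y'

namespace Path
variable {C : DGCat.{u, v} k Γ}

/-- The number `r` for a sequence `(f_0, …, f_{r+1})`. -/
def len : ∀ {Y Y' : C.Obj}, Path C Y Y' → ℕ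
  | _, _, last .. => 0
  | _, _, cons _ _ _ _ p => p.len + 1

/-- The degrees `(|f_0|, …, |f_{r+1}|)`. -/
def deg : ∀ {Y Y' : C.Obj} (p : Path C Y Y'), Fin (p.len + 2) → Γ
  | _, _, last _ i _ _ j _ _ => ![i, j]
  | _, _, cons _ i _ _ p => Fin.cons i p.deg

/-- The tensor `f_0 ⊗ ⋯ ⊗ f_{r+1}`. -/
def tens : ∀ {Y Y' : C.Obj} (p : Path C Y Y'), (Bimod.barT C p.len).obj Y Y'
  | _, _, last X _ f _ _ g _ => Bimod.preMk (M := Bimod.unit C) X f g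
  | _, _, cons X _ f _ p => Bimod.preMk (M := Bimod.barT C p.len) X f p.tens

/-- The element `[f_0, …, f_{r+1}]` of the bar complex. -/
def bracket {Y Y' : C.Obj} (p : Path C Y Y') : (Bimod.bar C).obj Y Y' :=
  (Bimod.barCplx C).inc p.len Y Y' p.tens

/-- The parities `k_u = ⟨ι, |f_u|⟩`. -/
def par {Y Y' : C.Obj} (p : Path C Y Y') (u : Fin (p.len + 2)) : ZMod 2 := form ι (p.deg u)

/-- The sign exponent `σ(k_0, …, k_{r+1}) = ∑_{u=0}^{r} (r + 1 - u) k_u`. -/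
def σ {Y Y' : C.Obj} (p : Path C Y Y') : ZMod 2 :=
  ∑ u : Fin (p.len + 1), ((p.len + 1 - (u : ℕ) : ℕ) : ZMod 2) * p.par u.castSucc

/-- The element `[f_0, …, f_{r+1}]' = (-1)^σ [f_0, …, f_{r+1}]` of the bar complex. -/
def bracket' {Y Y' : C.Obj} (p : Path C Y Y') : (Bimod.bar C).obj Y Y' := sgn k p.σ • p.bracket

/-- `(f, a, …, a, g)` with `n` copies of `a`. -/
def between {X Y' : C.Obj} (j : Γ) (a : C.hom X X) (ha : a ∈ (C.hom X X).gr j) (l : Γ)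
    (g : C.hom X Y') (hg : g ∈ (C.hom X Y').gr l) :
    ∀ (_ : ℕ) {Y : C.Obj} (i : Γ) (f : C.hom Y X) (_ : f ∈ (C.hom Y X).gr i), Path C Y Y'
  | 0, _, i, f, hf => last X i f hf l g hg
  | n + 1, _, i, f, hf => cons X i f hf (between j a ha l g hg n j a ha)

/-- The sequence `p` preceded by `n` copies of `a`. -/
def reps {X Y' : C.Obj} (j : Γ) (a : C.hom X X) (ha : a ∈ (C.hom X X).gr j) (p : Path C X Y') :
    ℕ → Path C X Y'
  | 0 => p
  | n + 1 => cons X j a ha (reps j a ha p n)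

/-- For a sequence `(f_0, …, f_{r+1})` in `Tw(C)` passing through the objects
`tw_{α_0}(X_0), …, tw_{α_r}(X_r)`, the sequence
`(f_0, α_0, …, α_0, f_1, α_1, …, α_1, …, f_r, α_r, …, α_r, f_{r+1})` in `C`,
with `n_u` copies of `α_u`. -/
def insert : ∀ {Y Y' : MCObj C} (p : Path (Tw C) Y Y') (_ : Fin (p.len + 1) → ℕ),
    Path C Y.obj Y'.obj
  | _, _, last X i f hf j g hg, n => between ι X.α X.α_mem j g hg (n 0) i f hf
  | _, _, cons X i f hf p, n => cons X.obj i f hf (reps ι X.α X.α_mem (insert p (Fin.tail n)) (n 0))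

/-- The exponent `binom(N + 1, 2) + ∑_u (r - u) n_u + ∑_{u ≤ u'} k_u n_{u'}`, `N = ∑_u n_u`. -/
def insertSign {Y Y' : C.Obj} (p : Path C Y Y') (n : Fin (p.len + 1) → ℕ) : ZMod 2 :=
  ((((∑ u, n u) + 1).choose 2 : ℕ) : ZMod 2)
    + (∑ u : Fin (p.len + 1), ((p.len - (u : ℕ) : ℕ) : ZMod 2) * (n u : ZMod 2))
    + ∑ u : Fin (p.len + 1), ∑ u' : Fin (p.len + 1),
        if u ≤ u' then p.par u.castSucc * (n u' : ZMod 2) else 0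

end Path
end path

section target
variable (C : DGCat.{u, v} k Γ)

/-- `Tw(C)` as a `(Tw(C), C)`-bimodule, restricted along `η : C → Tw(C)`. -/
def twR : Bimod.{v} (Tw C) C := (Bimod.unit (Tw C)).restr (DGFunctor.id (Tw C)) (η C)

/-- `Tw(C)` as a `(C, Tw(C))`-bimodule, restricted along `η : C → Tw(C)`. -/
def twL : Bimod.{v} C (Tw C) := (Bimod.unit (Tw C)).restr (η C) (DGFunctor.id (Tw C))

/-- The bimodule `Tw(C) ⊗_C B ⊗_C Tw(C)` for the completed bar complex `B` of `C`. -/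
def twBarTw : Bimod.{max u v} (Tw C) (Tw C) := ((twR C).tensor (Bimod.barHat C)).tensor (twL C)

variable {C}

/-- The canonical map `ψ : X → tw_α(X)` in `Tw(C)`, given by the identity of `X`. -/
def ψ (Y : MCObj C) : (twR C).obj Y Y.obj := C.one Y.obj

/-- The inverse `ψ⁻¹ : tw_α(X) → X`, given by the identity of `X`. -/
def ψinv (Y : MCObj C) : (twL C).obj Y.obj Y := C.one Y.obj

/-- The element `ψ_Y · x · ψ_{Y'}⁻¹` of `Tw(C) ⊗_C B ⊗_C Tw(C)`. -/
def sandwich (Y Y' : MCObj C) (x : (Bimod.barHat C).obj Y.obj Y'.obj) : (twBarTw C).obj Y Y' :=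
  Bimod.tmul ((twR C).tensor (Bimod.barHat C)) (twL C) Y'.obj
    (Bimod.tmul (twR C) (Bimod.barHat C) Y.obj (ψ Y) x) (ψinv Y')

/-- The element `x` of the completed bar complex is the sum of the family `T` of elements of the
bar complex: in each length only finitely many `T i` have a nonzero component, and these
components add up to the component of `x`. -/
def IsSum {I : Type*} {Y Y' : C.Obj} (T : I → (Bimod.bar C).obj Y Y')
    (x : (Bimod.barHat C).obj Y Y') : Prop :=
  ∀ s : ℕ, (Function.support fun i => (Bimod.barCplx C).coord s Y Y' (T i)).Finite ∧
    (Bimod.barCplx C).component s Y Y' x = ∑ᶠ i, (Bimod.barCplx C).coord s Y Y' (T i)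

/-- The defining formula
`Ξ([f_0, …, f_{r+1}]') = ψ_Y · (∑_{n_0, …, n_r} [f_0, α_0, …, α_0, f_1, …, f_{r+1}]') · ψ_{Y'}⁻¹`
for all sequences of homogeneous morphisms (including the convergence of the sum). -/
def XiFormula (Ξ : ∀ Y Y' : MCObj C, (Bimod.bar (Tw C)).obj Y Y' →ₗ[k] (twBarTw C).obj Y Y') :
    Prop :=
  ∀ (Y Y' : MCObj C) (p : Path (Tw C) Y Y'), ∃ x : (Bimod.barHat C).obj Y.obj Y'.obj,
    IsSum (fun n => (p.insert n).bracket') x ∧ Ξ Y Y' p.bracket' = sandwich Y Y' x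

/-- The formula for `Ξ` in terms of the elements `[f_0, …, f_{r+1}]`, with explicit signs. -/
def XiSignFormula (Ξ : ∀ Y Y' : MCObj C, (Bimod.bar (Tw C)).obj Y Y' →ₗ[k] (twBarTw C).obj Y Y') :
    Prop :=
  ∀ (Y Y' : MCObj C) (p : Path (Tw C) Y Y'), ∃ x : (Bimod.barHat C).obj Y.obj Y'.obj,
    IsSum (fun n => sgn k (p.insertSign n) • (p.insert n).bracket) x ∧
      Ξ Y Y' p.bracket = sandwich Y Y' x

end target

end
end DG

/-! Every sign becomes uniform once the bar complex is built by prepending morphisms to primed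
tensors. Write `mk f` for $[f_0,\dots]'\mapsto[f,f_0,\dots]'$. It behaves like an operator of degree
$-\iota$: the total differential $D$ satisfies
$D(\mathrm{mk}\,f\,y)=-\mathrm{mk}(df)\,y-\mathrm{mk}(\varepsilon f)(Dy)+f\cdot y$, where
$\varepsilon f=(-1)^{\langle\iota,|f|\rangle}f$, with no sign depending on the length
(`AugBar.D_mk`). To make this hold in all lengths, the completed bar complex is augmented by
$q^\iota C$ in length $-1$, so that every tensor is obtained by prepending to some $[g]'$.

Inserting arbitrarily many copies of $\alpha$ is the geometric series
$\mathrm{geom}\,\alpha=\sum_n(\mathrm{mk}\,\alpha)^n$. Since `mk` raises the length,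
$z=y+\mathrm{mk}\,\alpha\,z$ has exactly one solution, $z=\mathrm{geom}\,\alpha\,y$
(`AugBar.eq_geom`). Identities for the series thus reduce to checking this equation. In this way the
Maurer–Cartan equation gives $D\circ\mathrm{geom}\,\alpha-(\text{right
twist})\circ\mathrm{geom}\,\alpha=\mathrm{geom}\,\alpha\circ D^{tw}$, where $D^{tw}y=Dy+\alpha
y-(\varepsilon y)\alpha'$ (`AugBar.geom_twD`).

The map is defined by the recursion
$\Phi(\mathrm{mk}\,f\,b)=\mathrm{mk}\,f\,(\mathrm{geom}\,\alpha\,\Phi(b))$. By `AugBar.twD_mk_geom`,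
$D^{tw}(\mathrm{mk}\,f\,\mathrm{geom}\,\alpha\,y)$ obeys the rule for $D(\mathrm{mk}\,f\,b)$ in the
bar complex of $\operatorname{Tw}(C)$: the cross term $f\circ\alpha$ and the outer $\alpha$ acting
on $f$ are the terms that turn $df$ into the twisted differential of $f$. Induction on the length
shows that $\Phi$ intertwines the differential of the source with $D^{tw}$ (`twD_Φ_zero`,
`twD_Φ_succ`).

Since $d\psi=\psi\alpha$ and $d\psi^{-1}=-\alpha\psi^{-1}$, the assignment $x\mapsto\psi\otimes
x\otimes\psi^{-1}$ turns $D^{tw}$ into the differential of the target (`d_sandwichL`). Hence the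
composite is closed.

The series expands into the required sum (`Path.isAugSum_insert`). Uniqueness holds because primed
tensors span the bar complex (`Path.span_bracket'`). The unprimed formula is the parity computation
`Path.σ_insert`. -/

namespace DG

noncomputable section
open scoped Classical
open SignedGrading
set_option linter.unusedSectionVars false

universe u v u' v' u'' v'' w w' w'' uk uΓ

variable {k : Type uk} [CommRing k] {Γ : Type uΓ} [AddCommGroup Γ] [SignedGrading Γ]

namespace Bimod

/-! ### Prepending a morphism, as an operation between shifted bimodules. -/

section shiftedPre
variable {C : DGCat.{u, v} k Γ} {D : DGCat.{u', v'} k Γ} {M N : Bimod.{w} C D}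
  {Y' Y X : C.Obj} {Z Z' : D.Obj}

/-- The identity, as a map `M → q^j M`. -/
def sh (j : Γ) : M.obj Y Z →ₗ[k] (M.shift j).obj Y Z := (LinearMap.id : M.obj Y Z →ₗ[k] M.obj Y Z)

/-- The identity, as a map `q^j M → M`. -/
def unsh (j : Γ) : (M.shift j).obj Y Z →ₗ[k] M.obj Y Z := (LinearMap.id : M.obj Y Z →ₗ[k] M.obj Y Z)

theorem sh_unsh (j : Γ) (x : (M.shift j).obj Y Z) : sh j (unsh j x) = x := rfl

theorem unsh_sh (j : Γ) (x : M.obj Y Z) : unsh j (sh j x) = x := rfl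

theorem d_sh (j : Γ) (x : M.obj Y Z) :
    ((M.shift j).obj Y Z).d (sh j x) = sgn k (form j ι) • sh j ((M.obj Y Z).d x) := rfl

theorem ε_sh (j : Γ) (x : M.obj Y Z) :
    ((M.shift j).obj Y Z).ε (sh j x) = sgn k (form j ι) • sh j ((M.obj Y Z).ε x) := by
  rw [form_comm]
  exact DGMod.shift_tw j ι (M.obj Y Z) x

theorem lact_sh (j : Γ) (g : C.hom Y' Y) (x : M.obj Y Z) :
    (M.shift j).lact g (sh j x) = sh j (M.lact ((C.hom Y' Y).tw j g) x) := rfl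

theorem ract_sh (j : Γ) (x : M.obj Y Z) (g : D.hom Z Z') :
    (M.shift j).ract (sh j x) g = sh j (M.ract x g) := rfl

theorem sh_mem (j : Γ) {i : Γ} {x : M.obj Y Z} (hx : x ∈ (M.obj Y Z).gr i) :
    sh j x ∈ ((M.shift j).obj Y Z).gr (i + j) := by
  change x ∈ (M.obj Y Z).gr (i + j - j)
  rwa [add_sub_cancel_right]

theorem unsh_mem (j : Γ) {i : Γ} {x : (M.shift j).obj Y Z} (hx : x ∈ ((M.shift j).obj Y Z).gr i) :
    unsh j x ∈ (M.obj Y Z).gr (i - j) := hx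

theorem ε_preMk (f : C.hom Y X) (m : M.obj X Z) :
    (M.pre.obj Y Z).ε (preMk X f m) = preMk X ((C.hom Y X).ε f) ((M.obj X Z).ε m) :=
  DGMod.bilin_tw (preMk X) (fun _ _ _ hf _ hm => preMk_mem hf hm) ι f m

section
variable {N : Bimod.{w''} C D} {A : Type u''} [AddCommGroup A] [Module k A]

/-- A bilinear map regarded as a bilinear map between shifts. -/
def shBilin (F : A →ₗ[k] M.obj X Z →ₗ[k] N.obj Y Z') (j l : Γ) :
    A →ₗ[k] (M.shift j).obj X Z →ₗ[k] (N.shift l).obj Y Z' := F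

/-- A linear map regarded as a linear map between shifts. -/
def shMap (F : M.obj X Z →ₗ[k] N.obj Y Z') (j l : Γ) :
    (M.shift j).obj X Z →ₗ[k] (N.shift l).obj Y Z' := F

theorem shMap_sh (F : M.obj X Z →ₗ[k] N.obj Y Z') (j l : Γ) (x : M.obj X Z) :
    shMap F j l (sh j x) = sh l (F x) := rfl

end

/-- The map `f, b ↦ (-1)^⟨j, |f|⟩ f ⊗ b` from `q^j M` to `q^l (pre M)`. -/
def mkSh (j l : Γ) : C.hom Y X →ₗ[k] (M.shift j).obj X Z →ₗ[k] (M.pre.shift l).obj Y Z :=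
  shBilin (M := M) (N := M.pre) (preMk X ∘ₗ (C.hom Y X).tw j) j l

variable {j l : Γ}

theorem mkSh_sh (f : C.hom Y X) (b : M.obj X Z) :
    mkSh j l f (sh j b) = sh l (preMk X ((C.hom Y X).tw j f) b) := rfl

theorem sgn_form_step (h : l + ι = j) : sgn k (form j ι) = - sgn k (form l ι) := by
  rw [← h, map_add, AddMonoidHom.add_apply, sgn_add, form_ι_ι, sgn_one, mul_neg_one]

/-- The shifts differ by $\iota$, so `mkSh j l` is an operator of degree $-\iota$ and both terms of
the Leibniz rule acquire a minus sign. The sign $(-1)^{\langle j,|f|\rangle}$ in its definition is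
what removes any further dependence on $j$. -/
theorem d_mkSh (h : l + ι = j) (f : C.hom Y X) (b : (M.shift j).obj X Z) :
    ((M.pre.shift l).obj Y Z).d (mkSh j l f b) =
      -mkSh j l ((C.hom Y X).d f) b - mkSh j l ((C.hom Y X).ε f) (((M.shift j).obj X Z).d b) := by
  -- Writing the element of the shift as `sh` of an unshifted one makes all signs of the shift
  -- explicit; the proofs below start in the same way.
  rw [← sh_unsh j b]; generalize unsh j b = b
  have hs : sgn k (form l ι) = - sgn k (form j ι) := by rw [sgn_form_step h, neg_neg]
  rw [d_sh, map_smul, mkSh_sh, mkSh_sh, mkSh_sh, d_sh, d_preMk, DGMod.d_tw, map_smul, hs,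
    LinearMap.smul_apply, map_add, smul_add, map_smul, smul_smul, neg_mul, sgn_mul_self, neg_smul,
    one_smul, neg_smul, DGMod.ε, DGMod.tw_comm, ← sub_eq_add_neg]

/-- The sign of `ε` is the Koszul sign for moving $g$ past an operator of degree $-\iota$. -/
theorem lact_mkSh (h : l + ι = j) (g : C.hom Y' Y) (f : C.hom Y X) (b : (M.shift j).obj X Z) :
    (M.pre.shift l).lact g (mkSh j l f b) = mkSh j l (C.comp ((C.hom Y' Y).ε g) f) b := by
  rw [← sh_unsh j b]; generalize unsh j b = b
  rw [mkSh_sh, mkSh_sh, lact_sh, lact_preMk, C.tw_comp, ← h,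
    DGMod.tw_add _ l ι ((C.hom Y' Y).ε g), DGMod.ε,
    DGMod.tw_tw]

theorem ract_mkSh (f : C.hom Y X) (b : (M.shift j).obj X Z) (g : D.hom Z Z') :
    (M.pre.shift l).ract (mkSh j l f b) g = mkSh j l f ((M.shift j).ract b g) := by
  rw [← sh_unsh j b]; generalize unsh j b = b
  rw [mkSh_sh, ract_sh, ract_sh, mkSh_sh, ract_preMk]

theorem ε_mkSh (h : l + ι = j) (f : C.hom Y X) (b : (M.shift j).obj X Z) :
    ((M.pre.shift l).obj Y Z).ε (mkSh j l f b) =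
      -mkSh j l ((C.hom Y X).ε f) (((M.shift j).obj X Z).ε b) := by
  rw [← sh_unsh j b]; generalize unsh j b = b
  have hs : sgn k (form l ι) = - sgn k (form j ι) := by rw [sgn_form_step h, neg_neg]
  rw [ε_sh, map_smul, mkSh_sh, mkSh_sh, ε_sh, ε_preMk, hs, neg_smul, DGMod.ε, DGMod.tw_comm]

theorem mkSh_mem (h : l + ι = j) {i i' : Γ} {f : C.hom Y X} (hf : f ∈ (C.hom Y X).gr i)
    {b : (M.shift j).obj X Z} (hb : b ∈ ((M.shift j).obj X Z).gr i') :
    mkSh j l f b ∈ ((M.pre.shift l).obj Y Z).gr (i + i' - ι) := by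
  have := sh_mem l (preMk_mem (DGMod.tw_mem _ j hf) (unsh_mem j hb))
  have e : i + (i' - j) + l = i + i' - ι := by rw [← h]; abel
  rwa [e] at this

theorem shMap_act (f : C.hom Y X) (b : (M.shift j).obj X Z) :
    shMap (M.act Y Z) l j (mkSh j l f b) = (M.shift j).lact f b := by
  rw [← sh_unsh j b]; generalize unsh j b = b
  rw [mkSh_sh, shMap_sh, act_mk, lact_sh]

/-- The recursion $f\otimes b\mapsto fb-f\otimes\varphi(b)$ of the bar differential, after shifting.
The shifts before and after $\varphi$ differ by $\iota$, whence the `ε` on $f$. -/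
theorem shMap_preδ {j' : Γ} (h : j + ι = j') (φ : ∀ Y Z, M.pre.obj Y Z →ₗ[k] M.obj Y Z)
    (f : C.hom Y X) (b : (M.pre.shift j).obj X Z) :
    shMap (preδ φ Y Z) l j (mkSh j l f b) =
      (M.pre.shift j).lact f b -
        mkSh j' j ((C.hom Y X).ε f) (shMap (φ X Z) j j' b) := by
  rw [← sh_unsh j b]; generalize unsh j b = b
  rw [mkSh_sh, shMap_sh, shMap_sh, mkSh_sh, preδ_mk, lact_sh, map_sub, ← h, DGMod.tw_add,
    DGMod.ε, DGMod.tw_tw]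

/-- The sign operator `tw j` is an involution, so the values of `mkSh` are exactly the simple
tensors. -/
theorem mkSh_ind {p : (M.pre.shift l).obj Y Z → Prop} (x : (M.pre.shift l).obj Y Z) (zero : p 0)
    (add : ∀ x y, p x → p y → p (x + y))
    (mk : ∀ X (f : C.hom Y X) (b : (M.shift j).obj X Z), p (mkSh j l f b)) : p x :=
  preMk_ind (p := fun y => p (sh l y)) (unsh l x) zero (fun _ _ => add _ _) fun X f b => by
    have := mk X ((C.hom Y X).tw j f) (sh j b)
    rwa [mkSh_sh, DGMod.tw_tw] at this

variable {P : Type w'} [AddCommGroup P] [Module k P]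

/-- Linear maps out of `q^l (pre M)`. -/
def liftSh (F : ∀ X, C.hom Y X →ₗ[k] (M.shift j).obj X Z →ₗ[k] P) :
    (M.pre.shift l).obj Y Z →ₗ[k] P :=
  LinearMap.comp (preLift (M := M) fun X => (F X ∘ₗ (C.hom Y X).tw j).compl₂ (sh (M := M) j))
    (unsh (M := M.pre) l)

theorem liftSh_mkSh (F : ∀ X, C.hom Y X →ₗ[k] (M.shift j).obj X Z →ₗ[k] P) (f : C.hom Y X)
    (b : (M.shift j).obj X Z) : liftSh F (mkSh j l f b) = F X f b := by
  rw [← sh_unsh j b]; generalize unsh j b = b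
  rw [mkSh_sh, liftSh, LinearMap.comp_apply, unsh_sh, preLift_mk, LinearMap.compl₂_apply,
    LinearMap.comp_apply, DGMod.tw_tw]

/-- The total degree of the inputs is $n+\iota$ because `mkSh` lowers degrees by $\iota$. -/
theorem liftSh_mem (h : l + ι = j) {F : ∀ X, C.hom Y X →ₗ[k] (M.shift j).obj X Z →ₗ[k] P}
    {S : Submodule k P} {n : Γ}
    (hF : ∀ X i i', i + i' = n + ι → ∀ f ∈ (C.hom Y X).gr i, ∀ b ∈ ((M.shift j).obj X Z).gr i',
      F X f b ∈ S) {x : (M.pre.shift l).obj Y Z} (hx : x ∈ ((M.pre.shift l).obj Y Z).gr n) :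
    liftSh F x ∈ S := by
  rw [← sh_unsh l x]
  refine preMk_gr_mem (F := liftSh F ∘ₗ sh l) (fun X i i' hi f hf b hb => ?_) (unsh_mem l hx)
  -- Applying the involution `tw j` twice exhibits the simple tensor as a value of `mkSh`.
  have : preMk X f b = preMk X ((C.hom Y X).tw j ((C.hom Y X).tw j f)) b := by rw [DGMod.tw_tw]
  rw [this, LinearMap.comp_apply, ← mkSh_sh, liftSh_mkSh]
  refine hF X i (i' + j) ?_ _ (DGMod.tw_mem _ _ hf) _ (sh_mem j hb)
  rw [← add_assoc, hi, ← h]; abel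

end shiftedPre

/-! ### The bar complex in terms of prepending, with the identity bimodule as length $-1$ term. -/

section bar
variable {C : DGCat.{u, v} k Γ} {Y' Y X Z Z' : C.Obj}

variable (C) in
/-- The identity bimodule shifted by `ι`, i.e. the augmentation term of the bar complex. -/
def barU : Bimod.{v} C C := (unit C).shift ι

/-- The shifts $q^{-r\iota}$ continue to $r=-1$ as $q^{\iota}$. The augmentation term is therefore
related to length $0$ as length $s$ is to length $s+1$. -/
theorem shift_zero_step : -(0 • (ι : Γ)) + ι = ι := by rw [zero_nsmul, neg_zero, zero_add]

/-- The element `[f, g]'` of the bar complex. -/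
def mkU : C.hom Y X →ₗ[k] (barU C).obj X Z →ₗ[k] (barS C 0).obj Y Z :=
  mkSh (M := unit C) ι (-(0 • ι))

/-- The map `f, [f_0, …, f_{s+1}]' ↦ [f, f_0, …, f_{s+1}]'`. -/
def mkS (s : ℕ) : C.hom Y X →ₗ[k] (barS C s).obj X Z →ₗ[k] (barS C (s + 1)).obj Y Z :=
  mkSh (M := barT C s) (-(s • ι)) (-((s + 1) • ι))

theorem d_mkU (f : C.hom Y X) (b : (barU C).obj X Z) : ((barS C 0).obj Y Z).d (mkU f b) =
    -mkU ((C.hom Y X).d f) b - mkU ((C.hom Y X).ε f) (((barU C).obj X Z).d b) :=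
  d_mkSh shift_zero_step f b

theorem d_mkS (s : ℕ) (f : C.hom Y X) (b : (barS C s).obj X Z) :
    ((barS C (s + 1)).obj Y Z).d (mkS s f b) =
    -mkS s ((C.hom Y X).d f) b - mkS s ((C.hom Y X).ε f) (((barS C s).obj X Z).d b) :=
  d_mkSh (shift_step s) f b

theorem lact_mkU (g : C.hom Y' Y) (f : C.hom Y X) (b : (barU C).obj X Z) :
    (barS C 0).lact g (mkU f b) = mkU (C.comp ((C.hom Y' Y).ε g) f) b :=
  lact_mkSh shift_zero_step g f b

theorem lact_mkS (s : ℕ) (g : C.hom Y' Y) (f : C.hom Y X) (b : (barS C s).obj X Z) :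
    (barS C (s + 1)).lact g (mkS s f b) = mkS s (C.comp ((C.hom Y' Y).ε g) f) b :=
  lact_mkSh (shift_step s) g f b

theorem ract_mkU (f : C.hom Y X) (b : (barU C).obj X Z) (g : C.hom Z Z') :
    (barS C 0).ract (mkU f b) g = mkU f ((barU C).ract b g) :=
  ract_mkSh f b g

theorem ract_mkS (s : ℕ) (f : C.hom Y X) (b : (barS C s).obj X Z) (g : C.hom Z Z') :
    (barS C (s + 1)).ract (mkS s f b) g = mkS s f ((barS C s).ract b g) :=
  ract_mkSh f b g

theorem ε_mkU (f : C.hom Y X) (b : (barU C).obj X Z) : ((barS C 0).obj Y Z).ε (mkU f b) =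
    -mkU ((C.hom Y X).ε f) (((barU C).obj X Z).ε b) :=
  ε_mkSh shift_zero_step f b

theorem ε_mkS (s : ℕ) (f : C.hom Y X) (b : (barS C s).obj X Z) :
    ((barS C (s + 1)).obj Y Z).ε (mkS s f b) =
      -mkS s ((C.hom Y X).ε f) (((barS C s).obj X Z).ε b) :=
  ε_mkSh (shift_step s) f b

/-- The augmentation `Bar(C) → C`. -/
def actS (Y Z : C.Obj) : (barS C 0).obj Y Z →ₗ[k] (barU C).obj Y Z :=
  shMap (M := (unit C).pre) (N := unit C) ((unit C).act Y Z) (-(0 • ι)) ι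

theorem actS_mkU (f : C.hom Y X) (b : (barU C).obj X Z) :
    actS Y Z (mkU f b) = (barU C).lact f b :=
  shMap_act f b

/-- The bottom of the recursion has the same form as `barδS_mkS_succ`, with the augmentation `actS`
in the role of the bar differential. -/
theorem barδS_mkS_zero (f : C.hom Y X) (b : (barS C 0).obj X Z) :
    barδS C 0 Y Z (mkS 0 f b) =
      (barS C 0).lact f b - mkU ((C.hom Y X).ε f) (actS X Z b) :=
  shMap_preδ shift_zero_step (unit C).act f b

theorem barδS_mkS_succ (s : ℕ) (f : C.hom Y X) (b : (barS C (s + 1)).obj X Z) :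
    barδS C (s + 1) Y Z (mkS (s + 1) f b) =
      (barS C (s + 1)).lact f b - mkS s ((C.hom Y X).ε f) (barδS C s X Z b) :=
  shMap_preδ (shift_step s) (barδ C s) f b

theorem mkU_mem {i j : Γ} {f : C.hom Y X} (hf : f ∈ (C.hom Y X).gr i) {b : (barU C).obj X Z}
    (hb : b ∈ ((barU C).obj X Z).gr j) : mkU f b ∈ ((barS C 0).obj Y Z).gr (i + j - ι) :=
  mkSh_mem shift_zero_step hf hb

theorem mkS_mem {s : ℕ} {i j : Γ} {f : C.hom Y X} (hf : f ∈ (C.hom Y X).gr i)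
    {b : (barS C s).obj X Z} (hb : b ∈ ((barS C s).obj X Z).gr j) :
    mkS s f b ∈ ((barS C (s + 1)).obj Y Z).gr (i + j - ι) :=
  mkSh_mem (shift_step s) hf hb

theorem mkU_ind {p : (barS C 0).obj Y Z → Prop} (x : (barS C 0).obj Y Z) (zero : p 0)
    (add : ∀ x y, p x → p y → p (x + y))
    (mk : ∀ X (f : C.hom Y X) (b : (barU C).obj X Z), p (mkU f b)) : p x :=
  mkSh_ind x zero add mk

theorem mkS_ind {s : ℕ} {p : (barS C (s + 1)).obj Y Z → Prop} (x : (barS C (s + 1)).obj Y Z)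
    (zero : p 0) (add : ∀ x y, p x → p y → p (x + y))
    (mk : ∀ X (f : C.hom Y X) (b : (barS C s).obj X Z), p (mkS s f b)) : p x :=
  mkSh_ind (M := barT C s) x zero add mk

variable {P : Type w'} [AddCommGroup P] [Module k P]

/-- Linear maps out of the length `0` part of the bar complex. -/
def liftU (F : ∀ X, C.hom Y X →ₗ[k] (barU C).obj X Z →ₗ[k] P) : (barS C 0).obj Y Z →ₗ[k] P :=
  liftSh (M := unit C) F

theorem liftU_mkU (F : ∀ X, C.hom Y X →ₗ[k] (barU C).obj X Z →ₗ[k] P) (f : C.hom Y X)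
    (b : (barU C).obj X Z) : liftU F (mkU f b) = F X f b :=
  liftSh_mkSh F f b

/-- Linear maps out of the length `s + 1` part of the bar complex. -/
def liftS {s : ℕ} (F : ∀ X, C.hom Y X →ₗ[k] (barS C s).obj X Z →ₗ[k] P) :
    (barS C (s + 1)).obj Y Z →ₗ[k] P :=
  liftSh (M := barT C s) F

theorem liftS_mkS {s : ℕ} (F : ∀ X, C.hom Y X →ₗ[k] (barS C s).obj X Z →ₗ[k] P) (f : C.hom Y X)
    (b : (barS C s).obj X Z) : liftS F (mkS s f b) = F X f b :=
  liftSh_mkSh (M := barT C s) F f b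

theorem liftU_mem {F : ∀ X, C.hom Y X →ₗ[k] (barU C).obj X Z →ₗ[k] P} {S : Submodule k P} {n : Γ}
    (h : ∀ X i j, i + j = n + ι → ∀ f ∈ (C.hom Y X).gr i, ∀ b ∈ ((barU C).obj X Z).gr j,
      F X f b ∈ S) {x : (barS C 0).obj Y Z} (hx : x ∈ ((barS C 0).obj Y Z).gr n) :
    liftU F x ∈ S :=
  liftSh_mem shift_zero_step h hx

theorem liftS_mem {s : ℕ} {F : ∀ X, C.hom Y X →ₗ[k] (barS C s).obj X Z →ₗ[k] P}
    {S : Submodule k P} {n : Γ}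
    (h : ∀ X i j, i + j = n + ι → ∀ f ∈ (C.hom Y X).gr i, ∀ b ∈ ((barS C s).obj X Z).gr j,
      F X f b ∈ S) {x : (barS C (s + 1)).obj Y Z} (hx : x ∈ ((barS C (s + 1)).obj Y Z).gr n) :
    liftS F x ∈ S :=
  liftSh_mem (M := barT C s) (shift_step s) h hx

end bar
end Bimod

/-! ### The augmented completed bar complex and the geometric series of a twist. -/

namespace Bimod
variable {C : DGCat.{u, v} k Γ} {Y' Y X Z Z' : C.Obj}

variable (C) in
/-- The underlying module of the augmented completed bar complex. -/
abbrev AugBar (Y Z : C.Obj) : Type (max u v) := (barU C).obj Y Z × ∀ s, (barS C s).obj Y Z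

namespace AugBar

theorem ext' {x y : AugBar C Y Z} (h : x.1 = y.1) (h0 : x.2 0 = y.2 0)
    (hs : ∀ s, x.2 (s + 1) = y.2 (s + 1)) : x = y :=
  Prod.ext h (funext fun s => match s with
    | 0 => h0
    | s + 1 => hs s)

/-- The projection to the augmentation term. -/
def pU : AugBar C Y Z →ₗ[k] (barU C).obj Y Z := LinearMap.fst k _ _

/-- The projection to the length `s` term. -/
def pS (s : ℕ) : AugBar C Y Z →ₗ[k] (barS C s).obj Y Z := LinearMap.proj s ∘ₗ LinearMap.snd k _ _

/-- Linear maps into `AugBar` from their components. -/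
def pair {P : Type w} [AddCommGroup P] [Module k P] (F : P →ₗ[k] (barU C).obj Y Z)
    (G : ∀ s, P →ₗ[k] (barS C s).obj Y Z) : P →ₗ[k] AugBar C Y Z :=
  LinearMap.prod F (LinearMap.pi G)

/-- The components of `AugBar.mk`. -/
def mkComp : ∀ s, C.hom Y X →ₗ[k] AugBar C X Z →ₗ[k] (barS C s).obj Y Z
  | 0 => mkU.compl₂ pU
  | s + 1 => (mkS s).compl₂ (pS s)

/-- The map `f, [f_0, …, f_{s+1}]' ↦ [f, f_0, …, f_{s+1}]'`. -/
def mk : C.hom Y X →ₗ[k] AugBar C X Z →ₗ[k] AugBar C Y Z :=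
  LinearMap.mk₂ k (fun f y => (0, fun s => mkComp s f y))
    (fun f f' y => Prod.ext (add_zero _).symm (funext fun _ => LinearMap.map_add₂ _ f f' y))
    (fun c f y => Prod.ext (smul_zero _).symm (funext fun _ => LinearMap.map_smul₂ _ c f y))
    (fun _ y y' => Prod.ext (add_zero _).symm (funext fun _ => map_add _ y y'))
    (fun c _ y => Prod.ext (smul_zero _).symm (funext fun _ => map_smul _ c y))

theorem mk_fst (f : C.hom Y X) (y : AugBar C X Z) : (mk f y).1 = 0 := rfl

theorem mk_zero (f : C.hom Y X) (y : AugBar C X Z) : (mk f y).2 0 = mkU f y.1 := rfl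

theorem mk_succ (f : C.hom Y X) (y : AugBar C X Z) (s : ℕ) :
    (mk f y).2 (s + 1) = mkS s f (y.2 s) := rfl

/-- The differential of the augmented completed bar complex. -/
def D : AugBar C Y Z →ₗ[k] AugBar C Y Z :=
  pair (((barU C).obj Y Z).d ∘ₗ pU + actS Y Z ∘ₗ pS 0)
    fun s => ((barS C s).obj Y Z).d ∘ₗ pS s + barδS C s Y Z ∘ₗ pS (s + 1)

theorem D_fst (y : AugBar C Y Z) :
    (D y).1 = ((barU C).obj Y Z).d y.1 + actS Y Z (y.2 0) := rfl

theorem D_snd (y : AugBar C Y Z) (s : ℕ) :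
    (D y).2 s = ((barS C s).obj Y Z).d (y.2 s) + barδS C s Y Z (y.2 (s + 1)) := rfl

/-- The sign operator of the augmented completed bar complex. -/
def E : AugBar C Y Z →ₗ[k] AugBar C Y Z :=
  pair (((barU C).obj Y Z).ε ∘ₗ pU) fun s => ((barS C s).obj Y Z).ε ∘ₗ pS s

theorem E_fst (y : AugBar C Y Z) : (E y).1 = ((barU C).obj Y Z).ε y.1 := rfl

theorem E_snd (y : AugBar C Y Z) (s : ℕ) : (E y).2 s = ((barS C s).obj Y Z).ε (y.2 s) := rfl

/-- The left action on the augmented completed bar complex. -/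
def lact (g : C.hom Y' Y) : AugBar C Y Z →ₗ[k] AugBar C Y' Z :=
  pair ((barU C).lact g ∘ₗ pU) fun s => (barS C s).lact g ∘ₗ pS s

theorem lact_fst (g : C.hom Y' Y) (y : AugBar C Y Z) : (lact g y).1 = (barU C).lact g y.1 := rfl

theorem lact_snd (g : C.hom Y' Y) (y : AugBar C Y Z) (s : ℕ) :
    (lact g y).2 s = (barS C s).lact g (y.2 s) := rfl

/-- The right action on the augmented completed bar complex. -/
def ract (g : C.hom Z Z') : AugBar C Y Z →ₗ[k] AugBar C Y Z' :=
  pair ((barU C).ract.flip g ∘ₗ pU) fun s => (barS C s).ract.flip g ∘ₗ pS s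

theorem ract_fst (g : C.hom Z Z') (y : AugBar C Y Z) : (ract g y).1 = (barU C).ract y.1 g := rfl

theorem ract_snd (g : C.hom Z Z') (y : AugBar C Y Z) (s : ℕ) :
    (ract g y).2 s = (barS C s).ract (y.2 s) g := rfl

/-- Collects the recursions for all lengths into one identity. In the augmentation component both
`mk` terms vanish, and applying the augmentation to `mkU f y.1` leaves the action of $f$. -/
theorem D_mk (f : C.hom Y X) (y : AugBar C X Z) :
    D (mk f y) = -mk ((C.hom Y X).d f) y - mk ((C.hom Y X).ε f) (D y) + lact f y := by
  refine ext' ?_ ?_ fun s => ?_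
  · simp only [D_fst, mk_fst, mk_zero, Prod.fst_add, Prod.fst_sub, Prod.fst_neg, lact_fst,
      actS_mkU, map_zero, neg_zero, sub_zero]
  · simp only [D_snd, D_fst, mk_zero, mk_succ, Prod.snd_add, Prod.snd_sub, Prod.snd_neg,
      Pi.add_apply, Pi.sub_apply, Pi.neg_apply, lact_snd, d_mkU, barδS_mkS_zero, map_add]
    abel
  · simp only [D_snd, mk_succ, Prod.snd_add, Prod.snd_sub, Prod.snd_neg,
      Pi.add_apply, Pi.sub_apply, Pi.neg_apply, lact_snd, d_mkS, barδS_mkS_succ, map_add]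
    abel

theorem E_mk (f : C.hom Y X) (y : AugBar C X Z) : E (mk f y) = -mk ((C.hom Y X).ε f) (E y) := by
  refine ext' ?_ ?_ fun s => ?_
  · rw [E_fst, mk_fst, map_zero, Prod.fst_neg, mk_fst, neg_zero]
  · exact ε_mkU f y.1
  · exact ε_mkS s f (y.2 s)

theorem lact_mk (g : C.hom Y' Y) (f : C.hom Y X) (y : AugBar C X Z) :
    lact g (mk f y) = mk (C.comp ((C.hom Y' Y).ε g) f) y := by
  refine ext' ?_ ?_ fun s => ?_
  · rw [lact_fst, mk_fst, map_zero, mk_fst]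
  · exact lact_mkU g f y.1
  · exact lact_mkS s g f (y.2 s)

theorem ract_mk (f : C.hom Y X) (y : AugBar C X Z) (g : C.hom Z Z') :
    ract g (mk f y) = mk f (ract g y) := by
  refine ext' ?_ ?_ fun s => ?_
  · rw [ract_fst, mk_fst, map_zero, mk_fst, LinearMap.zero_apply]
  · exact ract_mkU f y.1 g
  · exact ract_mkS s f (y.2 s) g

/-- `mk a` raises the length by one and has no augmentation component, so a fixed point vanishes
length by length. -/
theorem eq_zero_of_eq_mk {a : C.hom X X} {z : AugBar C X Z} (h : z = mk a z) : z = 0 := by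
  have h1 : z.1 = 0 := by rw [h, mk_fst]
  have hs : ∀ s, z.2 s = 0 := by
    intro s
    induction s with
    | zero => rw [h, mk_zero, h1, map_zero]
    | succ s ih => rw [h, mk_succ, ih, map_zero]
  exact Prod.ext h1 (funext hs)

/-- The components of `AugBar.geom`. -/
def geomComp (a : C.hom X X) : ∀ s, AugBar C X Z →ₗ[k] (barS C s).obj X Z
  | 0 => pS 0 + mkU a ∘ₗ pU
  -- The equation $z=y+\mathrm{mk}\,a\,z$ solved recursively: its component in length $s+1$ involves
  -- $z$ only in length $s$.
  | s + 1 => pS (s + 1) + mkS s a ∘ₗ geomComp a s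

/-- The map `[f_0, …, f_{s+1}]' ↦ ∑_n [a, …, a, f_0, …, f_{s+1}]'` with `n` copies of `a`. -/
def geom (a : C.hom X X) : AugBar C X Z →ₗ[k] AugBar C X Z := pair pU (geomComp a)

theorem geom_eq (a : C.hom X X) (y : AugBar C X Z) : geom a y = y + mk a (geom a y) :=
  ext' (add_zero _).symm rfl fun _ => rfl

/-- The difference of two solutions is a fixed point of `mk a`. This characterization replaces all
manipulation of infinite sums. -/
theorem eq_geom {a : C.hom X X} {y z : AugBar C X Z} (h : z = y + mk a z) : z = geom a y := by
  refine sub_eq_zero.1 (eq_zero_of_eq_mk (a := a) ?_)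
  rw [map_sub]
  nth_rw 1 [h, geom_eq a y]
  abel

theorem ract_geom (a : C.hom X X) (y : AugBar C X Z) (g : C.hom Z Z') :
    ract g (geom a y) = geom a (ract g y) := by
  apply eq_geom
  nth_rw 1 [geom_eq]
  rw [map_add, ract_mk]

/-- The operator `y ↦ d y + α_Y y - (-1)^|y| y α_Z`. -/
def twD (Y Z : MCObj C) : AugBar C Y.obj Z.obj →ₗ[k] AugBar C Y.obj Z.obj :=
  D + lact Y.α - ract Z.α ∘ₗ E

theorem twD_apply (Y Z : MCObj C) (y : AugBar C Y.obj Z.obj) :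
    twD Y Z y = D y + lact Y.α y - ract Z.α (E y) := rfl

/-- The left side has no term with $\alpha_X$ acting from the left: it is supplied by $D$ acting on
the series, since contracting an inserted $\alpha_X$ with its left neighbour is part of the bar
differential. -/
theorem geom_twD (X Z : MCObj C) (y : AugBar C X.obj Z.obj) :
    D (geom X.α y) - ract Z.α (E (geom X.α y)) = geom X.α (twD X Z y) := by
  apply eq_geom
  have hd : (C.hom X.obj X.obj).d X.α = - C.comp X.α X.α := eq_neg_of_add_eq_zero_left X.mc
  -- The term $-\mathrm{mk}(d\alpha)=\mathrm{mk}(\alpha^2)$ from differentiating the leading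
  -- $\alpha$ cancels the $-\mathrm{mk}(\alpha^2)$ in $\alpha\cdot\mathrm{geom}\,\alpha\,y$. This is
  -- where the Maurer–Cartan equation for $X$ enters.
  have h1 : D (geom X.α y) = D y + lact X.α y + mk X.α (D (geom X.α y)) := by
    have h2 : lact X.α (geom X.α y) = lact X.α y - mk (C.comp X.α X.α) (geom X.α y) := by
      nth_rw 1 [geom_eq]
      rw [map_add, lact_mk, ε_α, map_neg, LinearMap.neg_apply, map_neg, LinearMap.neg_apply,
        sub_eq_add_neg]
    nth_rw 1 [geom_eq]
    rw [map_add, D_mk, hd, ε_α, h2, map_neg, map_neg, LinearMap.neg_apply, LinearMap.neg_apply]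
    abel
  -- Two signs cancel: `E` anticommutes with prepending up to $\varepsilon$, and
  -- $\varepsilon\alpha=-\alpha$ because $\langle\iota,\iota\rangle=1$.
  have h3 : E (geom X.α y) = E y + mk X.α (E (geom X.α y)) := by
    nth_rw 1 [geom_eq]
    rw [map_add, E_mk, ε_α, map_neg, LinearMap.neg_apply, neg_neg]
  nth_rw 1 [h1, h3]
  rw [twD_apply, map_add, map_sub, ract_mk]
  abel

/-- The twisted analogue of `D_mk`. The term $f\cdot\mathrm{geom}\,y$ splits into $f\cdot y$ and a
term prepending $\varepsilon f\circ\alpha_X$. The latter, together with $\alpha_Y\circ f$ from the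
left twist, completes $df$ to the differential of $f$ in $\operatorname{Tw}(C)$. -/
theorem twD_mk_geom (Y X Z : MCObj C) (f : C.hom Y.obj X.obj) (y : AugBar C X.obj Z.obj) :
    twD Y Z (mk f (geom X.α y)) = -mk ((C.hom Y.obj X.obj).d f + twδ C Y X f) (geom X.α y)
      - mk ((C.hom Y.obj X.obj).ε f) (geom X.α (twD X Z y)) + lact f y := by
  have h : lact f (geom X.α y) =
      lact f y + mk (C.comp ((C.hom Y.obj X.obj).ε f) X.α) (geom X.α y) := by
    nth_rw 1 [geom_eq]
    rw [map_add, lact_mk]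
  rw [twD_apply, D_mk, lact_mk, E_mk, h, ε_α, twδ_apply, ← geom_twD]
  simp only [map_neg, map_sub, map_add, LinearMap.neg_apply, LinearMap.sub_apply,
    LinearMap.add_apply, ract_mk]
  abel

/-- The elements of `AugBar` all of whose components have degree `i`. -/
def gr (i : Γ) : Submodule k (AugBar C Y Z) :=
  (((barU C).obj Y Z).gr i).comap pU ⊓ ⨅ s, (((barS C s).obj Y Z).gr i).comap (pS s)

theorem mem_gr {i : Γ} {y : AugBar C Y Z} : y ∈ gr i ↔
    y.1 ∈ ((barU C).obj Y Z).gr i ∧ ∀ s, y.2 s ∈ ((barS C s).obj Y Z).gr i := by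
  rw [gr, Submodule.mem_inf, Submodule.mem_iInf]; rfl

theorem mk_mem {i j : Γ} {f : C.hom Y X} (hf : f ∈ (C.hom Y X).gr i) {y : AugBar C X Z}
    (hy : y ∈ gr j) : mk f y ∈ gr (i + j - ι) := by
  rw [mem_gr] at hy ⊢
  refine ⟨Submodule.zero_mem _, fun s => ?_⟩
  cases s with
  | zero => exact mkU_mem hf hy.1
  | succ s => exact mkS_mem hf (hy.2 s)

/-- Prepending has degree $-\iota$ and $a$ has degree $\iota$, so every term of the series preserves
degrees. -/
theorem geom_mem {i : Γ} {a : C.hom X X} (ha : a ∈ (C.hom X X).gr ι) {y : AugBar C X Z}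
    (hy : y ∈ gr i) : geom a y ∈ gr i := by
  rw [mem_gr] at hy ⊢
  refine ⟨hy.1, fun s => ?_⟩
  have e : ι + i - ι = i := add_sub_cancel_left ι i
  induction s with
  | zero => exact Submodule.add_mem _ (hy.2 0) (e ▸ mkU_mem ha hy.1)
  | succ s ih => exact Submodule.add_mem _ (hy.2 (s + 1)) (e ▸ mkS_mem ha ih)

end AugBar
end Bimod

/-! ### Signs in the augmentation term $q^\iota C$. -/

namespace Bimod
section
variable {C : DGCat.{u, v} k Γ} {Y' Y Z Z' : C.Obj}

/-- The identity, as a map `C → q^ι C`. -/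
def shU : C.hom Y Z →ₗ[k] (barU C).obj Y Z := sh (M := unit C) ι

/-- The identity, as a map `q^ι C → C`. -/
def unshU : (barU C).obj Y Z →ₗ[k] C.hom Y Z := unsh (M := unit C) ι

theorem shU_unshU (b : (barU C).obj Y Z) : shU (unshU b) = b := rfl

theorem d_shU (g : C.hom Y Z) : ((barU C).obj Y Z).d (shU g) = -shU ((C.hom Y Z).d g) := by
  refine (d_sh (M := unit C) ι g).trans ?_
  rw [form_ι_ι, sgn_one, neg_one_smul]; rfl

theorem ε_shU (g : C.hom Y Z) : ((barU C).obj Y Z).ε (shU g) = -shU ((C.hom Y Z).ε g) := by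
  refine (ε_sh (M := unit C) ι g).trans ?_
  rw [form_ι_ι, sgn_one, neg_one_smul]; rfl

theorem lact_shU (g : C.hom Y' Y) (f : C.hom Y Z) :
    (barU C).lact g (shU f) = shU (C.comp ((C.hom Y' Y).ε g) f) := rfl

theorem ract_shU (f : C.hom Y Z) (g : C.hom Z Z') :
    (barU C).ract (shU f) g = shU (C.comp f g) := rfl

theorem shU_mem {i : Γ} {f : C.hom Y Z} (hf : f ∈ (C.hom Y Z).gr i) :
    shU f ∈ ((barU C).obj Y Z).gr (i + ι) := sh_mem (M := unit C) ι hf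

theorem unshU_mem {i : Γ} {b : (barU C).obj Y Z} (hb : b ∈ ((barU C).obj Y Z).gr i) :
    unshU b ∈ (C.hom Y Z).gr (i - ι) := hb

end
end Bimod

/-! ### The recursive map of augmented bar complexes induced by a functor to $\operatorname{Tw}(C)$.
-/

/-- A dg functor from `T` to `Tw(C)`, described by morphisms of `C`. -/
structure TwFunctor (T : DGCat.{u', v'} k Γ) (C : DGCat.{u, v} k Γ) where
  obj : T.Obj → MCObj C
  map : ∀ {X Y}, T.hom X Y →ₗ[k] C.hom (obj X).obj (obj Y).obj
  map_mem : ∀ {X Y} (i : Γ), ∀ f ∈ (T.hom X Y).gr i, map f ∈ (C.hom (obj X).obj (obj Y).obj).gr i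
  map_d : ∀ {X Y} (f : T.hom X Y), map ((T.hom X Y).d f) =
    (C.hom (obj X).obj (obj Y).obj).d (map f) + twδ C (obj X) (obj Y) (map f)
  map_comp : ∀ {X Y Z} (f : T.hom X Y) (g : T.hom Y Z),
    map (T.comp f g) = C.comp (map f) (map g)

/-- The identity of `Tw(C)`. -/
def TwFunctor.id (C : DGCat.{u, v} k Γ) : TwFunctor (Tw C) C where
  obj X := X
  map {X Y} := (LinearMap.id : C.hom X.obj Y.obj →ₗ[k] C.hom X.obj Y.obj)
  map_mem _ _ h := h
  map_d _ := rfl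
  map_comp _ _ := rfl

namespace TwFunctor
variable {T : DGCat.{u', v'} k Γ} {C : DGCat.{u, v} k Γ} (G : TwFunctor T C) {Y' Y X Z Z' : T.Obj}

theorem map_ε (f : T.hom Y X) :
    G.map ((T.hom Y X).ε f) = (C.hom (G.obj Y).obj (G.obj X).obj).ε (G.map f) :=
  DGMod.map_tw_zero G.map G.map_mem ι f

open DG.Bimod

/-- The map `q^ι T → q^ι C` given by the underlying morphisms. -/
def mapU (Y Z : T.Obj) : (barU T).obj Y Z →ₗ[k] (barU C).obj (G.obj Y).obj (G.obj Z).obj :=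
  shU ∘ₗ G.map ∘ₗ unshU

theorem mapU_shU (f : T.hom Y Z) : G.mapU Y Z (shU f) = shU (G.map f) := rfl

theorem mapU_mem {i : Γ} {b : (barU T).obj Y Z} (hb : b ∈ ((barU T).obj Y Z).gr i) :
    G.mapU Y Z b ∈ ((barU C).obj (G.obj Y).obj (G.obj Z).obj).gr i := by
  have := shU_mem (G.map_mem _ _ (unshU_mem hb))
  rwa [sub_add_cancel] at this

theorem mapU_lact (g : T.hom Y' Y) (b : (barU T).obj Y Z) :
    G.mapU Y' Z ((barU T).lact g b) = (barU C).lact (G.map g) (G.mapU Y Z b) := by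
  rw [← shU_unshU b]; generalize unshU b = b
  rw [lact_shU, mapU_shU, mapU_shU, lact_shU, G.map_comp, G.map_ε]

theorem mapU_ract (b : (barU T).obj Y Z) (g : T.hom Z Z') :
    G.mapU Y Z' ((barU T).ract b g) = (barU C).ract (G.mapU Y Z b) (G.map g) := by
  rw [← shU_unshU b]; generalize unshU b = b
  rw [ract_shU, mapU_shU, mapU_shU, ract_shU, G.map_comp]

/-- The shift by $\iota$ negates the twisted differential as a whole. The left action on $q^\iota C$
and $\varepsilon$ carry matching signs, so the twist terms keep the form they have in `AugBar.twD`.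
-/
theorem mapU_d (b : (barU T).obj Y Z) : G.mapU Y Z (((barU T).obj Y Z).d b) =
    ((barU C).obj _ _).d (G.mapU Y Z b) + (barU C).lact (G.obj Y).α (G.mapU Y Z b) -
      (barU C).ract (((barU C).obj _ _).ε (G.mapU Y Z b)) (G.obj Z).α := by
  rw [← shU_unshU b]; generalize unshU b = b
  rw [d_shU, map_neg, mapU_shU, mapU_shU, d_shU, ε_shU, lact_shU, map_neg, LinearMap.neg_apply,
    ract_shU, G.map_d, ε_α, twδ_apply]
  simp only [map_add, map_sub, map_neg, LinearMap.neg_apply]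
  abel

/-- The map of augmented bar complexes on the augmentation term of the source. -/
def ΦU (Y Z : T.Obj) : (barU T).obj Y Z →ₗ[k] AugBar C (G.obj Y).obj (G.obj Z).obj :=
  AugBar.pair (G.mapU Y Z) 0

theorem ΦU_fst (b : (barU T).obj Y Z) : (G.ΦU Y Z b).1 = G.mapU Y Z b := rfl

theorem ΦU_snd (b : (barU T).obj Y Z) (s : ℕ) : (G.ΦU Y Z b).2 s = 0 := rfl

/-- The start of the induction, in length $-1$: there is no intermediate object at which to insert
anything, and `twD` reduces to the shifted twisted differential. -/
theorem twD_ΦU (b : (barU T).obj Y Z) :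
    AugBar.twD (G.obj Y) (G.obj Z) (G.ΦU Y Z b) = G.ΦU Y Z (((barU T).obj Y Z).d b) := by
  refine Prod.ext ?_ (funext fun s => ?_)
  · rw [G.ΦU_fst, G.mapU_d, AugBar.twD_apply, Prod.fst_sub, Prod.fst_add, AugBar.D_fst,
      AugBar.lact_fst, AugBar.ract_fst, AugBar.E_fst, G.ΦU_fst, G.ΦU_snd, map_zero, add_zero]
  · rw [AugBar.twD_apply, Prod.snd_sub, Prod.snd_add, Pi.sub_apply, Pi.add_apply, AugBar.D_snd,
      AugBar.lact_snd, AugBar.ract_snd, AugBar.E_snd]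
    simp only [G.ΦU_snd, map_zero, add_zero, LinearMap.zero_apply, sub_zero]

theorem ΦU_lact (g : T.hom Y' Y) (b : (barU T).obj Y Z) :
    G.ΦU Y' Z ((barU T).lact g b) = AugBar.lact (G.map g) (G.ΦU Y Z b) :=
  Prod.ext (G.mapU_lact g b) (funext fun s => (map_zero ((barS C s).lact (G.map g))).symm)

theorem ΦU_ract (b : (barU T).obj Y Z) (g : T.hom Z Z') :
    G.ΦU Y Z' ((barU T).ract b g) = AugBar.ract (G.map g) (G.ΦU Y Z b) :=
  Prod.ext (G.mapU_ract b g) (funext fun s => (map_zero ((barS C s).ract.flip (G.map g))).symm)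

theorem ΦU_mem {i : Γ} {b : (barU T).obj Y Z} (hb : b ∈ ((barU T).obj Y Z).gr i) :
    G.ΦU Y Z b ∈ AugBar.gr i :=
  AugBar.mem_gr.2 ⟨G.mapU_mem hb, fun _ => Submodule.zero_mem _⟩

/-- The bilinear map `f, b ↦ [f, ∑_n α, …, α, φ(b)]'`. -/
def ΦStep {P : Type w} [AddCommGroup P] [Module k P]
    (φ : P →ₗ[k] AugBar C (G.obj X).obj (G.obj Z).obj) :
    T.hom Y X →ₗ[k] P →ₗ[k] AugBar C (G.obj Y).obj (G.obj Z).obj :=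
  (AugBar.mk ∘ₗ G.map).compl₂ (AugBar.geom (G.obj X).α ∘ₗ φ)

/-- The map of augmented bar complexes on the length `r` term of the source. -/
def Φ : ∀ (r : ℕ) (Y Z : T.Obj), (barS T r).obj Y Z →ₗ[k] AugBar C (G.obj Y).obj (G.obj Z).obj
  | 0, _, Z => liftU (C := T) fun X => G.ΦStep (X := X) (G.ΦU X Z)
  | r + 1, _, Z => liftS (C := T) fun X => G.ΦStep (X := X) (Φ r X Z)

theorem Φ_mkU (f : T.hom Y X) (b : (barU T).obj X Z) :
    G.Φ 0 Y Z (mkU f b) = AugBar.mk (G.map f) (AugBar.geom (G.obj X).α (G.ΦU X Z b)) :=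
  liftU_mkU (C := T) _ f b

theorem Φ_mkS (r : ℕ) (f : T.hom Y X) (b : (barS T r).obj X Z) :
    G.Φ (r + 1) Y Z (mkS r f b) = AugBar.mk (G.map f) (AugBar.geom (G.obj X).α (G.Φ r X Z b)) :=
  liftS_mkS (C := T) _ f b

theorem Φ_lact (r : ℕ) (g : T.hom Y' Y) (x : (barS T r).obj Y Z) :
    G.Φ r Y' Z ((barS T r).lact g x) = AugBar.lact (G.map g) (G.Φ r Y Z x) := by
  cases r with
  | zero =>
    induction x using mkU_ind with
    | zero => simp only [map_zero]
    | add x y hx hy => simp only [map_add, hx, hy]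
    | mk X f b => rw [lact_mkU, G.Φ_mkU, G.Φ_mkU, AugBar.lact_mk, G.map_comp, G.map_ε]
  | succ r =>
    induction x using mkS_ind with
    | zero => simp only [map_zero]
    | add x y hx hy => simp only [map_add, hx, hy]
    | mk X f b => rw [lact_mkS, G.Φ_mkS, G.Φ_mkS, AugBar.lact_mk, G.map_comp, G.map_ε]

theorem Φ_ract (r : ℕ) : ∀ {Y : T.Obj} (x : (barS T r).obj Y Z) (g : T.hom Z Z'),
    G.Φ r Y Z' ((barS T r).ract x g) = AugBar.ract (G.map g) (G.Φ r Y Z x) := by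
  induction r with
  | zero =>
    intro Y x g
    induction x using mkU_ind with
    | zero => simp only [map_zero, LinearMap.zero_apply]
    | add x y hx hy => simp only [map_add, LinearMap.add_apply, hx, hy]
    | mk X f b => rw [ract_mkU, G.Φ_mkU, G.Φ_mkU, AugBar.ract_mk, AugBar.ract_geom, G.ΦU_ract]
  | succ r ih =>
    intro Y x g
    induction x using mkS_ind with
    | zero => simp only [map_zero, LinearMap.zero_apply]
    | add x y hx hy => simp only [map_add, LinearMap.add_apply, hx, hy]
    | mk X f b => rw [ract_mkS, G.Φ_mkS, G.Φ_mkS, AugBar.ract_mk, AugBar.ract_geom, ih]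

/-- In the augmented complex the augmentation is part of the differential, hence the extra term. It
lives in length $-1$ only and disappears from the unaugmented complex. -/
theorem twD_Φ_zero (x : (barS T 0).obj Y Z) : AugBar.twD (G.obj Y) (G.obj Z) (G.Φ 0 Y Z x) =
    G.Φ 0 Y Z (((barS T 0).obj Y Z).d x) + G.ΦU Y Z (actS (C := T) Y Z x) := by
  induction x using mkU_ind with
  | zero => simp only [map_zero, add_zero]
  | add x y hx hy => simp only [map_add, hx, hy]; abel
  | mk X f b =>
    rw [G.Φ_mkU, AugBar.twD_mk_geom, d_mkU, map_sub, map_neg, G.Φ_mkU, G.Φ_mkU, actS_mkU, G.ΦU_lact,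
      G.twD_ΦU, G.map_d, G.map_ε]

/-- Both sides satisfy the same rule for prepending: `AugBar.twD_mk_geom` on the left, `d_mkS` and
the recursion for `barδS` on the right. The inner `twD` is then the preceding case. -/
theorem twD_Φ_succ (r : ℕ) : ∀ {Y : T.Obj} (x : (barS T (r + 1)).obj Y Z),
    AugBar.twD (G.obj Y) (G.obj Z) (G.Φ (r + 1) Y Z x) =
      G.Φ (r + 1) Y Z (((barS T (r + 1)).obj Y Z).d x) +
      G.Φ r Y Z (barδS T r Y Z x) := by
  induction r with
  | zero =>
    intro Y x
    induction x using mkS_ind with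
    | zero => simp only [map_zero, add_zero]
    | add x y hx hy => simp only [map_add, hx, hy]; abel
    | mk X f b =>
      rw [G.Φ_mkS, AugBar.twD_mk_geom, d_mkS, map_sub, map_neg, G.Φ_mkS, G.Φ_mkS, barδS_mkS_zero,
        map_sub, G.Φ_lact, G.Φ_mkU, G.twD_Φ_zero, G.map_d, G.map_ε]
      simp only [map_add, LinearMap.add_apply]
      abel
  | succ r ih =>
    intro Y x
    induction x using mkS_ind with
    | zero => simp only [map_zero, add_zero]
    | add x y hx hy => simp only [map_add, hx, hy]; abel
    | mk X f b =>
      rw [G.Φ_mkS, AugBar.twD_mk_geom, d_mkS, map_sub, map_neg, G.Φ_mkS, G.Φ_mkS, barδS_mkS_succ,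
        map_sub, G.Φ_lact, G.Φ_mkS, ih, G.map_d, G.map_ε]
      simp only [map_add, LinearMap.add_apply]
      abel

theorem ΦStep_mem {P : Type w} [AddCommGroup P] [Module k P]
    {φ : P →ₗ[k] AugBar C (G.obj X).obj (G.obj Z).obj} {i j n : Γ} (hij : i + j = n + ι)
    {f : T.hom Y X}
    (hf : f ∈ (T.hom Y X).gr i) {b : P} (hb : φ b ∈ AugBar.gr j) :
    G.ΦStep φ f b ∈ AugBar.gr n := by
  have := AugBar.mk_mem (G.map_mem _ _ hf) (AugBar.geom_mem (G.obj X).α_mem hb)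
  rwa [hij, add_sub_cancel_right] at this

/-- `AugBar` contains all families, while the completed bar complex contains only finite sums of
homogeneous ones. Preservation of degrees is what makes the map land in the latter. -/
theorem Φ_mem (r : ℕ) : ∀ {Y : T.Obj} {i : Γ} {x : (barS T r).obj Y Z},
    x ∈ ((barS T r).obj Y Z).gr i → G.Φ r Y Z x ∈ AugBar.gr i := by
  induction r with
  | zero =>
    intro Y i x hx
    exact liftU_mem (C := T) (F := fun X => G.ΦStep (G.ΦU X Z)) (S := AugBar.gr i)
      (fun X i j hij f hf b hb => G.ΦStep_mem hij hf (G.ΦU_mem hb)) hx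
  | succ r ih =>
    intro Y i x hx
    exact liftS_mem (C := T) (F := fun X => G.ΦStep (G.Φ r X Z)) (S := AugBar.gr i)
      (fun X i j hij f hf b hb => G.ΦStep_mem hij hf (ih hb)) hx

end TwFunctor

/-! ### Total complexes through their inclusions and components. -/

namespace Bimod.Cplx
variable {C : DGCat.{u, v} k Γ} {D : DGCat.{u', v'} k Γ} (K : Cplx.{w} C D)
  {Y' Y : C.Obj} {Z Z' : D.Obj}

theorem tot_ind {p : K.tot.obj Y Z → Prop} (x : K.tot.obj Y Z) (zero : p 0)
    (add : ∀ x y, p x → p y → p (x + y)) (inc : ∀ r x, p (K.inc r Y Z x)) : p x :=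
  sInc_ind (K := K) (p := p) x zero add inc

theorem d_inc_zero (x : (K.B 0).obj Y Z) :
    (K.tot.obj Y Z).d (K.inc 0 Y Z x) = K.inc 0 Y Z (((K.B 0).obj Y Z).d x) :=
  (congrArg₂ (· + ·) (K.d_sInc 0 Y Z x) (K.sδ_zero Y Z x)).trans (add_zero _)

theorem d_inc_succ (r : ℕ) (x : (K.B (r + 1)).obj Y Z) :
    (K.tot.obj Y Z).d (K.inc (r + 1) Y Z x) =
      K.inc (r + 1) Y Z (((K.B (r + 1)).obj Y Z).d x) + K.inc r Y Z (K.δ r Y Z x) :=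
  congrArg₂ (· + ·) (K.d_sInc (r + 1) Y Z x) (K.sδ_succ r Y Z x)

theorem lact_inc (r : ℕ) (g : C.hom Y' Y) (x : (K.B r).obj Y Z) :
    K.tot.lact g (K.inc r Y Z x) = K.inc r Y' Z ((K.B r).lact g x) :=
  K.lact_sInc r Z g x

theorem ract_inc (r : ℕ) (x : (K.B r).obj Y Z) (g : D.hom Z Z') :
    K.tot.ract (K.inc r Y Z x) g = K.inc r Y Z' ((K.B r).ract x g) :=
  K.ract_sInc r Y x g

theorem coord_inc_same (r : ℕ) (x : (K.B r).obj Y Z) : K.coord r Y Z (K.inc r Y Z x) = x :=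
  DGMod.comp_inc_same (fun r => (K.B r).obj Y Z) r x

theorem coord_inc_ne {r s : ℕ} (h : r ≠ s) (x : (K.B r).obj Y Z) :
    K.coord s Y Z (K.inc r Y Z x) = 0 :=
  DGMod.comp_inc_ne (fun r => (K.B r).obj Y Z) h x

section lift
variable {P : Type w'} [AddCommGroup P] [Module k P]

/-- Linear maps out of the total complex. -/
def totLift (F : ∀ r, (K.B r).obj Y Z →ₗ[k] P) : K.tot.obj Y Z →ₗ[k] P :=
  (DGMod.dsumLift (fun r => (K.B r).obj Y Z) F :
    (DGMod.dsum fun r => (K.B r).obj Y Z) →ₗ[k] P)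

theorem totLift_inc (F : ∀ r, (K.B r).obj Y Z →ₗ[k] P) (r : ℕ) (x : (K.B r).obj Y Z) :
    K.totLift F (K.inc r Y Z x) = F r x :=
  DGMod.dsumLift_inc (fun r => (K.B r).obj Y Z) F r x

theorem totLift_mem {F : ∀ r, (K.B r).obj Y Z →ₗ[k] P} {S : Submodule k P} {i : Γ}
    (h : ∀ r, ∀ x ∈ ((K.B r).obj Y Z).gr i, F r x ∈ S) {x : K.tot.obj Y Z}
    (hx : x ∈ (K.tot.obj Y Z).gr i) : K.totLift F x ∈ S :=
  DGMod.dsum_gr_mem (fun r => (K.B r).obj Y Z) (F := DGMod.dsumLift (fun r => (K.B r).obj Y Z) F)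
    (fun r x hx => by rw [DGMod.dsumLift_inc]; exact h r x hx) hx

end lift

/-- Degree zero linear maps into the completed total complex. -/
def totHatLift {N : DGMod.{w'} k Γ} (F : ∀ s, N →ₗ[k] (K.B s).obj Y Z)
    (hF : ∀ s i, ∀ x ∈ N.gr i, F s x ∈ ((K.B s).obj Y Z).gr i) : N →ₗ[k] K.totHat.obj Y Z :=
  (DGMod.dprodLift (fun s => (K.B s).obj Y Z) 0 F
    (fun s i x hx => by rw [add_zero]; exact hF s i x hx) :
    N →ₗ[k] (DGMod.dprod fun s => (K.B s).obj Y Z))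

theorem component_ext {x y : K.totHat.obj Y Z}
    (h : ∀ s, K.component s Y Z x = K.component s Y Z y) : x = y :=
  DGMod.pcomp_ext (fun s => (K.B s).obj Y Z) h

theorem mem_totHat_gr {i : Γ} {x : K.totHat.obj Y Z} : x ∈ (K.totHat.obj Y Z).gr i ↔
    ∀ s, K.component s Y Z x ∈ ((K.B s).obj Y Z).gr i :=
  DGMod.mem_dprod_gr (fun s => (K.B s).obj Y Z)

theorem component_d (s : ℕ) (x : K.totHat.obj Y Z) :
    K.component s Y Z ((K.totHat.obj Y Z).d x) =
      ((K.B s).obj Y Z).d (K.component s Y Z x) + K.δ s Y Z (K.component (s + 1) Y Z x) := rfl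

theorem component_ε (s : ℕ) (x : K.totHat.obj Y Z) :
    K.component s Y Z ((K.totHat.obj Y Z).ε x) = ((K.B s).obj Y Z).ε (K.component s Y Z x) :=
  DGMod.pcomp_tw (fun s => (K.B s).obj Y Z) ι s x

theorem component_lact (s : ℕ) (g : C.hom Y' Y) (x : K.totHat.obj Y Z) :
    K.component s Y' Z (K.totHat.lact g x) = (K.B s).lact g (K.component s Y Z x) := rfl

theorem component_ract (s : ℕ) (x : K.totHat.obj Y Z) (g : D.hom Z Z') :
    K.component s Y Z' (K.totHat.ract x g) = (K.B s).ract (K.component s Y Z x) g := rfl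

end Bimod.Cplx

/-! ### The same interface for the bar complex and its completion. -/

namespace Bimod
section barApi
variable {C : DGCat.{u, v} k Γ} {Y' Y Z Z' : C.Obj}

/-- The inclusion of the length `r` part of the bar complex. -/
def barInc (r : ℕ) : (barS C r).obj Y Z →ₗ[k] (bar C).obj Y Z := (barCplx C).inc r Y Z

/-- The length `s` component of an element of the bar complex. -/
def barCoord (s : ℕ) : (bar C).obj Y Z →ₗ[k] (barS C s).obj Y Z := (barCplx C).coord s Y Z

/-- The length `s` component of an element of the completed bar complex. -/
def hatComp (s : ℕ) : (barHat C).obj Y Z →ₗ[k] (barS C s).obj Y Z := (barCplx C).component s Y Z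

theorem bar_ind {p : (bar C).obj Y Z → Prop} (x : (bar C).obj Y Z) (zero : p 0)
    (add : ∀ x y, p x → p y → p (x + y)) (inc : ∀ r x, p (barInc r x)) : p x :=
  (barCplx C).tot_ind (p := p) x zero add inc

theorem d_barInc_zero (x : (barS C 0).obj Y Z) :
    ((bar C).obj Y Z).d (barInc 0 x) = barInc 0 (((barS C 0).obj Y Z).d x) :=
  (barCplx C).d_inc_zero x

theorem d_barInc_succ (r : ℕ) (x : (barS C (r + 1)).obj Y Z) :
    ((bar C).obj Y Z).d (barInc (r + 1) x) =
      barInc (r + 1) (((barS C (r + 1)).obj Y Z).d x) + barInc r (barδS C r Y Z x) :=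
  (barCplx C).d_inc_succ r x

theorem lact_barInc (r : ℕ) (g : C.hom Y' Y) (x : (barS C r).obj Y Z) :
    (bar C).lact g (barInc r x) = barInc r ((barS C r).lact g x) :=
  (barCplx C).lact_inc r g x

theorem ract_barInc (r : ℕ) (x : (barS C r).obj Y Z) (g : C.hom Z Z') :
    (bar C).ract (barInc r x) g = barInc r ((barS C r).ract x g) :=
  (barCplx C).ract_inc r x g

theorem barCoord_barInc_same (r : ℕ) (x : (barS C r).obj Y Z) : barCoord r (barInc r x) = x :=
  (barCplx C).coord_inc_same r x

theorem barCoord_barInc_ne {r s : ℕ} (h : r ≠ s) (x : (barS C r).obj Y Z) :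
    barCoord s (barInc r x) = 0 :=
  (barCplx C).coord_inc_ne h x

section
variable {P : Type w'} [AddCommGroup P] [Module k P]

/-- Linear maps out of the bar complex. -/
def barLift (F : ∀ r, (barS C r).obj Y Z →ₗ[k] P) : (bar C).obj Y Z →ₗ[k] P :=
  (barCplx C).totLift F

theorem barLift_barInc (F : ∀ r, (barS C r).obj Y Z →ₗ[k] P) (r : ℕ) (x : (barS C r).obj Y Z) :
    barLift F (barInc r x) = F r x :=
  (barCplx C).totLift_inc F r x

theorem barLift_mem {F : ∀ r, (barS C r).obj Y Z →ₗ[k] P} {S : Submodule k P} {i : Γ}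
    (h : ∀ r, ∀ x ∈ ((barS C r).obj Y Z).gr i, F r x ∈ S) {x : (bar C).obj Y Z}
    (hx : x ∈ ((bar C).obj Y Z).gr i) : barLift F x ∈ S :=
  (barCplx C).totLift_mem h hx

end

/-- Degree zero linear maps into the completed bar complex. -/
def hatLift {N : DGMod.{w'} k Γ} (F : ∀ s, N →ₗ[k] (barS C s).obj Y Z)
    (hF : ∀ s i, ∀ x ∈ N.gr i, F s x ∈ ((barS C s).obj Y Z).gr i) : N →ₗ[k] (barHat C).obj Y Z :=
  (barCplx C).totHatLift F hF

theorem hatComp_ext {x y : (barHat C).obj Y Z} (h : ∀ s, hatComp s x = hatComp s y) : x = y :=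
  (barCplx C).component_ext h

theorem mem_barHat_gr {i : Γ} {x : (barHat C).obj Y Z} : x ∈ ((barHat C).obj Y Z).gr i ↔
    ∀ s, hatComp s x ∈ ((barS C s).obj Y Z).gr i :=
  (barCplx C).mem_totHat_gr

theorem hatComp_d (s : ℕ) (x : (barHat C).obj Y Z) : hatComp s (((barHat C).obj Y Z).d x) =
    ((barS C s).obj Y Z).d (hatComp s x) + barδS C s Y Z (hatComp (s + 1) x) :=
  (barCplx C).component_d s x

theorem hatComp_ε (s : ℕ) (x : (barHat C).obj Y Z) :
    hatComp s (((barHat C).obj Y Z).ε x) = ((barS C s).obj Y Z).ε (hatComp s x) :=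
  (barCplx C).component_ε s x

theorem hatComp_lact (s : ℕ) (g : C.hom Y' Y) (x : (barHat C).obj Y Z) :
    hatComp s ((barHat C).lact g x) = (barS C s).lact g (hatComp s x) :=
  (barCplx C).component_lact s g x

theorem hatComp_ract (s : ℕ) (x : (barHat C).obj Y Z) (g : C.hom Z Z') :
    hatComp s ((barHat C).ract x g) = (barS C s).ract (hatComp s x) g :=
  (barCplx C).component_ract s x g

end barApi
end Bimod

/-! ### The induced map from the bar complex to the completed bar complex. -/

namespace TwFunctor
variable {T : DGCat.{u', v'} k Γ} {C : DGCat.{u, v} k Γ} (G : TwFunctor T C) {Y' Y X Z Z' : T.Obj}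

open DG.Bimod

/-- The map `Bar(T) → Bar^(C)` induced by a dg functor `T → Tw(C)`. -/
def Φhat (Y Z : T.Obj) : (bar T).obj Y Z →ₗ[k] (barHat C).obj (G.obj Y).obj (G.obj Z).obj :=
  barLift fun r => hatLift (N := (barS T r).obj Y Z)
    (fun s => AugBar.pS s ∘ₗ G.Φ r Y Z) fun s _ _ hx => (AugBar.mem_gr.1 (G.Φ_mem r hx)).2 s

theorem hatComp_Φhat (r s : ℕ) (x : (barS T r).obj Y Z) :
    hatComp s (G.Φhat Y Z (barInc r x)) = (G.Φ r Y Z x).2 s := by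
  rw [Φhat, barLift_barInc]; rfl

theorem Φhat_mem {i : Γ} {x : (bar T).obj Y Z} (hx : x ∈ ((bar T).obj Y Z).gr i) :
    G.Φhat Y Z x ∈ ((barHat C).obj (G.obj Y).obj (G.obj Z).obj).gr i :=
  barLift_mem (fun r _ hx => mem_barHat_gr.2 fun s => (AugBar.mem_gr.1 (G.Φ_mem r hx)).2 s) hx

theorem Φhat_lact (g : T.hom Y' Y) (x : (bar T).obj Y Z) :
    G.Φhat Y' Z ((bar T).lact g x) = (barHat C).lact (G.map g) (G.Φhat Y Z x) := by
  induction x using bar_ind with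
  | zero => simp only [map_zero]
  | add x y hx hy => simp only [map_add, hx, hy]
  | inc r x =>
    refine hatComp_ext fun s => ?_
    rw [lact_barInc, hatComp_Φhat, hatComp_lact, hatComp_Φhat, Φ_lact, AugBar.lact_snd]

theorem Φhat_ract (x : (bar T).obj Y Z) (g : T.hom Z Z') :
    G.Φhat Y Z' ((bar T).ract x g) = (barHat C).ract (G.Φhat Y Z x) (G.map g) := by
  induction x using bar_ind with
  | zero => simp only [map_zero, LinearMap.zero_apply]
  | add x y hx hy => simp only [map_add, LinearMap.add_apply, hx, hy]
  | inc r x =>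
    refine hatComp_ext fun s => ?_
    rw [ract_barInc, hatComp_Φhat, hatComp_ract, hatComp_Φhat, Φ_ract, AugBar.ract_snd]

/-- `Φhat` is not a chain map for the untwisted differential of the target; the two extra terms are
absorbed later by $d\psi$ and $d\psi^{-1}$. -/
theorem Φhat_d (x : (bar T).obj Y Z) : G.Φhat Y Z (((bar T).obj Y Z).d x) =
    ((barHat C).obj _ _).d (G.Φhat Y Z x) + (barHat C).lact (G.obj Y).α (G.Φhat Y Z x) -
      (barHat C).ract (((barHat C).obj _ _).ε (G.Φhat Y Z x)) (G.obj Z).α := by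
  induction x using bar_ind with
  | zero => simp only [map_zero, LinearMap.zero_apply, add_zero, sub_zero]
  | add x y hx hy => simp only [map_add, LinearMap.add_apply, hx, hy]; abel
  | inc r x =>
    refine hatComp_ext fun s => ?_
    -- Only components of length $s\ge0$ are compared, so for $r=0$ the augmentation term of
    -- `twD_Φ_zero` contributes nothing.
    have h : (AugBar.twD (G.obj Y) (G.obj Z) (G.Φ r Y Z x)).2 s =
        hatComp s (G.Φhat Y Z (((bar T).obj Y Z).d (barInc r x))) := by
      cases r with
      | zero =>
        rw [d_barInc_zero, hatComp_Φhat, twD_Φ_zero, Prod.snd_add, Pi.add_apply, ΦU_snd, add_zero]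
      | succ r =>
        rw [d_barInc_succ, map_add, map_add, hatComp_Φhat, hatComp_Φhat, twD_Φ_succ,
          Prod.snd_add, Pi.add_apply]
    rw [← h, map_sub, map_add, hatComp_d, hatComp_lact, hatComp_ract, hatComp_ε]
    simp only [hatComp_Φhat]
    rfl

end TwFunctor

/-! ### Conjugation by $\psi$ and the bimodule map. -/

section sandwich

theorem Bimod.tq_rel {A : DGCat.{u, v} k Γ} {B : DGCat.{u', v'} k Γ} {C : DGCat.{u'', v''} k Γ}
    (M : Bimod.{w} A B) (N : Bimod.{w'} B C) {X : A.Obj} {Y Y' : B.Obj} {Z : C.Obj}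
    (m : M.obj X Y) (f : B.hom Y Y') (n : N.obj Y' Z) :
    tq M N Y' (M.ract m f) n = tq M N Y m (N.lact f n) := by
  rw [← sub_eq_zero]
  exact DGMod.qmk_eq_zero (tenRel_mem M N m f n)

variable {C : DGCat.{u, v} k Γ} {Y' Y Z Z' : MCObj C}

/-- The linear map `x ↦ ψ_Y · x · ψ_{Y'}⁻¹`. -/
def sandwichL (Y Z : MCObj C) : (Bimod.barHat C).obj Y.obj Z.obj →ₗ[k] (twBarTw C).obj Y Z :=
  (Bimod.tq ((twR C).tensor (Bimod.barHat C)) (twL C) Z.obj).flip (ψinv Z) ∘ₗ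
    Bimod.tq (twR C) (Bimod.barHat C) Y.obj (ψ Y)

theorem ψ_mem (Y : MCObj C) : ψ Y ∈ ((twR C).obj Y Y.obj).gr 0 := C.one_mem Y.obj

theorem ψinv_mem (Y : MCObj C) : ψinv Y ∈ ((twL C).obj Y.obj Y).gr 0 := C.one_mem Y.obj

/-- The source of $\psi_{\mathbf Y}$ has twist $0$ and its target has twist $\alpha$, so only
$\alpha\circ\mathrm{id}$ survives. Writing it as a right action lets it slide across the tensor
product over $C$. -/
theorem d_ψ (Y : MCObj C) : ((twR C).obj Y Y.obj).d (ψ Y) = (twR C).ract (ψ Y) Y.α := by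
  have h : (C.hom Y.obj Y.obj).d (C.one Y.obj) +
      (C.comp Y.α (C.one Y.obj) - C.comp ((C.hom Y.obj Y.obj).ε (C.one Y.obj)) 0) =
      C.comp (C.one Y.obj) Y.α := by
    rw [C.d_one, C.comp_one, C.one_comp, map_zero, sub_zero, zero_add]
  exact h

theorem d_ψinv (Y : MCObj C) :
    ((twL C).obj Y.obj Y).d (ψinv Y) = -(twL C).lact Y.α (ψinv Y) := by
  have h : (C.hom Y.obj Y.obj).d (C.one Y.obj) +
      (C.comp 0 (C.one Y.obj) - C.comp ((C.hom Y.obj Y.obj).ε (C.one Y.obj)) Y.α) =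
      -C.comp Y.α (C.one Y.obj) := by
    rw [C.d_one, DGMod.ε, C.tw_one, C.one_comp, map_zero, LinearMap.zero_apply,
      zero_sub, zero_add, C.comp_one]
  exact h

/-- $\psi_{\mathbf Y'}\otimes gx=\psi_{\mathbf Y'}g\otimes x=g\psi_{\mathbf Y}\otimes x$. Here $g$
is first a morphism of $C$ and finally the morphism of $\operatorname{Tw}(C)$ with the same
underlying element. -/
theorem sandwichL_lact (g : C.hom Y'.obj Y.obj) (x : (Bimod.barHat C).obj Y.obj Z.obj) :
    sandwichL Y' Z ((Bimod.barHat C).lact g x) =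
      (twBarTw C).lact (X' := Y') (X := Y) (g : (Tw C).hom Y' Y) (sandwichL Y Z x) := by
  refine Eq.trans ?_ (Bimod.tqLact_tq ((twR C).tensor (Bimod.barHat C)) (twL C)
    (g : (Tw C).hom Y' Y) Z.obj _ (ψinv Z)).symm
  refine congrArg (fun y => Bimod.tq ((twR C).tensor (Bimod.barHat C)) (twL C) Z.obj y (ψinv Z)) ?_
  refine (Bimod.tq_rel (twR C) (Bimod.barHat C) (ψ Y') g x).symm.trans ?_
  refine Eq.trans ?_ (Bimod.tqLact_tq (twR C) (Bimod.barHat C)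
    (g : (Tw C).hom Y' Y) Y.obj (ψ Y) x).symm
  have h : C.comp (C.one Y'.obj) g = C.comp g (C.one Y.obj) := by rw [C.one_comp, C.comp_one]
  exact congrArg (fun y : (twR C).obj Y' Y.obj => Bimod.tq (twR C) (Bimod.barHat C) Y.obj y x) h

theorem sandwichL_ract (x : (Bimod.barHat C).obj Y.obj Z.obj) (g : C.hom Z.obj Z'.obj) :
    sandwichL Y Z' ((Bimod.barHat C).ract x g) =
      (twBarTw C).ract (Y := Z) (Y' := Z') (sandwichL Y Z x) (g : (Tw C).hom Z Z') := by
  refine Eq.trans ?_ (Bimod.tqRact_tq ((twR C).tensor (Bimod.barHat C)) (twL C)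
    Z.obj _ (ψinv Z) (g : (Tw C).hom Z Z')).symm
  have h : C.comp g (C.one Z'.obj) = C.comp (C.one Z.obj) g := by rw [C.one_comp, C.comp_one]
  refine Eq.trans ?_ (congrArg (fun y : (twL C).obj Z.obj Z' =>
    Bimod.tq ((twR C).tensor (Bimod.barHat C)) (twL C) Z.obj
      (Bimod.tq (twR C) (Bimod.barHat C) Y.obj (ψ Y) x) y) h)
  refine Eq.trans ?_ (Bimod.tq_rel ((twR C).tensor (Bimod.barHat C)) (twL C) _ g (ψinv Z'))
  exact congrArg (fun y => Bimod.tq ((twR C).tensor (Bimod.barHat C)) (twL C) Z'.obj y (ψinv Z'))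
    (Bimod.tqRact_tq (twR C) (Bimod.barHat C) Y.obj (ψ Y) x g).symm

theorem sandwichL_mem {i : Γ} {x : (Bimod.barHat C).obj Y.obj Z.obj}
    (hx : x ∈ ((Bimod.barHat C).obj Y.obj Z.obj).gr i) :
    sandwichL Y Z x ∈ ((twBarTw C).obj Y Z).gr i := by
  have := Bimod.tq_mem ((twR C).tensor (Bimod.barHat C)) (twL C)
    (Bimod.tq_mem (twR C) (Bimod.barHat C) (ψ_mem Y) hx) (ψinv_mem Z)
  rwa [zero_add, add_zero] at this

theorem ε_ψ (Y : MCObj C) : ((twR C).obj Y Y.obj).ε (ψ Y) = ψ Y := by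
  rw [DGMod.ε_apply _ (ψ_mem Y), map_zero, sgn_zero, one_smul]

/-- The Leibniz rule with $d\psi=\psi\alpha$ and $d\psi^{-1}=-\alpha\psi^{-1}$, both twists being
moved onto $x$ by the tensor relations. Since $\psi$ has degree zero, the only Koszul sign is
$\varepsilon$ on $x$. -/
theorem d_sandwichL (x : (Bimod.barHat C).obj Y.obj Z.obj) :
    ((twBarTw C).obj Y Z).d (sandwichL Y Z x) =
      sandwichL Y Z (((Bimod.barHat C).obj Y.obj Z.obj).d x + (Bimod.barHat C).lact Y.α x -
        (Bimod.barHat C).ract (((Bimod.barHat C).obj Y.obj Z.obj).ε x) Z.α) := by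
  have h1 : (((twR C).tensor (Bimod.barHat C)).obj Y Z.obj).d
      (Bimod.tq (twR C) (Bimod.barHat C) Y.obj (ψ Y) x) =
      Bimod.tq (twR C) (Bimod.barHat C) Y.obj (ψ Y)
        (((Bimod.barHat C).obj Y.obj Z.obj).d x + (Bimod.barHat C).lact Y.α x) := by
    refine (Bimod.d_tq (twR C) (Bimod.barHat C) Y.obj (ψ Y) x).trans ?_
    rw [d_ψ, ε_ψ, map_add, add_comm]
    exact congrArg (_ + ·) (Bimod.tq_rel (twR C) (Bimod.barHat C) (ψ Y) Y.α x)
  have h2 : (((twR C).tensor (Bimod.barHat C)).obj Y Z.obj).ε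
      (Bimod.tq (twR C) (Bimod.barHat C) Y.obj (ψ Y) x) =
      Bimod.tq (twR C) (Bimod.barHat C) Y.obj (ψ Y)
        (((Bimod.barHat C).obj Y.obj Z.obj).ε x) := by
    refine (Bimod.ε_tq (twR C) (Bimod.barHat C) Y.obj (ψ Y) x).trans ?_
    rw [ε_ψ]
  refine (Bimod.d_tq ((twR C).tensor (Bimod.barHat C)) (twL C) Z.obj
    (Bimod.tq (twR C) (Bimod.barHat C) Y.obj (ψ Y) x) (ψinv Z)).trans ?_
  rw [map_sub, h1, h2, d_ψinv, map_neg, sub_eq_add_neg]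
  refine congrArg (fun y => _ + -y) ?_
  refine (Bimod.tq_rel ((twR C).tensor (Bimod.barHat C)) (twL C) _ Z.α (ψinv Z)).symm.trans ?_
  exact congrArg (fun y => Bimod.tq ((twR C).tensor (Bimod.barHat C)) (twL C) Z.obj y
    (ψinv Z)) (Bimod.tqRact_tq (twR C) (Bimod.barHat C) Y.obj (ψ Y) _ Z.α)

/-- The bimodule map `Bar(Tw(C)) → Tw(C) ⊗_C Bar^(C) ⊗_C Tw(C)`. -/
def Ξ (Y Z : MCObj C) : (Bimod.bar (Tw C)).obj Y Z →ₗ[k] (twBarTw C).obj Y Z :=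
  sandwichL Y Z ∘ₗ (TwFunctor.id C).Φhat Y Z

theorem Ξ_closed : IsClosedBimodMap (Bimod.bar (Tw C)) (twBarTw C) Ξ where
  mem _ _ _ _ hm := sandwichL_mem ((TwFunctor.id C).Φhat_mem hm)
  d Y Z m := (congrArg (sandwichL Y Z) ((TwFunctor.id C).Φhat_d m)).trans (d_sandwichL _).symm
  lact Y' _ Z g m := (congrArg (sandwichL Y' Z) ((TwFunctor.id C).Φhat_lact g m)).trans
    (sandwichL_lact _ _)
  ract Y _ Z' m g := (congrArg (sandwichL Y Z') ((TwFunctor.id C).Φhat_ract m g)).trans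
    (sandwichL_ract _ _)

end sandwich

/-! ### The parity of the sign exponents. -/

section signs

namespace Path
variable {C : DGCat.{u, v} k Γ} {Y Y' X : C.Obj}

theorem σ_last (i : Γ) (f : C.hom Y X) (hf : f ∈ (C.hom Y X).gr i) (j : Γ) (g : C.hom X Y')
    (hg : g ∈ (C.hom X Y').gr j) : (last X i f hf j g hg).σ = form ι i := by
  change ∑ u : Fin 1, ((0 + 1 - (u : ℕ) : ℕ) : ZMod 2) *
    form ι ((![i, j] : Fin 2 → Γ) u.castSucc) = _
  simp

theorem σ_cons (i : Γ) (f : C.hom Y X) (hf : f ∈ (C.hom Y X).gr i) (p : Path C X Y') :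
    (cons X i f hf p).σ = p.len * form ι i + p.σ := by
  change ∑ u : Fin (p.len + 1 + 1), ((p.len + 1 + 1 - (u : ℕ) : ℕ) : ZMod 2) *
    form ι ((Fin.cons i p.deg : Fin (p.len + 2 + 1) → Γ) u.castSucc) = _
  have h2 : (2 : ZMod 2) = 0 := rfl
  rw [Fin.sum_univ_succ, σ]
  congr 1
  · simp only [Fin.val_zero, Nat.sub_zero, Fin.castSucc_zero, Fin.cons_zero]
    push_cast
    -- The leading coefficient is the length plus two, which agrees with the length modulo 2.
    linear_combination form ι i * h2
  · refine Finset.sum_congr rfl fun u _ => ?_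
    rw [Fin.val_succ, Nat.add_sub_add_right, Fin.castSucc_succ, Fin.cons_succ, par]

theorem len_between (j : Γ) (a : C.hom X X) (ha : a ∈ (C.hom X X).gr j) (l : Γ)
    (g : C.hom X Y') (hg : g ∈ (C.hom X Y').gr l) (n : ℕ) :
    ∀ {Y : C.Obj} (i : Γ) (f : C.hom Y X) (hf : f ∈ (C.hom Y X).gr i),
      (between j a ha l g hg n i f hf).len = n := by
  induction n with
  | zero => intros; rfl
  | succ n ih => intro Y i f hf; exact congrArg (· + 1) (ih j a ha)

theorem len_reps (j : Γ) (a : C.hom X X) (ha : a ∈ (C.hom X X).gr j) (p : Path C X Y') (n : ℕ) :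
    (reps j a ha p n).len = n + p.len := by
  induction n with
  | zero => exact (zero_add _).symm
  | succ n ih => rw [add_right_comm]; exact congrArg (· + 1) ih

theorem choose_two_succ (n : ℕ) :
    ((n + 1).choose 2 : ZMod 2) = n + (n.choose 2 : ZMod 2) := by
  rw [Nat.choose_succ_succ' n 1, Nat.choose_one_right, Nat.cast_add]

/-- The $n$ copies of $a$ are odd with coefficients $n,\dots,1$, which add up to the binomial
coefficient; $f$ has coefficient $n+1$. -/
theorem σ_between (a : C.hom X X) (ha : a ∈ (C.hom X X).gr ι) (l : Γ)
    (g : C.hom X Y') (hg : g ∈ (C.hom X Y').gr l) (n : ℕ) :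
    ∀ {Y : C.Obj} (i : Γ) (f : C.hom Y X) (hf : f ∈ (C.hom Y X).gr i),
      (between ι a ha l g hg n i f hf).σ = ((n + 1).choose 2 : ℕ) + (n + 1) * form ι i := by
  induction n with
  | zero =>
    intro Y i f hf
    refine (σ_last i f hf l g hg).trans ?_
    simp
  | succ n ih =>
    intro Y i f hf
    have h2 : (2 : ZMod 2) = 0 := rfl
    refine (σ_cons i f hf _).trans ?_
    rw [len_between, ih, form_ι_ι, choose_two_succ (n + 1)]
    push_cast
    linear_combination -form ι i * h2

/-- Modulo 2, each prepended odd element adds the length of the sequence it is put in front of, and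
these lengths run from `p.len` to `p.len + n - 1`. -/
theorem σ_reps (a : C.hom X X) (ha : a ∈ (C.hom X X).gr ι) (p : Path C X Y') (n : ℕ) :
    (reps ι a ha p n).σ = p.σ + n * p.len + (n.choose 2 : ℕ) := by
  induction n with
  | zero => simp [reps]
  | succ n ih =>
    refine (σ_cons ι a ha _).trans ?_
    rw [len_reps, ih, form_ι_ι, choose_two_succ n]
    push_cast
    ring

theorem add_choose_two (m n : ℕ) :
    ((m + n + 1).choose 2 : ZMod 2) = (n + 1).choose 2 + m * n + ((m + 1).choose 2 : ℕ) := by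
  induction m with
  | zero => simp
  | succ m ih =>
    rw [show m + 1 + n + 1 = (m + n + 1) + 1 by ring, choose_two_succ (m + n + 1), ih,
      choose_two_succ (m + 1)]
    push_cast
    ring

theorem insertSign_last (i : Γ) (f : C.hom Y X) (hf : f ∈ (C.hom Y X).gr i) (j : Γ)
    (g : C.hom X Y') (hg : g ∈ (C.hom X Y').gr j) (n : Fin 1 → ℕ) :
    (last X i f hf j g hg).insertSign n = ((n 0 + 1).choose 2 : ℕ) + form ι i * n 0 := by
  change ((((∑ u, n u) + 1).choose 2 : ℕ) : ZMod 2)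
    + (∑ u : Fin 1, ((0 - (u : ℕ) : ℕ) : ZMod 2) * (n u : ZMod 2))
    + ∑ u : Fin 1, ∑ u' : Fin 1,
        (if u ≤ u' then form ι ((![i, j] : Fin 2 → Γ) u.castSucc) * (n u' : ZMod 2) else 0) = _
  simp

/-- Isolates the index $u=0$, so that $\tau$ can be compared with $\sigma$ by recursion on the
sequence. The product of $n_0$ with the remaining total comes from splitting the binomial
coefficient with `add_choose_two`. -/
theorem insertSign_cons (i : Γ) (f : C.hom Y X) (hf : f ∈ (C.hom Y X).gr i) (p : Path C X Y')
    (n : Fin (p.len + 1 + 1) → ℕ) :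
    (cons X i f hf p).insertSign n = p.insertSign (Fin.tail n) +
      n 0 * ((∑ u, Fin.tail n u : ℕ) + p.len + 1) + ((n 0 + 1).choose 2 : ℕ) +
      form ι i * (n 0 + (∑ u, Fin.tail n u : ℕ)) := by
  change ((((∑ u, n u) + 1).choose 2 : ℕ) : ZMod 2)
    + (∑ u : Fin (p.len + 1 + 1), ((p.len + 1 - (u : ℕ) : ℕ) : ZMod 2) * (n u : ZMod 2))
    + ∑ u : Fin (p.len + 1 + 1), ∑ u' : Fin (p.len + 1 + 1),
        (if u ≤ u' then form ι ((Fin.cons i p.deg : Fin (p.len + 2 + 1) → Γ) u.castSucc) *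
          (n u' : ZMod 2) else 0) = _
  have h1 : ∑ u, n u = n 0 + ∑ u, Fin.tail n u := Fin.sum_univ_succ n
  have h2 : ∑ u : Fin (p.len + 1 + 1), ((p.len + 1 - (u : ℕ) : ℕ) : ZMod 2) * (n u : ZMod 2) =
      (p.len + 1) * n 0 +
        ∑ u : Fin (p.len + 1), ((p.len - (u : ℕ) : ℕ) : ZMod 2) * (Fin.tail n u : ZMod 2) := by
    rw [Fin.sum_univ_succ]
    congr 1
    · simp
    · refine Finset.sum_congr rfl fun u _ => ?_
      rw [Fin.val_succ, Nat.add_sub_add_right]; rfl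
  have h3 : ∑ u : Fin (p.len + 1 + 1), ∑ u' : Fin (p.len + 1 + 1),
        (if u ≤ u' then form ι ((Fin.cons i p.deg : Fin (p.len + 2 + 1) → Γ) u.castSucc) *
          (n u' : ZMod 2) else 0) = form ι i * (n 0 + (∑ u, Fin.tail n u : ℕ)) +
      ∑ u : Fin (p.len + 1), ∑ u' : Fin (p.len + 1),
        (if u ≤ u' then p.par u.castSucc * (Fin.tail n u' : ZMod 2) else 0) := by
    rw [Fin.sum_univ_succ]
    congr 1
    · simp only [Fin.zero_le, if_true, Fin.castSucc_zero, Fin.cons_zero]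
      rw [← Finset.mul_sum, ← Nat.cast_sum, h1, Nat.cast_add]
    · refine Finset.sum_congr rfl fun u _ => ?_
      rw [Fin.sum_univ_succ, if_neg (by simp), zero_add]
      refine Finset.sum_congr rfl fun u' _ => ?_
      simp only [Fin.succ_le_succ_iff, Fin.castSucc_succ, Fin.cons_succ]
      rfl
  rw [h1, h2, h3, add_choose_two, insertSign]
  ring

end Path

namespace Path
variable {C : DGCat.{u, v} k Γ}

theorem len_insert : ∀ {Y Y' : MCObj C} (p : Path (Tw C) Y Y') (n : Fin (p.len + 1) → ℕ),
    (p.insert n).len = p.len + ∑ u, n u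
  | _, _, last X i f hf j g hg, n => by
    refine (len_between (C := C) ι X.α X.α_mem j g hg (n 0) i f hf).trans ?_
    exact ((zero_add _).trans (Fin.sum_univ_one n)).symm
  | _, _, cons X i f hf p, n => by
    have e : (reps ι X.α X.α_mem (insert p (Fin.tail n)) (n 0)).len =
        n 0 + (p.len + ∑ u, Fin.tail n u) :=
      (len_reps (C := C) ι X.α X.α_mem (insert p (Fin.tail n)) (n 0)).trans
        (congrArg (n 0 + ·) (len_insert p (Fin.tail n)))
    refine (congrArg (· + 1) e).trans ?_
    refine Eq.trans ?_ (congrArg (p.len + 1 + ·) (Fin.sum_univ_succ n)).symm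
    change n 0 + (p.len + ∑ u, Fin.tail n u) + 1 = p.len + 1 + (n 0 + ∑ u, Fin.tail n u)
    ring

/-- Recursion on the sequence: `σ_cons` and `σ_reps` compute the left side, `insertSign_cons` the
right. -/
theorem σ_insert : ∀ {Y Y' : MCObj C} (p : Path (Tw C) Y Y') (n : Fin (p.len + 1) → ℕ),
    (p.insert n).σ = p.σ + p.insertSign n
  | _, _, last X i f hf j g hg, n => by
    refine (σ_between (C := C) X.α X.α_mem j g hg (n 0) i f hf).trans ?_
    refine Eq.trans ?_ (congrArg₂ (· + ·) (σ_last (C := Tw C) i f hf j g hg)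
      (insertSign_last (C := Tw C) i f hf j g hg n)).symm
    have key : ∀ c m κ : ZMod 2, c + (m + 1) * κ = κ + (c + κ * m) := fun c m κ => by ring
    exact key _ _ _
  | _, _, cons X i f hf p, n => by
    have h2 : (2 : ZMod 2) = 0 := rfl
    have e1 : (reps ι X.α X.α_mem (insert p (Fin.tail n)) (n 0)).len =
        n 0 + (p.len + ∑ u, Fin.tail n u) :=
      (len_reps (C := C) ι X.α X.α_mem (insert p (Fin.tail n)) (n 0)).trans
        (congrArg (n 0 + ·) (len_insert p (Fin.tail n)))
    have e2 : (reps ι X.α X.α_mem (insert p (Fin.tail n)) (n 0)).σ =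
        p.σ + p.insertSign (Fin.tail n) + n 0 * ((p.len + ∑ u, Fin.tail n u : ℕ) : ZMod 2) +
          ((n 0).choose 2 : ℕ) :=
      (σ_reps (C := C) X.α X.α_mem (insert p (Fin.tail n)) (n 0)).trans
        (congrArg₂ (fun (a : ZMod 2) (b : ℕ) => a + n 0 * b + ((n 0).choose 2 : ℕ))
          (σ_insert p (Fin.tail n)) (len_insert p (Fin.tail n)))
    refine (σ_cons (C := C) i f hf _).trans ?_
    refine (congrArg₂ (fun (a : ℕ) (b : ZMod 2) => a * form ι i + b) e1 e2).trans ?_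
    refine Eq.trans ?_ (congrArg₂ (· + ·) (σ_cons (C := Tw C) i f hf p)
      (insertSign_cons (C := Tw C) i f hf p n)).symm
    -- Here $a=n_0$, $L$ is the length of the tail, $N$ the number of insertions in it and $\kappa$
    -- the parity of $f$. After $\binom{a+1}{2}=a+\binom a2$ the two sides differ by $2a$.
    have key : ∀ (a L N : ℕ) (s I κ : ZMod 2), ((a + (L + N) : ℕ) : ZMod 2) * κ +
        (s + I + a * ((L + N : ℕ) : ZMod 2) + (a.choose 2 : ℕ)) =
        L * κ + s + (I + a * ((N : ℕ) + L + 1) + ((a + 1).choose 2 : ℕ) + κ * (a + (N : ℕ))) := by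
      intro a L N s I κ
      rw [choose_two_succ]
      push_cast
      linear_combination -(a : ZMod 2) * h2
    exact key _ _ _ _ _ _

end Path
end signs

/-! ### Componentwise finite sums and the expansion of the geometric series. -/

section sums

/-- The family `f` has finite support and sum `m`. -/
def IsFinSum {I : Type w} {M : Type w'} [AddCommMonoid M] (f : I → M) (m : M) : Prop :=
  ∃ F : Finset I, (∀ i ∉ F, f i = 0) ∧ ∑ i ∈ F, f i = m

namespace IsFinSum
variable {I : Type w} {J : Type w''} {M : Type w'} [AddCommGroup M] {f : I → M} {m : M}

theorem finite_support (h : IsFinSum f m) : (Function.support f).Finite := by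
  obtain ⟨F, hF, -⟩ := h
  exact F.finite_toSet.subset fun i hi => by_contra fun hn => hi (hF i hn)

theorem eq_finsum (h : IsFinSum f m) : m = ∑ᶠ i, f i := by
  obtain ⟨F, hF, rfl⟩ := h
  exact (finsum_eq_sum_of_support_subset f fun i hi => by_contra fun hn => hi (hF i hn)).symm

theorem of_forall_eq_zero (h : ∀ i, f i = 0) : IsFinSum f 0 :=
  ⟨∅, fun i _ => h i, Finset.sum_empty⟩

theorem of_unique [Unique I] : IsFinSum f (f default) :=
  ⟨{default}, fun i hi => (hi (Finset.mem_singleton.2 (Unique.eq_default i))).elim,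
    Finset.sum_singleton f default⟩

theorem map [Module k M] {N : Type v} [AddCommGroup N] [Module k N] (L : M →ₗ[k] N)
    (h : IsFinSum f m) : IsFinSum (fun i => L (f i)) (L m) := by
  obtain ⟨F, hF, rfl⟩ := h
  exact ⟨F, fun i hi => (congrArg L (hF i hi)).trans (map_zero L), (map_sum L f F).symm⟩

theorem of_equiv {f : J → M} (e : I ≃ J) (h : IsFinSum (fun i => f (e i)) m) : IsFinSum f m := by
  obtain ⟨F, hF, rfl⟩ := h
  refine ⟨F.map e.toEmbedding, fun j hj => ?_, Finset.sum_map _ _ _⟩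
  have : f (e (e.symm j)) = 0 := hF (e.symm j) fun hn => hj (Finset.mem_map_equiv.2 hn)
  rwa [e.apply_symm_apply] at this

theorem of_sum {f : I ⊕ J → M} {m' : M} (h : IsFinSum (fun i => f (.inl i)) m)
    (h' : IsFinSum (fun j => f (.inr j)) m') : IsFinSum f (m + m') := by
  obtain ⟨F, hF, rfl⟩ := h
  obtain ⟨F', hF', rfl⟩ := h'
  refine ⟨F.disjSum F', ?_, Finset.sum_disjSum _ _ _⟩
  rintro (i | j) hi
  · exact hF i fun hn => hi (Finset.inl_mem_disjSum.2 hn)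
  · exact hF' j fun hn => hi (Finset.inr_mem_disjSum.2 hn)

/-- The splitting of `ℕ × I` into `{0} × I` and its complement. -/
def natProdEquiv (I : Type w) : I ⊕ ℕ × I ≃ ℕ × I where
  toFun := Sum.elim (fun i => (0, i)) fun x => (x.1 + 1, x.2)
  invFun
    | (0, i) => .inl i
    | (n + 1, i) => .inr (n, i)
  left_inv := by rintro (_ | _) <;> rfl
  right_inv := by rintro ⟨_ | _, _⟩ <;> rfl

/-- Matches the equation $z=y+\mathrm{mk}\,a\,z$: the terms without an inserted $a$ give $y$, the
others have a leading $a$ to strip off. -/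
theorem of_nat_prod {f : ℕ × I → M} {m' : M} (h : IsFinSum (fun i => f (0, i)) m)
    (h' : IsFinSum (fun x : ℕ × I => f (x.1 + 1, x.2)) m') : IsFinSum f (m + m') :=
  of_equiv (natProdEquiv I) (of_sum h h')

end IsFinSum

namespace Bimod.AugBar
variable {C : DGCat.{u, v} k Γ} {Y X Z : C.Obj} {I : Type w} {J : Type w'}

/-- The family `T` has finite support in each component, and sum `y`. -/
structure IsAugSum (T : I → AugBar C Y Z) (y : AugBar C Y Z) : Prop where
  fst : IsFinSum (fun i => (T i).1) y.1
  snd : ∀ s, IsFinSum (fun i => (T i).2 s) (y.2 s)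

namespace IsAugSum

theorem of_unique [Unique I] (T : I → AugBar C Y Z) : IsAugSum T (T default) :=
  ⟨.of_unique, fun _ => .of_unique⟩

theorem of_equiv {T : J → AugBar C Y Z} {y : AugBar C Y Z} (e : I ≃ J)
    (h : IsAugSum (fun i => T (e i)) y) : IsAugSum T y :=
  ⟨.of_equiv e h.fst, fun s => .of_equiv e (h.snd s)⟩

theorem map_mk (f : C.hom Y X) {T : I → AugBar C X Z} {y : AugBar C X Z} (h : IsAugSum T y) :
    IsAugSum (fun i => AugBar.mk f (T i)) (AugBar.mk f y) :=
  ⟨.of_forall_eq_zero fun _ => rfl, fun s => match s with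
    | 0 => h.fst.map (mkU f)
    | s + 1 => (h.snd s).map (mkS s f)⟩

/-- The defining recursion of `AugBar.geom` is read as a sum over the number of inserted copies.
Finiteness in each length follows by induction, since a leading $a$ lowers the remaining length by
one. -/
theorem geom (a : C.hom X X) {T : I → AugBar C X Z} {y : AugBar C X Z} (h : IsAugSum T y) :
    IsAugSum (fun x : ℕ × I => (AugBar.mk a)^[x.1] (T x.2)) (AugBar.geom a y) := by
  have h1 : IsFinSum (fun x : ℕ × I => ((AugBar.mk a)^[x.1] (T x.2)).1) y.1 := by
    rw [← add_zero y.1]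
    refine .of_nat_prod h.fst (.of_forall_eq_zero fun x => ?_)
    rw [Function.iterate_succ_apply', mk_fst]
  refine ⟨h1, fun s => ?_⟩
  induction s with
  | zero =>
    refine .of_nat_prod (h.snd 0) ?_
    simp only [Function.iterate_succ_apply']
    exact h1.map (mkU a)
  | succ s ih =>
    refine .of_nat_prod (h.snd (s + 1)) ?_
    simp only [Function.iterate_succ_apply']
    exact ih.map (mkS s a)

end IsAugSum
end Bimod.AugBar
end sums

/-! ### Primed tensors, their span, and the expansion of the recursive map on them. -/

namespace Path
open DG.Bimod

section
variable {C : DGCat.{u, v} k Γ} {Y Y' X : C.Obj}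

/-- The element `[f_0, …, f_{r+1}]'` of the length `r` part of the bar complex. -/
def primed : ∀ {Y Y' : C.Obj} (p : Path C Y Y'), (barS C p.len).obj Y Y'
  | _, _, last _ _ f _ _ g _ => mkU f (shU g)
  | _, _, cons _ _ f _ p => mkS p.len f p.primed

theorem tw_neg_nsmul_ι (n : ℕ) {i : Γ} {f : C.hom Y X} (hf : f ∈ (C.hom Y X).gr i) :
    (C.hom Y X).tw (-(n • ι)) f = sgn k (n * form ι i) • f := by
  rw [DGMod.tw_neg, DGMod.tw_apply _ _ hf, map_nsmul, AddMonoidHom.nsmul_apply, nsmul_eq_mul]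

/-- The identity, as a map from the bar complex to its shift. -/
def shS (s : ℕ) : (barT C s).obj Y Y' →ₗ[k] (barS C s).obj Y Y' := sh (M := barT C s) (-(s • ι))

/-- This is the origin of $\sigma$: prepending $f$ to a sequence of length $s$ carries the sign
$(-1)^{sk}$ with $k$ the parity of $f$, which is the recursion `σ_cons`. In the base case the shift
by $\iota$ contributes $(-1)^{k_0}$. -/
theorem primed_eq : ∀ {Y Y' : C.Obj} (p : Path C Y Y'),
    p.primed = sgn k p.σ • shS p.len p.tens
  | _, _, last X i f hf j g hg => by
    rw [σ_last]
    refine (congrArg (fun y => shS (C := C) 0 (preMk (M := unit C) X y g))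
      (DGMod.tw_apply _ ι hf)).trans ?_
    exact (congrArg (shS 0) (LinearMap.map_smul₂ (preMk (M := unit C) X) _ f g)).trans
      (map_smul (shS (C := C) 0) _ _)
  | _, _, cons X i f hf p => by
    rw [σ_cons, sgn_add, mul_smul, smul_comm]
    refine (congrArg (mkS p.len f) (primed_eq p)).trans ?_
    refine (map_smul (mkS p.len f) _ _).trans (congrArg (sgn k p.σ • ·) ?_)
    refine (congrArg (fun y => shS (C := C) (p.len + 1) (preMk (M := barT C p.len) X y p.tens))
      (tw_neg_nsmul_ι p.len hf)).trans ?_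
    exact (congrArg (shS (p.len + 1)) (LinearMap.map_smul₂ (preMk (M := barT C p.len) X) _ f
      p.tens)).trans (map_smul (shS (C := C) (p.len + 1)) _ _)

theorem bracket'_eq (p : Path C Y Y') : p.bracket' = barInc p.len p.primed := by
  rw [primed_eq, map_smul]; rfl

theorem bracket_eq (p : Path C Y Y') : p.bracket = sgn k p.σ • p.bracket' := by
  rw [bracket', smul_smul, sgn_mul_self, one_smul]

/-- The element `[f_0, …, f_{r+1}]'` of the augmented completed bar complex. -/
def aug : ∀ {Y Y' : C.Obj} (_ : Path C Y Y'), AugBar C Y Y'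
  | _, _, last _ _ f _ _ g _ => AugBar.mk f (shU g, 0)
  | _, _, cons _ _ f _ p => AugBar.mk f p.aug

theorem aug_fst : ∀ {Y Y' : C.Obj} (p : Path C Y Y'), p.aug.1 = 0
  | _, _, last .. => rfl
  | _, _, cons .. => rfl

theorem aug_snd_len : ∀ {Y Y' : C.Obj} (p : Path C Y Y'), p.aug.2 p.len = p.primed
  | _, _, last .. => rfl
  | _, _, cons _ _ f _ p => congrArg (mkS p.len f) (aug_snd_len p)

theorem aug_snd_ne : ∀ {Y Y' : C.Obj} (p : Path C Y Y') {s : ℕ}, p.len ≠ s → p.aug.2 s = 0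
  | _, _, last .., 0, h => (h rfl).elim
  | _, _, last _ _ f .., s + 1, _ => map_zero (mkS s f)
  | _, _, cons _ _ f _ p, 0, _ => (congrArg (mkU f) (aug_fst p)).trans (map_zero _)
  | _, _, cons _ _ f _ p, s + 1, h =>
    (congrArg (mkS s f) (aug_snd_ne p fun e => h (congrArg (· + 1) e))).trans (map_zero _)

/-- Links the bar complex, where sums are stated, with `AugBar`, where they are computed: both
elements are concentrated in length `p.len`. -/
theorem barCoord_bracket' (p : Path C Y Y') (s : ℕ) : barCoord s p.bracket' = p.aug.2 s := by
  rw [bracket'_eq]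
  by_cases h : p.len = s
  · subst h; rw [barCoord_barInc_same, aug_snd_len]
  · rw [barCoord_barInc_ne h, aug_snd_ne p h]

theorem aug_between (j : Γ) (a : C.hom X X) (ha : a ∈ (C.hom X X).gr j) (l : Γ)
    (g : C.hom X Y') (hg : g ∈ (C.hom X Y').gr l) (n : ℕ) :
    ∀ {Y : C.Obj} (i : Γ) (f : C.hom Y X) (hf : f ∈ (C.hom Y X).gr i),
      (between j a ha l g hg n i f hf).aug = AugBar.mk f ((AugBar.mk a)^[n] (shU g, 0)) := by
  induction n with
  | zero => intros; rfl
  | succ n ih =>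
    intro Y i f hf
    rw [Function.iterate_succ_apply']
    exact congrArg (AugBar.mk f) (ih j a ha)

theorem aug_reps (j : Γ) (a : C.hom X X) (ha : a ∈ (C.hom X X).gr j) (p : Path C X Y') (n : ℕ) :
    (reps j a ha p n).aug = (AugBar.mk a)^[n] p.aug := by
  induction n with
  | zero => rfl
  | succ n ih => rw [Function.iterate_succ_apply']; exact congrArg (AugBar.mk a) ih

/-- The map `[f_0, …, f_{r+1}]' ↦ [f, f_0, …, f_{r+1}]'` on the bar complex. -/
def barMk (f : C.hom Y X) : (bar C).obj X Y' →ₗ[k] (bar C).obj Y Y' :=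
  barLift fun r => barInc (r + 1) ∘ₗ mkS r f

theorem barMk_barInc (f : C.hom Y X) (r : ℕ) (x : (barS C r).obj X Y') :
    barMk f (barInc r x) = barInc (r + 1) (mkS r f x) :=
  barLift_barInc _ r x

theorem barMk_bracket' {i : Γ} {f : C.hom Y X} (hf : f ∈ (C.hom Y X).gr i) (p : Path C X Y') :
    barMk f p.bracket' = (cons X i f hf p).bracket' := by
  rw [bracket'_eq, barMk_barInc, bracket'_eq]; rfl

/-- Decomposing every factor into homogeneous parts reduces to prepending a homogeneous $f$. -/
theorem barInc_mem_span (r : ℕ) : ∀ {Y : C.Obj} (x : (barS C r).obj Y Y'),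
    barInc r x ∈ Submodule.span k (Set.range (bracket' (C := C) (Y := Y) (Y' := Y'))) := by
  induction r with
  | zero =>
    intro Y x
    induction x using mkU_ind with
    | zero => rw [map_zero]; exact Submodule.zero_mem _
    | add x y hx hy => rw [map_add]; exact Submodule.add_mem _ hx hy
    | mk X f b =>
      rw [← shU_unshU b]; generalize unshU b = g
      induction f using DGMod.hom_ind with
      | zero => rw [map_zero, LinearMap.zero_apply, map_zero]; exact Submodule.zero_mem _
      | add f f' h h' =>
        rw [map_add, LinearMap.add_apply, map_add]; exact Submodule.add_mem _ h h'
      | mem i f hf =>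
        induction g using DGMod.hom_ind with
        | zero => rw [map_zero, map_zero, map_zero]; exact Submodule.zero_mem _
        | add g g' h h' => rw [map_add, map_add, map_add]; exact Submodule.add_mem _ h h'
        | mem j g hg =>
          refine Submodule.subset_span ⟨last X i f hf j g hg, ?_⟩
          rw [bracket'_eq]; rfl
  | succ r ih =>
    intro Y x
    induction x using mkS_ind with
    | zero => rw [map_zero]; exact Submodule.zero_mem _
    | add x y hx hy => rw [map_add]; exact Submodule.add_mem _ hx hy
    | mk X f b =>
      induction f using DGMod.hom_ind with
      | zero => rw [map_zero, LinearMap.zero_apply, map_zero]; exact Submodule.zero_mem _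
      | add f f' h h' =>
        rw [map_add, LinearMap.add_apply, map_add]; exact Submodule.add_mem _ h h'
      | mem i f hf =>
        -- Prepending a homogeneous morphism sends primed tensors to primed tensors, hence the span
        -- into the span; the inductive hypothesis then applies to $b$.
        have h : Submodule.span k (Set.range (bracket' (C := C) (Y := X) (Y' := Y'))) ≤
            (Submodule.span k (Set.range (bracket' (C := C) (Y := Y) (Y' := Y')))).comap
              (barMk f) := by
          refine Submodule.span_le.2 ?_
          rintro _ ⟨p, rfl⟩
          exact Submodule.subset_span ⟨cons X i f hf p, (barMk_bracket' hf p).symm⟩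
        rw [← barMk_barInc]
        exact h (ih b)

theorem span_bracket' (Y Y' : C.Obj) :
    Submodule.span k (Set.range (bracket' (C := C) (Y := Y) (Y' := Y'))) = ⊤ := by
  refine eq_top_iff.2 fun x _ => ?_
  induction x using bar_ind with
  | zero => exact Submodule.zero_mem _
  | add x y hx hy => exact Submodule.add_mem _ (hx trivial) (hy trivial)
  | inc r x => exact barInc_mem_span r x

end

section
variable {C : DGCat.{u, v} k Γ}

/-- The recursion for `Φ` alternates prepending $f_u$ with a geometric series in $\alpha_u$. Each
series contributes one summation index $n_u$, and together they run over all tuples $n$. -/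
theorem isAugSum_insert : ∀ {Y Y' : MCObj C} (p : Path (Tw C) Y Y'),
    AugBar.IsAugSum (fun n => (p.insert n).aug) ((TwFunctor.id C).Φ p.len Y Y' p.primed)
  | Y, Y', last X i f hf j g hg => by
    have h := AugBar.IsAugSum.map_mk (C := C) (Y := Y.obj) f
      ((AugBar.IsAugSum.of_unique fun _ : Unit =>
        ((shU g, 0) : AugBar C X.obj Y'.obj)).geom X.α)
    have h' := AugBar.IsAugSum.of_equiv (T := fun n : Fin 1 → ℕ =>
      (insert (last (C := Tw C) X i f hf j g hg) n).aug)
      -- With a single intermediate object the series is applied to the one-term sum $[g]'$, so its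
      -- index set $\mathbb N\times\mathrm{Unit}$ must be identified with one-entry tuples.
      ((Equiv.prodPUnit ℕ).trans (Equiv.funUnique (Fin 1) ℕ).symm) (y := _) (by
        convert h using 2 with x
        exact aug_between (C := C) ι X.α X.α_mem j g hg x.1 i f hf)
    refine (congrArg (AugBar.IsAugSum _) ?_).mp h'
    exact ((TwFunctor.id C).Φ_mkU (Y := Y) (X := X) (Z := Y') f (shU g)).symm
  | Y, Y', cons X i f hf p => by
    have h := AugBar.IsAugSum.map_mk (C := C) (Y := Y.obj) f ((isAugSum_insert p).geom X.α)
    have h' := AugBar.IsAugSum.of_equiv (T := fun n : Fin (p.len + 1 + 1) → ℕ =>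
      (insert (cons (C := Tw C) X i f hf p) n).aug)
      (Fin.consEquiv fun _ => ℕ) (y := _) (by
        convert h using 2 with x
        exact congrArg (AugBar.mk (C := C) (Y := Y.obj) f)
          (aug_reps (C := C) ι X.α X.α_mem (p.insert x.2) x.1))
    refine (congrArg (AugBar.IsAugSum _) ?_).mp h'
    exact ((TwFunctor.id C).Φ_mkS (Y := Y) (X := X) (Z := Y') p.len f p.primed).symm

theorem isSum_insert {Y Y' : MCObj C} (p : Path (Tw C) Y Y') :
    IsSum (fun n => (p.insert n).bracket') ((TwFunctor.id C).Φhat Y Y' p.bracket') := by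
  intro s
  have h := (isAugSum_insert p).snd s
  have e : (fun n => barCoord s (p.insert n).bracket') = fun n => (p.insert n).aug.2 s :=
    funext fun n => barCoord_bracket' (p.insert n) s
  have e' : hatComp s ((TwFunctor.id C).Φhat Y Y' p.bracket') =
      ((TwFunctor.id C).Φ p.len Y Y' p.primed).2 s := by
    refine (congrArg (fun y => hatComp s ((TwFunctor.id C).Φhat Y Y' y))
      (bracket'_eq (C := Tw C) p)).trans ?_
    exact (TwFunctor.id C).hatComp_Φhat p.len s p.primed
  rw [← e, ← e'] at h
  exact ⟨h.finite_support, h.eq_finsum⟩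

end
end Path

/-! ### The defining formula, uniqueness, and the explicit signs. -/

section formula
variable {C : DGCat.{u, v} k Γ}

/-- The sum is prescribed in every length, and an element of the product is determined by its
components. -/
theorem IsSum.unique {I : Type w} {Y Y' : C.Obj} {T : I → (Bimod.bar C).obj Y Y'}
    {x x' : (Bimod.barHat C).obj Y Y'} (h : IsSum T x) (h' : IsSum T x') : x = x' :=
  Bimod.hatComp_ext fun s => (h s).2.trans (h' s).2.symm

theorem IsSum.smul {I : Type w} {Y Y' : C.Obj} {T : I → (Bimod.bar C).obj Y Y'}
    {x : (Bimod.barHat C).obj Y Y'} (c : k) (h : IsSum T x) :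
    IsSum (fun i => c • T i) (c • x) := by
  intro s
  have e : (fun i => Bimod.barCoord s (c • T i)) = fun i => c • Bimod.barCoord s (T i) :=
    funext fun i => map_smul _ c (T i)
  constructor
  · change (Function.support fun i => Bimod.barCoord s (c • T i)).Finite
    rw [e]
    exact (h s).1.subset (Function.support_const_smul_subset c _)
  · change Bimod.hatComp s (c • x) = ∑ᶠ i, Bimod.barCoord s (c • T i)
    rw [e, map_smul]
    refine (congrArg (c • ·) (h s).2).trans ?_
    exact map_finsum (LinearMap.lsmul k ((Bimod.barS C s).obj Y Y') c) (h s).1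

theorem Ξ_formula : XiFormula (C := C) Ξ :=
  fun _ _ p => ⟨_, p.isSum_insert, rfl⟩

theorem XiFormula.unique
    {F F' : ∀ Y Y' : MCObj C, (Bimod.bar (Tw C)).obj Y Y' →ₗ[k] (twBarTw C).obj Y Y'}
    (h : XiFormula F) (h' : XiFormula F') : F = F' := by
  funext Y Y'
  refine LinearMap.ext_on_range (Path.span_bracket' (C := Tw C) Y Y') fun p => ?_
  obtain ⟨x, hx, e⟩ := h Y Y' p
  obtain ⟨x', hx', e'⟩ := h' Y Y' p
  rw [e, e', hx.unique hx']

/-- The primed formula multiplied by $(-1)^{\sigma(k)}$: in each summand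
$\sigma(k)+\sigma(l)=\tau(n)$ modulo 2, by `Path.σ_insert`. -/
theorem Ξ_signFormula : XiSignFormula (C := C) Ξ := by
  intro Y Y' p
  refine ⟨sgn k p.σ • (TwFunctor.id C).Φhat Y Y' p.bracket', ?_, ?_⟩
  · refine (congrArg (IsSum · _) (funext fun n => ?_)).mp (p.isSum_insert.smul (sgn k p.σ))
    rw [Path.bracket', smul_smul, Path.σ_insert, ← sgn_add, ← add_assoc, CharTwo.add_self_eq_zero,
      zero_add]
  · refine (congrArg (Ξ Y Y') (Path.bracket_eq (C := Tw C) p)).trans ?_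
    exact (map_smul (Ξ Y Y') (sgn k p.σ) _).trans (map_smul (sandwichL Y Y') (sgn k p.σ) _).symm

end formula

end
end DG

theorem mainTheorem4 {k : Type*} [CommRing k] {Γ : Type*} [AddCommGroup Γ] [DG.SignedGrading Γ]
    (C : DG.DGCat k Γ) :
    ∃ Ξ : ∀ Y Y' : DG.MCObj C,
        (DG.Bimod.bar (DG.Tw C)).obj Y Y' →ₗ[k] (DG.twBarTw C).obj Y Y',
      DG.XiFormula Ξ ∧ (∀ Ξ', DG.XiFormula Ξ' → Ξ' = Ξ) ∧
      DG.IsClosedBimodMap (DG.Bimod.bar (DG.Tw C)) (DG.twBarTw C) Ξ ∧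
      DG.XiSignFormula Ξ ∧
      ∀ (Y Y' : DG.MCObj C) (p : DG.Path (DG.Tw C) Y Y') (n : Fin (p.len + 1) → ℕ),
        (p.insert n).σ - p.σ = p.insertSign n :=
  ⟨DG.Ξ, DG.Ξ_formula, fun _ h => h.unique DG.Ξ_formula, DG.Ξ_closed, DG.Ξ_signFormula,
    fun _ _ p n => sub_eq_of_eq_add' (p.σ_insert n)⟩
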